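/- **Paths and tiles.** A path of length $N$ is a word $\lambda$ in $U$ (step $(1,1)$) and $D$ (step $(1,-1)$), drawn from the origin. Let $h_\lambda(x)$ denote its height at abscissa $x$. For two paths $\lambda,\mu$ of length $N$ with $h_\lambda\le h_\mu$ everywhere, the shape $\lambda/\mu$ is the set of boxes (unit squares with sides parallel to the steps) with center $(x,y)$, $1\le x\le N$, $h_\lambda(x)<y<h_\mu(x)$, $y\not\equiv h_\lambda(x)\pmod 2$. The boxes centered on $x=N$ are called anchor boxes. A ballot tile of length $(2n,n')$ is a ribbon of boxes whose centers form a translate of a path from $(0,0)$ to $(2n+n',n')$ that stays weakly above $y=0$. A Dyck tile is a ballot tile of length $(2n,0)$. A tiling of $\lambda/\mu$ is cover-inclusive if every tile, moved down by one box (by $(0,-2)$), is either entirely strictly below $\lambda$ or contained in another tile. **Dyck generating function.** Let $$P^{\mathrm{Dyck}}_\lambda=\sum_{\mu}\sum_{T}q^{\mathrm{art}(T)},$$ where $\mu$ runs over the paths weakly above $\lambda$ with the same end points as $\lambda$, $T$ runs over the cover-inclusive tilings of $\lambda/\mu$ by Dyck tiles, and $\mathrm{art}(T)$ is half of (number of boxes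 plus number of tiles). **Ballot generating function of type BI.** Let $$P^{I}_{\lambda,*}=P^I_\lambda=\sum_{\mu}\sum_{T}q^{\mathrm{art}(T)},$$ where $\mu$ runs over the paths of length $N$ weakly above $\lambda$ (with any end point), and $T$ runs over the cover-inclusive tilings of $\lambda/\mu$ by ballot tiles such that the rightmost box of every tile of length $(2n,n')$ with $n'\ge 1$ is an anchor box, the number of tiles of length $(2n,n')$ is even for each $n$ and each odd $n'$, and there is no tile of length $(2n,n')$ with $n'>0$ even. Here $\mathrm{art}(T)$ is half of (number of boxes plus number of Dyck tiles). Let $P(M,N)=P^I_{D^NU^M,*}$. **Theorem.** Let $\lambda$ be a path with at least one $D$. A valley of $\lambda$ is a point between two consecutive steps $DU$; the end point of $\lambda$ also counts as a valley if the last step of $\lambda$ is $D$. The minimum point of $\lambda$ is the leftmost of its lowest valleys. Cut $\lambda$ at its minimum point, $\lambda=\lambda_1\circ\lambda_2$. Let $M_2$ and $N_2$ be the numbers of $U$'s and of $D$'s in $\lambda_2$, and let $N_1$ be the number of $D$'s in $\lambda_1$. Then $$P^{I}_{\lambda,*}=P^{\mathrm{Dyck}}_{\lambda_1}\cdot P(M_2+N_2,N_1)\cdot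 P^{I}_{\lambda_2,*}.$$ -/

import Mathlib

open Polynomial

namespace BallotTiling

/-- An up step `(1,1)` or a down step `(1,-1)`. A lattice path starting at the origin is the list
of its steps. -/
inductive Step where
  | U : Step
  | D : Step
  deriving DecidableEq

instance : Fintype Step := ⟨{Step.U, Step.D}, fun s => by cases s <;> simp⟩

def Step.rise : Step → ℤ
  | Step.U => 1
  | Step.D => -1

/-- The ordinate of the path `l` at abscissa `i` (for `i ≤ l.length`). -/
def height (l : List Step) (i : ℕ) : ℤ := ((l.take i).map Step.rise).sum

/-- The paths with `n` steps. -/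
def paths (n : ℕ) : Finset (List Step) :=
  (Finset.univ : Finset (Fin n → Step)).image List.ofFn

/-- The path `m` lies weakly above the path `l`. -/
def IsAbove (m l : List Step) : Prop :=
  m.length = l.length ∧ ∀ i ≤ l.length, height l i ≤ height m i

/-- `w` is a ballot path of length `(2n,n')`: it goes from `(0,0)` to `(2n+n',n')` and does not go
below the line `y = 0`. It is a Dyck path when `n' = 0`. -/
def IsBallotPath (w : List Step) (n n' : ℕ) : Prop :=
  w.length = 2 * n + n' ∧ height w w.length = n' ∧ ∀ i ≤ w.length, 0 ≤ height w i

/-- A box, a unit square turned by 45 degrees (its diagonals have length 2, its sides are parallel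
to the steps), is recorded by its center. -/
abbrev Box := ℕ × ℤ

/-- The boxes between the lower path `l` and the upper path `m`, both with `N` steps. Boxes with
center on the line `x = N` are the anchor boxes; there are none when `l` and `m` end at the same
point. -/
noncomputable def region (l m : List Step) : Finset Box :=
  (Finset.Icc 1 l.length).biUnion fun x =>
    ((Finset.Ioo (height l x) (height m x)).filter fun y => Odd (y - height l x)).image
      fun y => (x, y)

/-- The ribbon whose box centers form the translate of the path `w` that starts at `b`. -/
def ribbon (b : Box) (w : List Step) : Finset Box :=
  (Finset.range (w.length + 1)).image fun i => (b.1 + i, b.2 + height w i)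

/-- `t` is a ballot tile of length `(2n,n')`. -/
def IsBallotTile (t : Finset Box) (n n' : ℕ) : Prop :=
  ∃ (b : Box) (w : List Step), IsBallotPath w n n' ∧ t = ribbon b w

/-- `t` is a Dyck tile, that is, a ballot tile of length `(2n,0)` for some `n`. -/
def IsDyckTile (t : Finset Box) : Prop := ∃ n, IsBallotTile t n 0

/-- The set `T` of tiles covers `R` without overlaps. -/
def Tiles (T : Finset (Finset Box)) (R : Finset Box) : Prop :=
  (∀ t ∈ T, ∀ t' ∈ T, t ≠ t' → Disjoint t t') ∧ T.biUnion id = R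

/-- If a tile is moved down by one box (a diagonal of a box has length 2), then it is strictly
below the lower path `l` or contained in another tile. -/
def CoverInclusive (l : List Step) (T : Finset (Finset Box)) : Prop :=
  ∀ t ∈ T, (∀ b ∈ t, b.2 - 2 < height l b.1) ∨ ∃ t' ∈ T, ∀ b ∈ t, (b.1, b.2 - 2) ∈ t'

open Classical in
/-- The cover-inclusive Dyck tilings of the skew shape `l/m`. -/
noncomputable def dyckTilings (l m : List Step) : Finset (Finset (Finset Box)) :=
  (region l m).powerset.powerset.filter fun T =>
    (∀ t ∈ T, IsDyckTile t) ∧ Tiles T (region l m) ∧ CoverInclusive l T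

open Classical in
/-- The cover-inclusive ballot tilings of type BI of the shifted skew shape `l/m`. Since `l.length`
is the largest abscissa of a box of the shape, the condition `b.1 = l.length` says that the rightmost
box of a tile of length `(2n,n')` with `1 ≤ n'` is an anchor box. -/
noncomputable def ballotTilings (l m : List Step) : Finset (Finset (Finset Box)) :=
  (region l m).powerset.powerset.filter fun T =>
    ((∀ t ∈ T, ∃ n n', IsBallotTile t n n') ∧ Tiles T (region l m) ∧ CoverInclusive l T) ∧
    (∀ t ∈ T, ∀ n n', IsBallotTile t n n' → 1 ≤ n' → ∃ b ∈ t, b.1 = l.length) ∧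
    (∀ n n', Odd n' → Even (T.filter fun t => IsBallotTile t n n').card) ∧
    (∀ n n', Even n' → 0 < n' → (T.filter fun t => IsBallotTile t n n').card = 0)

open Classical in
/-- `(area + tiles) / 2` for one tile: `area` is the number of its boxes, `tiles` is `1` for a Dyck
tile and `0` for a ballot tile of length `(2n,n')` with `1 ≤ n'`. The division is exact for Dyck
tiles and for odd `n'`. -/
noncomputable def tileArt (t : Finset Box) : ℕ :=
  (t.card + if IsDyckTile t then 1 else 0) / 2

noncomputable def art (T : Finset (Finset Box)) : ℕ := ∑ t ∈ T, tileArt t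

open Classical in
/-- The generating function of cover-inclusive Dyck tilings with lower path `l`. The upper path
runs above `l` between the same end points. For a Dyck path `l` the upper paths are then the Dyck
paths above `l`. Putting up steps before `l` and down steps after it, so as to turn `l` into a Dyck
path, does not change the shapes in question, as every path above has the same such steps. -/
noncomputable def dyckGF (l : List Step) : ℤ[X] :=
  ∑ m ∈ (paths l.length).filter fun m =>
      IsAbove m l ∧ height m l.length = height l l.length,
    ∑ T ∈ dyckTilings l m, (X : ℤ[X]) ^ art T

open Classical in
/-- The generating function of cover-inclusive ballot tilings of type BI with lower path `l`.
Here `l` may be any path: putting up steps before it does not change the shapes in question. -/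
noncomputable def ballotGF (l : List Step) : ℤ[X] :=
  ∑ m ∈ (paths l.length).filter fun m => IsAbove m l,
    ∑ T ∈ ballotTilings l m, (X : ℤ[X]) ^ art T

/-- The generating function of ballot tilings of type BI with lower path `D^N U^M`. -/
noncomputable def ballotGFDU (M N : ℕ) : ℤ[X] :=
  ballotGF (List.replicate N Step.D ++ List.replicate M Step.U)

/-- The point of abscissa `k` of the path `l` is a valley: it comes after a down step, and it
either comes before an up step or is the end point of `l`. -/
def IsValley (l : List Step) (k : ℕ) : Prop :=
  1 ≤ k ∧ l[k - 1]? = some Step.D ∧ (l[k]? = some Step.U ∨ k = l.length)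

/-- The point of abscissa `k` of the path `l` is the leftmost one among its lowest valleys. -/
def IsMinimumPoint (l : List Step) (k : ℕ) : Prop :=
  IsValley l k ∧
    ∀ j, IsValley l j → height l k < height l j ∨ (height l k = height l j ∧ k ≤ j)

end BallotTiling

/-! Write q for `X` and work in the fraction field of ℤ[X]. There q is not a root of unity, so one
may divide by 1 - q^n.

Cover-inclusiveness makes every tile a vertical translate of a piece of λ. A tiling is therefore
determined by its stacks: over each abscissa, the list of the starting points of the tiles met
there, from bottom to top. Reading λ from left to right gives a transfer process. A tile closes only
at the height of its base, or at the end of λ. At a down step all tiles based at the present height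
close, and as many or one more open. At an up step some number e of the topmost such tiles close,
and e or e - 1 open. The weight is local: a down step costs 1 for each tile of the column, an up
step 1 for each tile that closes (`IsStack.art_tilingOf`). Anchored tiles of positive height
difference are "frozen": they lie below all other tiles, open in even batches, and are paid for when
they open. Thus both generating functions become values of `Wt` (`sum_tilings`, `W1_eq_frozenSum`).

The transform `hat` makes the process tractable, because `hat q m (Phi l)` is the sum for the path
D^m l with empty initial stack (`hat_Phi_replicate`). A down step raises m by one (`hat_down`). A
Dyck path with n up steps, after which the path still has to descend, raises m by n and multiplies
by a scalar proportional to the Gaussian binomial of m + n and n (`dyck_transfer`). At the minimum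
point, λ₁ is a run of up steps, irrelevant for an empty stack, followed by blocks (Dyck path) D.
Hence the sum for λ is C · `hat q N₁ (Phi λ₂)`, where C depends on λ₁ alone (`hat_Phi_desc`). With
λ₂ empty and the end condition of Dyck tilings, the same formula identifies C as the Dyck generating
function.

The path λ₂ never goes below its start. For such paths `hat q m (Phi l)` is its value at m = 0 times
a product `normG` that depends only on m and the length of l (`hat_Phi_eq`). The path U^(M₂+N₂) has
the same length and value 1 at m = 0, so this product is P(M₂+N₂, N₁). -/

namespace BallotTiling

/-! ### A q-binomial transform and Gaussian binomials. -/

section Transform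

variable {K : Type*} [Field K]

/-- The transform `g ↦ ∑ c, [z ^ c] (∏ i < m, (1 + q ^ i z)) * g c`. -/
def hat (q : K) : ℕ → (ℕ → K) → K
  | 0, g => g 0
  | m + 1, g => hat q m g + q ^ m * hat q m (fun c => g (c + 1))

variable (q : K)

theorem hat_add (m : ℕ) (f g : ℕ → K) :
    hat q m (fun c => f c + g c) = hat q m f + hat q m g := by
  induction m generalizing f g with
  | zero => rfl
  | succ m ih => simp only [hat, ih]; ring

theorem hat_smul (m : ℕ) (a : K) (g : ℕ → K) :
    hat q m (fun c => a * g c) = a * hat q m g := by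
  induction m generalizing g with
  | zero => rfl
  | succ m ih => simp only [hat, ih]; ring

theorem hat_zero_fun (m : ℕ) : hat q m (fun _ => 0) = 0 := by
  simpa using hat_smul q m 0 (fun _ => 0)

/-- This is (1 + z) ∏_{i<m} (1 + q^i (q z)) = ∏_{i<m+1} (1 + q^i z). The left side is a down step:
each of the `c` tiles pays q, and one extra tile may open. -/
theorem hat_down (m : ℕ) (g : ℕ → K) :
    hat q m (fun c => q ^ c * (g c + g (c + 1))) = hat q (m + 1) g := by
  induction m generalizing g with
  | zero => simp [hat]
  | succ m ih =>
    have h : (fun c => q ^ (c + 1) * (g (c + 1) + g (c + 1 + 1))) =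
        fun c => q * (q ^ c * ((fun c => g (c + 1)) c + (fun c => g (c + 1)) (c + 1))) := by
      funext c; simp only; ring
    rw [hat, ih, h, hat_smul, ih, hat]
    simp only [hat]
    ring

/-- Split ∏_{i<J+k} (1 + q^i z) after its first `J` factors. The power `q ^ (i * J)` substitutes q^J
z for z in the remaining ones. -/
theorem hat_hat (J k : ℕ) (g : ℕ → K) :
    hat q k (fun i => q ^ (i * J) * hat q J (fun c => g (c + i))) = hat q (J + k) g := by
  induction k generalizing g with
  | zero => simp [hat]
  | succ k ih =>
    have h : (fun i => q ^ ((i + 1) * J) * hat q J (fun c => g (c + (i + 1)))) =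
        fun i => q ^ J * (q ^ (i * J) * hat q J (fun c => (fun c => g (c + 1)) (c + i))) := by
      funext i; simp only [add_assoc]; ring
    rw [hat, ih, h, hat_smul, ih (fun c => g (c + 1)), ← add_assoc, hat]
    ring

/-- The summation over the tiles closed before an up step: `e` of the `c` tiles are closed,
and `e` or `e - 1` tiles are opened. -/
def upSum (B : ℕ → ℕ → K) (c : ℕ) : K :=
  ∑ e ∈ Finset.range (c + 1), q ^ e * (B (c - e) e + if e = 0 then 0 else B (c - e) (e - 1))

/-- The term e = c + 1, in which no tile is kept, has the shape of `hat_down`; in all others one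
more tile is kept. -/
theorem upSum_succ (B : ℕ → ℕ → K) (c : ℕ) :
    upSum q B (c + 1) =
      upSum q (fun i => B (i + 1)) c + q * (q ^ c * (B 0 c + B 0 (c + 1))) := by
  rw [upSum, Finset.sum_range_succ, upSum]
  congr 1
  · refine Finset.sum_congr rfl fun e he => ?_
    have : c + 1 - e = c - e + 1 := by
      have := Finset.mem_range.1 he; omega
    rw [this]
  · simp; ring

/-- The constraint (kept) + (closed) = c disappears under the transform: the `m` factors are shared
between the opened tiles, which get `j`, and the kept ones, which get `m - j`. In the induction,
`upSum_succ` and `hat_down` supply the summand j = m + 1. -/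
theorem hat_upSum (m : ℕ) (B : ℕ → ℕ → K) :
    hat q m (upSum q B) = ∑ j ∈ Finset.range (m + 1),
      q ^ j * hat q (m - j) (fun i => q ^ (i * j) * hat q j (B i)) := by
  induction m generalizing B with
  | zero => simp [hat, upSum]
  | succ m ih =>
    have h1 : (fun c => upSum q B (c + 1)) = fun c =>
        upSum q (fun i => B (i + 1)) c + q * (q ^ c * (B 0 c + B 0 (c + 1))) := by
      funext c; exact upSum_succ q B c
    rw [hat, h1, hat_add, hat_smul, hat_down, ih, ih, Finset.sum_range_succ _ (m + 1)]
    have h2 : ∀ j ∈ Finset.range (m + 1),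
        q ^ j * hat q (m + 1 - j) (fun i => q ^ (i * j) * hat q j (B i)) =
        q ^ j * hat q (m - j) (fun i => q ^ (i * j) * hat q j (B i)) +
        q ^ m * (q ^ j * hat q (m - j) (fun i => q ^ (i * j) * hat q j (B (i + 1)))) := by
      intro j hj
      have hj' : j ≤ m := by have := Finset.mem_range.1 hj; omega
      have h3 : m + 1 - j = m - j + 1 := by omega
      have h4 : (fun i => q ^ ((i + 1) * j) * hat q j (B (i + 1))) =
          fun i => q ^ j * (q ^ (i * j) * hat q j (B (i + 1))) := by
        funext i; ring
      rw [h3, hat, h4, hat_smul]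
      have h5 : q ^ m = q ^ (m - j) * q ^ j := by rw [← pow_add]; congr 1; omega
      rw [h5]; ring
    rw [Finset.sum_congr rfl h2, Finset.sum_add_distrib, ← Finset.mul_sum]
    simp only [Nat.sub_self, hat]
    simp
    ring

/-- The shift of a function on `ℕ` by one place. -/
def delay (g : ℕ → K) (c : ℕ) : K := if c = 0 then 0 else g (c - 1)

theorem hat_delay (m : ℕ) (g : ℕ → K) :
    hat q m (delay g) = ∑ i ∈ Finset.range m, q ^ i * hat q i g := by
  induction m generalizing g with
  | zero => simp [hat, delay]
  | succ m ih => rw [hat, ih, Finset.sum_range_succ]; simp [delay]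

theorem hat_pow_succ (m : ℕ) : hat q m (fun c => q ^ c) = ∏ i ∈ Finset.range m, (1 + q ^ (i + 1)) := by
  induction m with
  | zero => simp [hat]
  | succ m ih =>
    have : (fun c => q ^ (c + 1)) = fun c => q * q ^ c := by funext c; ring
    rw [hat, this, hat_smul, ih, Finset.prod_range_succ]; ring

theorem hat_single (m : ℕ) (v : K) : hat q m (fun i => if i = 0 then v else 0) = v := by
  cases m with
  | zero => simp [hat]
  | succ m =>
    induction m with
    | zero => simp [hat]
    | succ m ih => rw [hat, ih]; simp [hat_zero_fun]

/-- `(1 - q ^ (m + 1)) ⋯ (1 - q ^ (m + n))`. -/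
def qP (n m : ℕ) : K := ∏ i ∈ Finset.range n, (1 - q ^ (m + 1 + i))

/-- The `q`-binomial coefficient of `m + n` and `n`. -/
def qb (n m : ℕ) : K := qP q n m / qP q n 0

theorem qP_add (a b m : ℕ) : qP q (a + b) m = qP q a m * qP q b (m + a) := by
  rw [qP, Finset.prod_range_add]
  congr 1
  refine Finset.prod_congr rfl fun i _ => ?_
  congr 2; ring

theorem qP_succ_left (n m : ℕ) : qP q (n + 1) m = (1 - q ^ (m + 1)) * qP q n (m + 1) := by
  rw [add_comm, qP_add]; simp [qP]

theorem qP_succ_right (n m : ℕ) : qP q (n + 1) m = qP q n m * (1 - q ^ (m + n + 1)) := by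
  rw [qP_add]; simp [qP]

theorem qP_ne_zero {q : K} (hq : ∀ n, 0 < n → q ^ n ≠ 1) (n m : ℕ) : qP q n m ≠ 0 :=
  Finset.prod_ne_zero_iff.2 fun i _ => sub_ne_zero.2 (hq _ (by omega)).symm

theorem qb_zero_left (m : ℕ) : qb q 0 m = 1 := by simp [qb, qP]

theorem qb_zero_right {q : K} (hq : ∀ n, 0 < n → q ^ n ≠ 1) (n : ℕ) : qb q n 0 = 1 :=
  div_self (qP_ne_zero hq n 0)

theorem qb_succ_succ {q : K} (hq : ∀ n, 0 < n → q ^ n ≠ 1) (n m : ℕ) :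
    qb q (n + 1) (m + 1) = qb q (n + 1) m + q ^ (m + 1) * qb q n (m + 1) := by
  have h1 := qP_ne_zero hq n 0
  have h2 : (1 - q ^ (0 + n + 1)) ≠ 0 := sub_ne_zero.2 (hq _ (by omega)).symm
  rw [qb, qb, qb, qP_succ_right q n 0, qP_succ_right q n (m + 1), qP_succ_left q n m]
  field_simp
  ring

theorem sum_qb {q : K} (hq : ∀ n, 0 < n → q ^ n ≠ 1) (n m : ℕ) :
    ∑ j ∈ Finset.range (m + 1), q ^ j * qb q n j = qb q (n + 1) m := by
  induction m with
  | zero => simp [qb_zero_right hq]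
  | succ m ih => rw [Finset.sum_range_succ, ih, qb_succ_succ hq]

/-- Trinomial revision: it merges two Gaussian binomials in `m` into one, up to a factor free of
`m`. -/
theorem qb_mul_qb {q : K} (hq : ∀ n, 0 < n → q ^ n ≠ 1) (a b m : ℕ) :
    qb q a m * qb q b (m + a) = qb q b a * qb q (a + b) m := by
  have h1 := qP_ne_zero hq a 0
  have h2 := qP_ne_zero hq b 0
  have h3 := qP_ne_zero hq b (0 + a)
  rw [qb, qb, qb, qb, qP_add, qP_add q a b 0]
  rw [zero_add] at *
  field_simp

end Transform

/-! ### Heights and Dyck paths. -/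

theorem height_zero (l : List Step) : height l 0 = 0 := by simp [height]

theorem height_cons_succ (s : Step) (l : List Step) (i : ℕ) :
    height (s :: l) (i + 1) = s.rise + height l i := by simp [height]

theorem height_append_left (a l : List Step) (i : ℕ) (hi : i ≤ a.length) :
    height (a ++ l) i = height a i := by
  simp [height, List.take_append_of_le_length hi]

theorem height_append_right (a l : List Step) (i : ℕ) :
    height (a ++ l) (a.length + i) = height a a.length + height l i := by
  simp [height, List.take_append, List.take_of_length_le]

/-- The path goes below its starting height. -/
def Low (l : List Step) : Prop := ∃ i ≤ l.length, height l i < 0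

theorem low_down (l : List Step) : Low (Step.D :: l) :=
  ⟨1, by simp, by simp [height, Step.rise]⟩

/-- Dyck paths, through the decomposition at the first return. -/
inductive Dyck : List Step → Prop
  | nil : Dyck []
  | node {a c : List Step} : Dyck a → Dyck c → Dyck (Step.U :: (a ++ Step.D :: c))

/-- The number of up steps. -/
def ups (a : List Step) : ℕ := a.count Step.U

theorem ups_node (a c : List Step) : ups (Step.U :: (a ++ Step.D :: c)) = ups a + 1 + ups c := by
  simp [ups]; ring

theorem Dyck.length {a : List Step} (h : Dyck a) : a.length = 2 * ups a := by
  induction h with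
  | nil => rfl
  | node _ _ iha ihc => rw [ups_node]; simp [iha, ihc]; ring

theorem Dyck.height_length {a : List Step} (h : Dyck a) : height a a.length = 0 := by
  induction h with
  | nil => rfl
  | @node a c _ _ iha ihc =>
    simp only [height, List.take_length] at *
    simp [iha, ihc, Step.rise]

theorem Low.append {a l : List Step} (ha : Dyck a) (h : Low l) : Low (a ++ l) := by
  obtain ⟨i, hi, h⟩ := h
  refine ⟨a.length + i, by simpa using hi, ?_⟩
  rw [height_append_right, ha.height_length]; simpa using h

/-! ### The transfer weight and its behaviour along a Dyck path. -/

section Weight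

variable {K : Type*} [Field K] (q : K) (ok : List Step → Prop) (fin : ℕ → K)

open Classical in
/-- The sum over the numbers `2p` of tiles, among `d` new ones, that extend to the end of the path
`l`. If `R` is positive or `l` is not suitable for such tiles, then `p` has to be `0`. -/
noncomputable def frz (l : List Step) (R : ℕ) (g : ℕ → K) (d : ℕ) : K :=
  ∑ p ∈ Finset.range (d / 2 + 1),
    if p = 0 ∨ (R = 0 ∧ ok l) then q ^ (p * (l.length + 1)) * g (d - 2 * p) else 0

/-- A function on `ℕ` preceded by the value `i`. -/
def push (i : ℕ) (b : ℕ → ℕ) : ℕ → ℕ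
  | 0 => i
  | n + 1 => b n

/-- The weighted number of completions along the path `l` of a stack of open tiles, `c` of which
have their base at the present height, and `b i` have it `i + 1` units lower; `R` is the total
of the `b i`. -/
noncomputable def Wt : List Step → ℕ → ℕ → (ℕ → ℕ) → K
  | [], c, R, _ => if R = 0 then fin c else 0
  | Step.D :: l, c, R, b =>
    q ^ (c + R) * (frz q ok l R (fun d => Wt l (d + b 0) (R - b 0) (fun i => b (i + 1))) c +
      frz q ok l R (fun d => Wt l (d + b 0) (R - b 0) (fun i => b (i + 1))) (c + 1))
  | Step.U :: l, c, R, b =>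
    upSum q (fun i d => frz q ok l (R + i) (fun d => Wt l d (R + i) (push i b)) d) c

variable {ok}

theorem frz_of_not {l : List Step} {R : ℕ} (h : ¬(R = 0 ∧ ok l)) (g : ℕ → K) :
    frz q ok l R g = g := by
  funext d
  rw [frz, Finset.sum_range_succ']
  simp [h]

theorem push_zero : push 0 (0 : ℕ → ℕ) = 0 := by
  funext i; cases i <;> rfl

/-- The condition `0 < R ∨ Low l` excludes frozen tiles throughout `a`: either a live tile lies
below, or the path still has to descend. The scalar `C` is chosen before the end conditions, so it
can be evaluated under one and used under another. Its form as a Gaussian binomial in `m` is what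
the product formulas need later. -/
theorem dyck_transfer {q : K} (hq : ∀ n, 0 < n → q ^ n ≠ 1) {a : List Step} (ha : Dyck a) :
    ∃ C : ℕ → K, (∀ m, C m = C 0 * qb q (ups a) m) ∧
      ∀ (ok : List Step → Prop) (fin : ℕ → K), (∀ l, ok l → ¬ Low l) →
      ∀ (l : List Step) (R : ℕ) (b : ℕ → ℕ), (0 < R ∨ Low l) → ∀ m,
        hat q m (fun c => Wt q ok fin (a ++ l) c R b) =
          q ^ (ups a * R) * (C m * hat q (m + ups a) (fun c => Wt q ok fin l c R b)) := by
  induction ha with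
  | nil => exact ⟨fun _ => 1, by simp [ups, qb_zero_left], by simp [ups]⟩
  | @node a c ha hc iha ihc =>
    obtain ⟨A, hA, hA'⟩ := iha
    obtain ⟨C, hC, hC'⟩ := ihc
    refine ⟨fun m => (∑ j ∈ Finset.range (m + 1), q ^ j * A j) * C (m + (ups a + 1)), ?_, ?_⟩
    · intro m
      have h1 : ∀ m, ∑ j ∈ Finset.range (m + 1), q ^ j * A j = A 0 * qb q (ups a + 1) m := by
        intro m
        rw [← sum_qb hq, Finset.mul_sum]
        refine Finset.sum_congr rfl fun j _ => ?_
        rw [hA j]; ring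
      simp only [h1]
      rw [hC (m + _), hC (0 + _), ups_node]
      have h2 := qb_mul_qb hq (ups a + 1) (ups c) m
      simp only [zero_add, qb_zero_right hq]
      linear_combination A 0 * C 0 * h2
    · intro ok fin hok l R b hl m
      have hno : ∀ l' i, (0 < R ∨ Low l') → ¬(R + i = 0 ∧ ok l') := by
        rintro l' i (h | h) ⟨h1, h2⟩
        · omega
        · exact hok _ h2 h
      have hl2 : 0 < R ∨ Low (c ++ l) := hl.imp id (Low.append hc)
      have e1 : (fun k => Wt q ok fin (Step.U :: (a ++ Step.D :: c) ++ l) k R b) =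
          upSum q (fun i d => Wt q ok fin (a ++ (Step.D :: (c ++ l))) d (R + i) (push i b)) := by
        funext k
        simp only [List.cons_append, List.append_assoc, Wt]
        congr 1
        funext i
        exact frz_of_not q (hno _ _ (Or.inr (Low.append ha (low_down _)))) _
      have e2 : ∀ i, (fun d => Wt q ok fin (Step.D :: (c ++ l)) d (R + i) (push i b)) =
          fun d => q ^ (R + i) * (q ^ d * (Wt q ok fin (c ++ l) (d + i) R b +
            Wt q ok fin (c ++ l) (d + 1 + i) R b)) := by
        intro i
        funext d
        simp only [Wt]
        rw [frz_of_not q (hno _ _ hl2)]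
        simp only [push, Nat.add_sub_cancel]
        rw [pow_add]; ring
      rw [e1, hat_upSum]
      have e3 : ∀ j i, hat q j (fun d =>
          Wt q ok fin (a ++ (Step.D :: (c ++ l))) d (R + i) (push i b)) =
          q ^ ((ups a + 1) * R) * A j * (q ^ (i * (ups a + 1)) *
            hat q (j + ups a + 1) (fun d => Wt q ok fin (c ++ l) (d + i) R b)) := by
        intro j i
        rw [hA' ok fin hok _ _ _ (Or.inr (low_down _)), e2, hat_smul,
          hat_down q _ (fun d => Wt q ok fin (c ++ l) (d + i) R b)]
        ring
      have e4 : ∀ j ∈ Finset.range (m + 1), q ^ j * hat q (m - j) (fun i => q ^ (i * j) *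
          hat q j (fun d => Wt q ok fin (a ++ (Step.D :: (c ++ l))) d (R + i) (push i b))) =
          q ^ ((ups a + 1) * R) * (q ^ j * A j) *
            hat q (m + (ups a + 1)) (fun d => Wt q ok fin (c ++ l) d R b) := by
        intro j hj
        have hj' : j ≤ m := by have := Finset.mem_range.1 hj; omega
        -- The excursion contributes `i * (ups a + 1)` to the exponent, which completes `i * j` to
        -- the shift required by `hat_hat`. The resulting index (j + ups a + 1) + (m - j) is free of
        -- `j`, so the sum over `j` factors out.
        have h6 : (fun i => q ^ (i * j) * hat q j (fun d =>
            Wt q ok fin (a ++ (Step.D :: (c ++ l))) d (R + i) (push i b))) =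
            fun i => q ^ ((ups a + 1) * R) * A j * (q ^ (i * (j + ups a + 1)) *
            hat q (j + ups a + 1) (fun d => (fun d => Wt q ok fin (c ++ l) d R b) (d + i))) := by
          funext i; rw [e3]; ring
        rw [h6, hat_smul, hat_hat q _ _ (fun d => Wt q ok fin (c ++ l) d R b)]
        have : j + ups a + 1 + (m - j) = m + (ups a + 1) := by omega
        rw [this]; ring
      rw [Finset.sum_congr rfl e4, ← Finset.sum_mul, ← Finset.mul_sum,
        hC' ok fin hok _ _ _ hl, ups_node]
      have : m + (ups a + 1) + ups c = m + (ups a + 1 + ups c) := by ring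
      rw [this]; ring

end Weight

/-! ### Decompositions at first passages. -/

theorem Low.exists_dyck_append {l : List Step} (h : Low l) :
    ∃ a c, Dyck a ∧ l = a ++ Step.D :: c := by
  induction hn : l.length using Nat.strong_induction_on generalizing l with
  | _ n ih =>
    subst hn
    match l, h with
    | [], ⟨i, hi, h⟩ => simp [height] at h
    | Step.D :: c, _ => exact ⟨[], c, Dyck.nil, rfl⟩
    | Step.U :: l, ⟨i, hi, h⟩ =>
      cases i with
      | zero => simp [height] at h
      | succ i =>
        rw [height_cons_succ] at h
        simp only [Step.rise, List.length_cons] at h hi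
        obtain ⟨a, c, ha, rfl⟩ := ih _ (by simp) (l := l) ⟨i, by omega, by omega⟩ rfl
        have hc : Low c := by
          by_contra hc
          have hia : a.length + 1 ≤ i := by
            by_contra hlt
            have hi' : i ≤ a.length := by omega
            rw [height_append_left _ _ _ hi'] at h
            have hla : ∀ {a : List Step}, Dyck a → ∀ i ≤ a.length, 0 ≤ height a i := by
              intro a ha
              induction ha with
              | nil => intro i _; simp [height]
              | @node a c ha hc iha ihc =>
                intro i hi
                cases i with
                | zero => simp [height]
                | succ i =>
                  rw [height_cons_succ]
                  rcases Nat.lt_or_ge a.length i with h1 | h1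
                  · obtain ⟨j, rfl⟩ : ∃ j, i = a.length + (j + 1) := ⟨i - a.length - 1, by omega⟩
                    rw [height_append_right, ha.height_length, height_cons_succ]
                    have := ihc j (by simp at hi; omega)
                    simp [Step.rise]; omega
                  · rw [height_append_left _ _ _ h1]
                    have := iha i h1
                    simp [Step.rise]; omega
            have := hla ha i hi'
            omega
          obtain ⟨j, rfl⟩ : ∃ j, i = a.length + (j + 1) := ⟨i - a.length - 1, by omega⟩
          rw [height_append_right, ha.height_length, height_cons_succ] at h
          simp only [Step.rise] at h
          exact hc ⟨j, by simp at hi; omega, by omega⟩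
        obtain ⟨a', c', ha', rfl⟩ := ih _ (by simp; omega) hc rfl
        exact ⟨_, c', Dyck.node ha ha', by simp⟩

/-- Paths that stay weakly above their starting height, through the decomposition at the first
return. -/
inductive NonNeg : List Step → Prop
  | nil : NonNeg []
  | up {l : List Step} : NonNeg l → NonNeg (Step.U :: l)
  | exc {a l : List Step} : Dyck a → NonNeg l → NonNeg (Step.U :: (a ++ Step.D :: l))

theorem height_exc {a : List Step} (ha : Dyck a) (l : List Step) (i : ℕ) :
    height (Step.U :: (a ++ Step.D :: l)) (a.length + (i + 1) + 1) = height l i := by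
  rw [height_cons_succ, height_append_right, ha.height_length, height_cons_succ]
  simp [Step.rise]

/-- A leading `U` is either matched by a first return, which splits off an excursion, or never
undone. -/
theorem nonNeg_of_not_low {l : List Step} (h : ¬ Low l) : NonNeg l := by
  induction hn : l.length using Nat.strong_induction_on generalizing l with
  | _ n ih =>
    subst hn
    match l, h with
    | [], _ => exact .nil
    | Step.D :: c, h => exact absurd (low_down c) h
    | Step.U :: l, h =>
      by_cases hl : Low l
      · obtain ⟨a, c, ha, rfl⟩ := hl.exists_dyck_append
        refine .exc ha (ih _ (by simp; omega) ?_ rfl)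
        rintro ⟨i, hi, h1⟩
        exact h ⟨a.length + (i + 1) + 1, by simp; omega, by rw [height_exc ha]; exact h1⟩
      · exact .up (ih _ (by simp) hl rfl)

theorem NonNeg.not_low {l : List Step} (h : NonNeg l) : ¬ Low l := by
  induction h with
  | nil => rintro ⟨i, _, h⟩; simp [height] at h
  | up h ih =>
    rintro ⟨i, hi, h1⟩
    cases i with
    | zero => simp [height] at h1
    | succ i =>
      rw [height_cons_succ] at h1
      exact ih ⟨i, by simpa using hi, by simp only [Step.rise] at h1; omega⟩
  | @exc a l ha hl ih =>
    intro h
    obtain ⟨a', c, ha', he⟩ := h.exists_dyck_append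
    -- The decomposition at the first passage is unique.
    have key : ∀ {a'}, Dyck a' → ∀ {a} {l c : List Step}, Dyck a →
        a ++ Step.D :: l = a' ++ Step.D :: c → a = a' ∧ l = c := by
      intro a' ha'
      induction ha' with
      | nil =>
        intro a l c ha he
        cases ha with
        | nil => simpa using he
        | node => simp at he
      | @node a1 a2 h1 h2 ih1 ih2 =>
        intro a l c ha he
        cases ha with
        | nil => simp at he
        | @node b1 b2 hb1 hb2 =>
          simp only [List.cons_append, List.append_assoc, List.cons.injEq, true_and] at he
          obtain ⟨rfl, h4⟩ := ih1 hb1 he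
          obtain ⟨rfl, rfl⟩ := ih2 hb2 h4
          exact ⟨rfl, rfl⟩
    cases ha' with
    | nil => simp at he
    | @node a1 a2 h1 h2 =>
      simp only [List.cons_append, List.append_assoc, List.cons.injEq, true_and] at he
      obtain ⟨rfl, rfl⟩ := key h1 ha he
      exact ih (Low.append h2 (low_down c))

/-- Paths whose end point is their strict minimum, through the decomposition at the record
minima. -/
inductive Desc : List Step → Prop
  | nil : Desc []
  | step {a l : List Step} : Dyck a → Desc l → Desc (a ++ Step.D :: l)

theorem desc_of_forall_lt {l : List Step} (h : ∀ i < l.length, height l l.length < height l i) :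
    Desc l := by
  induction hn : l.length using Nat.strong_induction_on generalizing l with
  | _ n ih =>
    subst hn
    by_cases h0 : l = []
    · subst h0; exact .nil
    · have hl : Low l := ⟨l.length, le_rfl, by
        simpa [height_zero] using h 0 (List.length_pos_iff.2 h0)⟩
      obtain ⟨a, c, ha, rfl⟩ := hl.exists_dyck_append
      refine .step ha (ih _ (by simp; omega) (fun i hi => ?_) rfl)
      have h1 := h (a.length + (i + 1)) (by simp; omega)
      rw [List.length_append, List.length_cons, height_append_right, height_append_right,
        height_cons_succ, height_cons_succ] at h1
      omega

/-! ### The transform along descents, up steps and excursions. -/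

section Stack

variable {K : Type*} [Field K] (q : K) (ok : List Step → Prop) (fin : ℕ → K)

theorem frz_zero_fun (l : List Step) (R : ℕ) (d : ℕ) : frz q ok l R (fun _ => 0) d = 0 := by
  simp [frz]

/-- A live tile can end only at the height of its base. The path goes down at most `k` units, and
fewer than `R` tiles have their base within that reach. -/
theorem wt_eq_zero (l : List Step) (k c R : ℕ) (b : ℕ → ℕ)
    (hl : ∀ i ≤ l.length, -(k : ℤ) ≤ height l i) (hb : ∑ i ∈ Finset.range k, b i < R) :
    Wt q ok fin l c R b = 0 := by
  induction l generalizing k c R b with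
  | nil => simp only [Wt]; rw [if_neg (by omega)]
  | cons s l ih =>
    have hl' : ∀ i ≤ l.length, -(k : ℤ) ≤ s.rise + height l i := fun i hi => by
      simpa [height_cons_succ] using hl (i + 1) (by simpa using hi)
    cases s with
    | D =>
      obtain ⟨k, rfl⟩ : ∃ k', k = k' + 1 := by
        have := hl' 0 (by simp)
        simp only [height_zero, Step.rise] at this
        exact ⟨k - 1, by omega⟩
      have h0 : (fun d => Wt q ok fin l (d + b 0) (R - b 0) (fun i => b (i + 1))) = fun _ => 0 := by
        funext d
        refine ih k _ _ _ (fun i hi => ?_) ?_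
        · have := hl' i hi
          simp only [Step.rise] at this
          push_cast at this
          omega
        · rw [Finset.sum_range_succ'] at hb
          omega
      simp only [Wt]
      rw [h0, frz_zero_fun, frz_zero_fun]
      simp
    | U =>
      have h0 : ∀ i, (fun d => Wt q ok fin l d (R + i) (push i b)) = fun _ => 0 := by
        intro i
        funext d
        refine ih (k + 1) _ _ _ (fun i hi => ?_) ?_
        · have := hl' i hi
          simp only [Step.rise] at this
          push_cast
          omega
        · rw [Finset.sum_range_succ']
          simp only [push]
          omega
      simp only [Wt]
      refine Finset.sum_eq_zero fun e _ => ?_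
      simp [h0, frz_zero_fun]

/-- The completions of a stack of `c` tiles with their bases at the starting height of `l`, none
of which extends to the end of `l` unless its base is there. -/
noncomputable def Psi (l : List Step) (c : ℕ) : K := Wt q ok fin l c 0 0

/-- The completions of a stack of `c` tiles with the same starting point. -/
noncomputable def Phi (l : List Step) : ℕ → K := frz q ok l 0 (Psi q ok fin l)

variable {ok}

theorem Phi_of_not {l : List Step} (h : ¬ ok l) : Phi q ok fin l = Psi q ok fin l :=
  frz_of_not q (by simp [h]) _

/-- Either no tile is frozen, or one frozen pair, of weight `q ^ (l.length + 1)`, can be removed.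
The two delays lower `c` by 2 and give 0 for `c < 2`. -/
theorem Phi_of_ok {l : List Step} (h : ok l) (c : ℕ) :
    Phi q ok fin l c = Psi q ok fin l c +
      q ^ (l.length + 1) * delay (delay (Phi q ok fin l)) c := by
  match c with
  | 0 => simp [Phi, frz, delay]
  | 1 => simp [Phi, frz, delay]
  | c + 2 =>
    simp only [delay, Phi, frz, h]
    have : (c + 2) / 2 = c / 2 + 1 := by omega
    rw [this, Finset.sum_range_succ', add_comm]
    congr 1
    · simp
    · rw [if_neg (by omega), if_neg (by omega), Finset.mul_sum]
      refine Finset.sum_congr (by simp) fun p _ => ?_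
      rw [if_pos (by simp), if_pos (by simp)]
      have : c + 2 - 2 * (p + 1) = c + 2 - 1 - 1 - 2 * p := by omega
      rw [this]
      ring

/-- A live tile kept over the up step has its base below all of `l` and could never close. Only i =
0 survives in `hat_upSum`. -/
theorem hat_Psi_up {l : List Step} (hl : ¬ Low l) (m : ℕ) :
    hat q m (Psi q ok fin (Step.U :: l)) =
      ∑ j ∈ Finset.range (m + 1), q ^ j * hat q j (Phi q ok fin l) := by
  have h1 : Psi q ok fin (Step.U :: l) =
      upSum q (fun i => if i = 0 then Phi q ok fin l else fun _ => 0) := by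
    funext c
    simp only [Psi, Wt]
    congr 1
    funext i
    split_ifs with hi
    · subst hi
      rw [push_zero]
      rfl
    · have : (fun d => Wt q ok fin l d (0 + i) (push i 0)) = fun _ => 0 := by
        funext d
        refine wt_eq_zero q ok fin l 0 _ _ _ (fun i hi => ?_) (by simp; omega)
        by_contra h
        exact hl ⟨i, hi, by simpa using h⟩
      funext d
      rw [this, frz_zero_fun]
  rw [h1, hat_upSum]
  refine Finset.sum_congr rfl fun j _ => ?_
  have h2 : (fun i => q ^ (i * j) * hat q j (if i = 0 then Phi q ok fin l else fun _ => 0)) =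
      fun i => if i = 0 then hat q j (Phi q ok fin l) else 0 := by
    funext i
    split_ifs with hi
    · simp [hi]
    · simp [hat_zero_fun]
  rw [h2, hat_single]

theorem hat_sub (m : ℕ) (f g : ℕ → K) :
    hat q m (fun c => f c - g c) = hat q m f - hat q m g := by
  have := hat_add q m (fun c => f c - g c) g
  simp only [sub_add_cancel] at this
  rw [this]; ring

/-- As in `dyck_transfer`, except that tiles opened at the return to the starting height may be
frozen, provided that no live tile is below them, that is, for i = 0. The excess of `Phi` over `Psi`
thus skips the transform in `i` and keeps an index depending on `j`. -/
theorem hat_Psi_exc {a : List Step} (ha : Dyck a) (C : ℕ → K) (hok : ∀ l, ok l → ¬ Low l)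
    (hC : ∀ (l : List Step) (R : ℕ) (b : ℕ → ℕ), (0 < R ∨ Low l) → ∀ m,
        hat q m (fun c => Wt q ok fin (a ++ l) c R b) =
          q ^ (ups a * R) * (C m * hat q (m + ups a) (fun c => Wt q ok fin l c R b)))
    (l : List Step) (m : ℕ) :
    hat q m (Psi q ok fin (Step.U :: (a ++ Step.D :: l))) =
      (∑ j ∈ Finset.range (m + 1), q ^ j * C j) * hat q (m + (ups a + 1)) (Psi q ok fin l) +
      ∑ j ∈ Finset.range (m + 1), q ^ j * C j * (hat q (j + (ups a + 1)) (Phi q ok fin l) -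
        hat q (j + (ups a + 1)) (Psi q ok fin l)) := by
  have e1 : Psi q ok fin (Step.U :: (a ++ Step.D :: l)) =
      upSum q (fun i d => Wt q ok fin (a ++ Step.D :: l) d i (push i 0)) := by
    funext k
    simp only [Psi, Wt, zero_add]
    congr 1
    funext i
    exact frz_of_not q (fun h => hok _ h.2 (Low.append ha (low_down _))) _
  set δ : ℕ → K := fun d => Phi q ok fin l d - Psi q ok fin l d with hδ
  have e2 : ∀ i, (fun d => Wt q ok fin (Step.D :: l) d i (push i 0)) =
      fun d => q ^ i * (q ^ d * (Psi q ok fin l (d + i) + Psi q ok fin l (d + 1 + i))) +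
        (if i = 0 then 1 else 0) * (q ^ d * (δ d + δ (d + 1))) := by
    intro i
    funext d
    simp only [Wt, push]
    have h3 : (fun d => Wt q ok fin l (d + i) (i - i) (fun i => (0 : ℕ → ℕ) i)) =
        fun d => Psi q ok fin l (d + i) := by
      funext d; simp only [Nat.sub_self]; rfl
    rw [h3]
    by_cases hi : i = 0
    · subst hi
      simp only [hδ, Phi, add_zero, if_true]
      have : (fun d => Psi q ok fin l d) = Psi q ok fin l := rfl
      rw [this]; ring
    · rw [frz_of_not q (by simp [hi])]
      simp only [hi, if_false]
      rw [pow_add]; ring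
  have e3 : ∀ j i, hat q j (fun d => Wt q ok fin (a ++ Step.D :: l) d i (push i 0)) =
      C j * (q ^ (i * (ups a + 1)) *
            hat q (j + ups a + 1) (fun d => Psi q ok fin l (d + i))) +
        (if i = 0 then C j * hat q (j + ups a + 1) δ else 0) := by
    intro j i
    rw [hC _ _ _ (Or.inr (low_down _)), e2, hat_add, hat_smul, hat_smul,
      hat_down q _ (fun d => Psi q ok fin l (d + i)), hat_down]
    by_cases hi : i = 0
    · subst hi; simp; ring
    · simp only [hi, if_false]; ring
  have e4 : ∀ j ∈ Finset.range (m + 1), q ^ j * hat q (m - j) (fun i => q ^ (i * j) *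
      hat q j (fun d => Wt q ok fin (a ++ Step.D :: l) d i (push i 0))) =
      (q ^ j * C j) * hat q (m + (ups a + 1)) (Psi q ok fin l) +
      q ^ j * C j * hat q (j + (ups a + 1)) δ := by
    intro j hj
    have hj' : j ≤ m := by have := Finset.mem_range.1 hj; omega
    have h6 : (fun i => q ^ (i * j) * hat q j (fun d =>
        Wt q ok fin (a ++ Step.D :: l) d i (push i 0))) =
        fun i => C j * (q ^ (i * (j + ups a + 1)) *
        hat q (j + ups a + 1) (fun d => Psi q ok fin l (d + i))) +
        if i = 0 then C j * hat q (j + ups a + 1) δ else 0 := by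
      funext i; rw [e3]
      by_cases hi : i = 0
      · subst hi; simp
      · simp only [hi, if_false]; ring
    rw [h6, hat_add, hat_smul, hat_hat, hat_single]
    have : j + ups a + 1 + (m - j) = m + (ups a + 1) := by omega
    rw [this]; ring_nf
  rw [e1, hat_upSum, Finset.sum_congr rfl e4, Finset.sum_add_distrib, ← Finset.sum_mul]
  simp only [hδ, hat_sub]

/-- Each block (Dyck path) D acts by a scalar and a shift of `m`, and before the end of `u` no tile
can be frozen. That `C` precedes `ok`, `fin` and `l` allows the ballot and the Dyck sums to share
it. -/
theorem hat_Phi_desc {q : K} (hq : ∀ n, 0 < n → q ^ n ≠ 1) {u : List Step} (hu : Desc u) :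
    ∃ C : ℕ → K, ∀ (ok : List Step → Prop) (fin : ℕ → K), (∀ l, ok l → ¬ Low l) →
      ∀ (l : List Step) (m : ℕ), hat q m (Phi q ok fin (u ++ l)) =
        C m * hat q (m + u.count Step.D) (Phi q ok fin l) := by
  induction hu with
  | nil => exact ⟨fun _ => 1, by simp⟩
  | @step a u ha hu ih =>
    obtain ⟨C, hC⟩ := ih
    obtain ⟨A, -, hA⟩ := dyck_transfer hq ha
    refine ⟨fun m => A m * C (m + ups a + 1), fun ok fin hok l m => ?_⟩
    have h1 : Low ((a ++ Step.D :: u) ++ l) := by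
      rw [List.append_assoc]; exact Low.append ha (low_down _)
    have h2 : hat q m (Phi q ok fin ((a ++ Step.D :: u) ++ l)) =
        A m * hat q (m + ups a) (Psi q ok fin (Step.D :: (u ++ l))) := by
      rw [Phi_of_not q fin (fun h => hok _ h h1)]
      have := hA ok fin hok (Step.D :: (u ++ l)) 0 0 (Or.inr (low_down _)) m
      simp only [mul_zero, pow_zero, one_mul] at this
      rw [List.append_assoc, List.cons_append]
      exact this
    have h3 : Psi q ok fin (Step.D :: (u ++ l)) = fun c => q ^ c * (Phi q ok fin (u ++ l) c +
        Phi q ok fin (u ++ l) (c + 1)) := by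
      funext c
      simp only [Psi, Wt]
      rfl
    rw [h2, h3, hat_down, hC ok fin hok]
    have : (a ++ Step.D :: u).count Step.D = ups a + (u.count Step.D + 1) := by
      have h4 : ∀ {a}, Dyck a → a.count Step.D = ups a := by
        intro a ha
        induction ha with
        | nil => rfl
        | node _ _ ih1 ih2 => rw [ups_node]; simp [ih1, ih2]; ring
      simp [h4 ha]
    rw [this]
    have h5 : m + (ups a + (u.count Step.D + 1)) = m + ups a + 1 + u.count Step.D := by ring
    rw [h5]; ring

/-- The combinatorial meaning of the transform: at m = 0 it says that `hat q n (Phi l)` is the sum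
for D^n l with empty initial stack. -/
theorem hat_Phi_replicate (hok : ∀ l, ok l → ¬ Low l) (n : ℕ) (l : List Step) (m : ℕ) :
    hat q m (Phi q ok fin (List.replicate n Step.D ++ l)) = hat q (m + n) (Phi q ok fin l) := by
  induction n generalizing m with
  | zero => simp
  | succ n ih =>
    have h3 : Psi q ok fin (Step.D :: (List.replicate n Step.D ++ l)) =
        fun c => q ^ c * (Phi q ok fin (List.replicate n Step.D ++ l) c +
        Phi q ok fin (List.replicate n Step.D ++ l) (c + 1)) := by
      funext c
      simp only [Psi, Wt]
      rfl
    rw [List.replicate_succ, List.cons_append, Phi_of_not q fin (fun h => hok _ h (low_down _)), h3,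
      hat_down, ih, Nat.add_assoc, Nat.add_comm 1 n]

end Stack

/-! ### Product formulas for paths that stay above their start. -/

section Product

variable {K : Type*} [Field K] {q : K}

/-- The normalised generating function for even `L = 2k`, in product form. -/
def evenG (q : K) (k N : ℕ) : K :=
  ∏ i ∈ Finset.range N, (1 - q ^ (2 * (i + 1 + k))) / (1 - q ^ (i + 1))

/-- The normalised generating function for odd `L = 2k + 1`, in product form. -/
def oddG (q : K) (k N : ℕ) : K := evenG q k N * (1 - q ^ (N + 2 * k + 2)) / (1 - q ^ (2 * k + 2))

theorem one_sub_pow_ne (hq : ∀ n, 0 < n → q ^ n ≠ 1) {n : ℕ} (hn : 0 < n) : 1 - q ^ n ≠ 0 :=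
  sub_ne_zero.2 (hq n hn).symm

theorem evenG_succ (hq : ∀ n, 0 < n → q ^ n ≠ 1) (k N : ℕ) :
    evenG q k (N + 1) * (1 - q ^ (N + 1)) = evenG q k N * (1 - q ^ (2 * (N + 1 + k))) := by
  have := one_sub_pow_ne hq (show 0 < N + 1 by omega)
  rw [evenG, Finset.prod_range_succ, ← evenG]
  field_simp

theorem evenG_shift (hq : ∀ n, 0 < n → q ^ n ≠ 1) (k N : ℕ) :
    evenG q (k + 1) N * (1 - q ^ (2 * k + 2)) = evenG q k N * (1 - q ^ (2 * (N + 1 + k))) := by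
  induction N with
  | zero => simp [evenG]; ring
  | succ N ih =>
    have h1 := one_sub_pow_ne hq (show 0 < N + 1 by omega)
    apply mul_right_cancel₀ h1
    have h2 := evenG_succ hq (k + 1) N
    have h3 := evenG_succ hq k N
    have h4 : 2 * (N + 1 + (k + 1)) = 2 * (N + 1 + 1 + k) := by ring
    rw [h4] at h2
    linear_combination (1 - q ^ (2 * k + 2)) * h2 + (1 - q ^ (2 * (N + 1 + 1 + k))) * ih -
      (1 - q ^ (2 * (N + 1 + 1 + k))) * h3

theorem sum_oddG_mul (hq : ∀ n, 0 < n → q ^ n ≠ 1) (k N : ℕ) :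
    (∑ j ∈ Finset.range N, q ^ j * oddG q k j) * (1 - q ^ (2 * k + 2)) =
      evenG q k N * (1 - q ^ N) := by
  induction N with
  | zero => simp
  | succ N ih =>
    have h1 := one_sub_pow_ne hq (show 0 < 2 * k + 2 by omega)
    rw [Finset.sum_range_succ, add_mul, ih, evenG_succ hq, oddG]
    field_simp
    ring

/-- The effect of an up step in front of a path of odd length, by `hat_Psi_up`. -/
theorem sum_oddG (hq : ∀ n, 0 < n → q ^ n ≠ 1) (k N : ℕ) :
    ∑ j ∈ Finset.range (N + 1), q ^ j * oddG q k j = evenG q (k + 1) N := by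
  apply mul_right_cancel₀ (one_sub_pow_ne hq (show 0 < 2 * k + 2 by omega))
  rw [sum_oddG_mul hq, evenG_succ hq, evenG_shift hq]

/-- The renewal equation for frozen pairs (`hat_Phi_of_anchorable`) for length 2k + 1. The first sum
comes from an up step in front of a path of length 2k. -/
theorem oddG_eq (hq : ∀ n, 0 < n → q ^ n ≠ 1) (k N : ℕ) :
    oddG q k N = ∑ j ∈ Finset.range (N + 1), q ^ j * evenG q k j +
      q ^ (2 * k + 2) * ∑ i ∈ Finset.range N, q ^ i * ∑ j ∈ Finset.range i, q ^ j * oddG q k j := by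
  have h1 := one_sub_pow_ne hq (show 0 < 2 * k + 2 by omega)
  induction N with
  | zero => simpa [oddG, evenG] using h1
  | succ N ih =>
    rw [Finset.sum_range_succ _ (N + 1),
      Finset.sum_range_succ (fun i => q ^ i * ∑ j ∈ Finset.range i, q ^ j * oddG q k j) N]
    have h2 : oddG q k (N + 1) = oddG q k N + q ^ (N + 1) * evenG q k (N + 1) +
        q ^ (2 * k + 2) * (q ^ N * ∑ j ∈ Finset.range N, q ^ j * oddG q k j) := by
      apply mul_right_cancel₀ h1
      have h3 := sum_oddG_mul hq k N
      have h4 := evenG_succ hq k N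
      have h5 : ∀ N, oddG q k N * (1 - q ^ (2 * k + 2)) =
          evenG q k N * (1 - q ^ (N + 2 * k + 2)) := by
        intro N; rw [oddG]; field_simp
      have h6 := h5 N
      have h7 := h5 (N + 1)
      linear_combination h7 - h6 - q ^ (2 * k + 2) * q ^ N * h3 + h4
    rw [h2, ih]; ring

theorem qb_succ_right (hq : ∀ n, 0 < n → q ^ n ≠ 1) (n m : ℕ) :
    qb q n (m + 1) * (1 - q ^ (m + 1)) = qb q n m * (1 - q ^ (m + n + 1)) := by
  have h := qP_ne_zero hq n 0
  have h2 := qP_succ_left q n m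
  rw [qP_succ_right] at h2
  rw [qb, qb]
  field_simp
  linear_combination -h2

theorem qb_succ_left (hq : ∀ n, 0 < n → q ^ n ≠ 1) (n m : ℕ) :
    qb q (n + 1) m * (1 - q ^ (n + 1)) = qb q n m * (1 - q ^ (m + n + 1)) := by
  have h := qP_ne_zero hq n 0
  have h1 := one_sub_pow_ne hq (show 0 < n + 1 by omega)
  rw [qb, qb, qP_succ_right, qP_succ_right q n 0, zero_add]
  field_simp

/-- This absorbs the Gaussian binomial of an excursion in front of a path of even length. -/
theorem qb_mul_evenG (hq : ∀ n, 0 < n → q ^ n ≠ 1) (k n m : ℕ) :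
    qb q n m * evenG q k (m + n) = evenG q k n * evenG q (k + n) m := by
  induction m with
  | zero => simp [qb_zero_right hq, evenG]
  | succ m ih =>
    have h1 := one_sub_pow_ne hq (show 0 < m + 1 by omega)
    have h2 := one_sub_pow_ne hq (show 0 < m + n + 1 by omega)
    have h3 := qb_succ_right hq n m
    have h4 := evenG_succ hq k (m + n)
    have h5 := evenG_succ hq (k + n) m
    have h6 : m + 1 + n = m + n + 1 := by ring
    have h7 : 2 * (m + 1 + (k + n)) = 2 * (m + n + 1 + k) := by ring
    rw [h6]
    rw [h7] at h5
    apply mul_right_cancel₀ h1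
    linear_combination evenG q k (m + n + 1) * h3 + qb q n m * h4 +
      (1 - q ^ (2 * (m + n + 1 + k))) * ih - evenG q k n * h5

/-- The counterpart for odd length. The left side is the expression of `hat_Psi_exc`, whose second
sum corrects for tiles frozen at the return. -/
theorem qb_mul_sum_evenG (hq : ∀ n, 0 < n → q ^ n ≠ 1) (k n m : ℕ) :
    qb q (n + 1) m * ∑ j ∈ Finset.range (m + (n + 1) + 1), q ^ j * evenG q k j +
      ∑ j ∈ Finset.range (m + 1), q ^ j * qb q n j * (oddG q k (j + (n + 1)) -
        ∑ i ∈ Finset.range (j + (n + 1) + 1), q ^ i * evenG q k i) =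
    oddG q k (n + 1) * ∑ j ∈ Finset.range (m + 1), q ^ j * evenG q (k + (n + 1)) j := by
  induction m with
  | zero => simp [qb_zero_right hq, evenG]
  | succ m ih =>
    rw [Finset.sum_range_succ _ (m + 1), Finset.sum_range_succ _ (m + 1), mul_add, ← ih,
      qb_succ_succ hq]
    have h6 : m + 1 + (n + 1) = m + (n + 1) + 1 := by ring
    rw [h6, Finset.sum_range_succ _ (m + (n + 1) + 1)]
    -- By q-Pascal, the partial sums of `evenG` with coefficient `q ^ (m + 1) * qb q n (m + 1)`
    -- cancel. What remains is this identity between increments.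
    have key : qb q (n + 1) m * (q ^ (m + (n + 1) + 1) * evenG q k (m + (n + 1) + 1)) +
        q ^ (m + 1) * qb q n (m + 1) * oddG q k (m + (n + 1) + 1) =
        oddG q k (n + 1) * (q ^ (m + 1) * evenG q (k + (n + 1)) (m + 1)) := by
      have h1 := one_sub_pow_ne hq (show 0 < m + (n + 1) + 1 by omega)
      have h2 := one_sub_pow_ne hq (show 0 < 2 * k + 2 by omega)
      have h3 := qb_succ_right hq (n + 1) m
      have h4 := qb_succ_left hq n (m + 1)
      have h5 := qb_mul_evenG hq k (n + 1) (m + 1)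
      rw [h6] at h5
      have h7 : m + 1 + n + 1 = m + (n + 1) + 1 := by ring
      rw [h7] at h4
      have e1 : oddG q k (m + (n + 1) + 1) * (1 - q ^ (2 * k + 2)) =
          evenG q k (m + (n + 1) + 1) * (1 - q ^ (m + (n + 1) + 1 + 2 * k + 2)) := by
        rw [oddG]; field_simp
      have e2 : oddG q k (n + 1) * (1 - q ^ (2 * k + 2)) =
          evenG q k (n + 1) * (1 - q ^ (n + 1 + 2 * k + 2)) := by
        rw [oddG]; field_simp
      apply mul_right_cancel₀ h1
      apply mul_right_cancel₀ h2
      generalize evenG q k (m + (n + 1) + 1) = E at *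
      generalize oddG q k (m + (n + 1) + 1) = O at *
      generalize oddG q k (n + 1) = O' at *
      generalize evenG q (k + (n + 1)) (m + 1) = E' at *
      generalize evenG q k (n + 1) = E'' at *
      linear_combination -(1 - q ^ (2 * k + 2)) * q ^ (m + (n + 1) + 1) * E * h3
        - q ^ (m + 1) * O * (1 - q ^ (2 * k + 2)) * h4
        + q ^ (m + 1) * qb q (n + 1) (m + 1) * (1 - q ^ (n + 1)) * e1
        - q ^ (m + 1) * E' * (1 - q ^ (m + (n + 1) + 1)) * e2
        + q ^ (m + 1) * (1 - q ^ (m + (n + 1) + 1)) * (1 - q ^ (n + 1 + 2 * k + 2)) * h5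
    linear_combination key

open Classical in
/-- The normalised generating function of a stack on a path with `L` steps. -/
noncomputable def normG (q : K) (L N : ℕ) : K := if Even L then evenG q (L / 2) N else oddG q (L / 2) N

theorem normG_even (k N : ℕ) : normG q (2 * k) N = evenG q k N := by
  simp [normG]

theorem normG_odd (k N : ℕ) : normG q (2 * k + 1) N = oddG q k N := by
  rw [normG, if_neg (by simp)]
  congr 1; omega

theorem normG_zero_right (hq : ∀ n, 0 < n → q ^ n ≠ 1) (L : ℕ) : normG q L 0 = 1 := by
  have h1 := one_sub_pow_ne hq (show 0 < 2 * (L / 2) + 2 by omega)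
  simp [normG, evenG, oddG, div_self h1]

/-- Tiles of positive height difference may extend to the end of the path `l`. -/
def Anchorable (l : List Step) : Prop := ¬ Low l ∧ Odd l.length

theorem hat_Phi_of_anchorable (fin : ℕ → K) {l : List Step} (hl : Anchorable l) (m : ℕ) :
    hat q m (Phi q Anchorable fin l) = hat q m (Psi q Anchorable fin l) +
      q ^ (l.length + 1) * ∑ i ∈ Finset.range m, q ^ i * ∑ j ∈ Finset.range i,
        q ^ j * hat q j (Phi q Anchorable fin l) := by
  have h1 : Phi q Anchorable fin l = fun c => Psi q Anchorable fin l c +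
      q ^ (l.length + 1) * delay (delay (Phi q Anchorable fin l)) c := by
    funext c; exact Phi_of_ok q fin hl c
  conv_lhs => rw [h1]
  rw [hat_add, hat_smul, hat_delay]
  simp only [hat_delay]

/-- The renewal equation involves the transform of `Phi` only at indices below `m`, so it has one
solution, and `oddG_eq` exhibits it. -/
theorem hat_Phi_of_hat_Psi (hq : ∀ n, 0 < n → q ^ n ≠ 1) (fin : ℕ → K) {l : List Step}
    (hl : Anchorable l) {k : ℕ} (hk : l.length = 2 * k + 1) {x : K}
    (h : ∀ m, hat q m (Psi q Anchorable fin l) =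
      x * ∑ j ∈ Finset.range (m + 1), q ^ j * evenG q k j) (m : ℕ) :
    hat q m (Phi q Anchorable fin l) = x * normG q l.length m := by
  induction m using Nat.strong_induction_on with
  | _ m ih =>
    rw [hat_Phi_of_anchorable fin hl, h, hk, normG_odd, oddG_eq hq, mul_add]
    congr 1
    rw [mul_left_comm]
    congr 1
    rw [Finset.mul_sum]
    refine Finset.sum_congr rfl fun i hi => ?_
    rw [mul_left_comm]
    congr 1
    rw [Finset.mul_sum]
    refine Finset.sum_congr rfl fun j hj => ?_
    rw [Finset.mem_range] at hi hj
    rw [ih j (by omega), hk, normG_odd]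
    ring

/-- The renewal equation read backwards: the induction supplies `Phi`, but an excursion also needs
`Psi`. -/
theorem hat_Psi_of_hat_Phi (hq : ∀ n, 0 < n → q ^ n ≠ 1) (fin : ℕ → K) {l : List Step}
    (hl : Anchorable l) {k : ℕ} (hk : l.length = 2 * k + 1) {x : K}
    (h : ∀ m, hat q m (Phi q Anchorable fin l) = x * normG q l.length m) (m : ℕ) :
    hat q m (Psi q Anchorable fin l) = x * ∑ j ∈ Finset.range (m + 1), q ^ j * evenG q k j := by
  have h1 := hat_Phi_of_anchorable (q := q) fin hl m
  simp only [h] at h1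
  rw [hk] at h1
  simp only [normG_odd] at h1
  rw [oddG_eq hq] at h1
  have h2 : ∑ i ∈ Finset.range m, q ^ i * ∑ j ∈ Finset.range i, q ^ j * (x * oddG q k j) =
      x * ∑ i ∈ Finset.range m, q ^ i * ∑ j ∈ Finset.range i, q ^ j * oddG q k j := by
    simp only [Finset.mul_sum]
    refine Finset.sum_congr rfl fun i _ => Finset.sum_congr rfl fun j _ => by ring
  rw [h2] at h1
  linear_combination -h1

/-- The path enters only through the scalar `x` and its length. For even length nothing is frozen
and `Phi` is `Psi`; for odd length `Phi` comes from the renewal equation. -/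
theorem exists_hat_Phi_eq (hq : ∀ n, 0 < n → q ^ n ≠ 1) {l : List Step} (hl : NonNeg l) :
    ∃ x : K, ∀ m, hat q m (Phi q Anchorable (fun c => q ^ c) l) = x * normG q l.length m := by
  induction hl with
  | nil =>
    refine ⟨1, fun m => ?_⟩
    rw [Phi_of_not _ _ (by simp [Anchorable])]
    have : Psi q Anchorable (fun c => q ^ c) [] = fun c => q ^ c := by
      funext c; simp [Psi, Wt]
    rw [this, hat_pow_succ, List.length_nil, one_mul, ← mul_zero 2, normG_even, evenG]
    refine Finset.prod_congr rfl fun i _ => ?_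
    have h1 := one_sub_pow_ne hq (show 0 < i + 1 by omega)
    field_simp
    ring
  | @up l hl ih =>
    obtain ⟨x, hx⟩ := ih
    have h1 : ∀ m, hat q m (Psi q Anchorable (fun c => q ^ c) (Step.U :: l)) =
        x * ∑ j ∈ Finset.range (m + 1), q ^ j * normG q l.length j := by
      intro m
      rw [hat_Psi_up _ _ hl.not_low, Finset.mul_sum]
      refine Finset.sum_congr rfl fun j _ => ?_
      rw [hx]; ring
    refine ⟨x, ?_⟩
    rcases Nat.even_or_odd' l.length with ⟨k, hk | hk⟩
    · have hU : Anchorable (Step.U :: l) := ⟨hl.up.not_low, ⟨k, by simp [hk]⟩⟩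
      refine hat_Phi_of_hat_Psi hq _ hU (k := k) (by simp [hk]) ?_
      simpa only [hk, normG_even] using h1
    · intro m
      have h2 : (Step.U :: l).length = 2 * (k + 1) := by simp [hk]; ring
      rw [Phi_of_not _ _ (fun h => Nat.not_odd_iff_even.2 ⟨_, two_mul _⟩ (h2 ▸ h.2)), h1, h2,
        normG_even, hk, ← sum_oddG hq]
      simp only [normG_odd]
  | @exc a l ha hl ih =>
    obtain ⟨x, hx⟩ := ih
    obtain ⟨C, hC0, hC⟩ := dyck_transfer hq ha
    have hE := hat_Psi_exc q (ok := Anchorable) (fun c => q ^ c) ha C (fun _ h => h.1)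
      (hC _ _ (fun _ h => h.1)) l
    have hsum : ∀ m, ∑ j ∈ Finset.range (m + 1), q ^ j * C j = C 0 * qb q (ups a + 1) m := by
      intro m
      rw [← sum_qb hq, Finset.mul_sum]
      refine Finset.sum_congr rfl fun j _ => ?_
      rw [hC0 j]; ring
    have hlen : (Step.U :: (a ++ Step.D :: l)).length = l.length + 2 * (ups a + 1) := by
      simp [ha.length]; ring
    rcases Nat.even_or_odd' l.length with ⟨k, hk | hk⟩
    · have h2 : (Step.U :: (a ++ Step.D :: l)).length = 2 * (k + (ups a + 1)) := by
        rw [hlen, hk]; ring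
      refine ⟨C 0 * x * evenG q k (ups a + 1), fun m => ?_⟩
      rw [Phi_of_not _ _ (fun h => Nat.not_odd_iff_even.2 ⟨_, two_mul _⟩ (h2 ▸ h.2)), hE,
        Phi_of_not _ _ (fun h => Nat.not_odd_iff_even.2 ⟨_, two_mul _⟩ (hk ▸ h.2)), h2, normG_even]
      have h3 := hx (m + (ups a + 1))
      rw [Phi_of_not _ _ (fun h => Nat.not_odd_iff_even.2 ⟨_, two_mul _⟩ (hk ▸ h.2)), hk,
        normG_even] at h3
      rw [h3, hsum]
      simp only [sub_self, mul_zero, Finset.sum_const_zero, add_zero]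
      linear_combination C 0 * x * qb_mul_evenG hq k (ups a + 1) m
    · have hA : Anchorable l := ⟨hl.not_low, ⟨k, hk⟩⟩
      have hA' : Anchorable (Step.U :: (a ++ Step.D :: l)) :=
        ⟨(NonNeg.exc ha hl).not_low, ⟨k + (ups a + 1), by rw [hlen, hk]; ring⟩⟩
      refine ⟨C 0 * x * oddG q k (ups a + 1), ?_⟩
      refine hat_Phi_of_hat_Psi hq _ hA' (k := k + (ups a + 1)) (by rw [hlen, hk]; ring) ?_
      intro m
      rw [hE, hsum, hat_Psi_of_hat_Phi hq _ hA hk hx]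
      have h4 : ∀ j, hat q (j + (ups a + 1)) (Phi q Anchorable (fun c => q ^ c) l) -
          hat q (j + (ups a + 1)) (Psi q Anchorable (fun c => q ^ c) l) =
          x * (oddG q k (j + (ups a + 1)) -
            ∑ i ∈ Finset.range (j + (ups a + 1) + 1), q ^ i * evenG q k i) := by
        intro j
        rw [hat_Psi_of_hat_Phi hq _ hA hk hx, hx, hk, normG_odd]; ring
      simp only [h4]
      have h5 : ∑ j ∈ Finset.range (m + 1), q ^ j * C j * (x * (oddG q k (j + (ups a + 1)) -
            ∑ i ∈ Finset.range (j + (ups a + 1) + 1), q ^ i * evenG q k i)) =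
          C 0 * x * ∑ j ∈ Finset.range (m + 1), q ^ j * qb q (ups a) j *
            (oddG q k (j + (ups a + 1)) -
            ∑ i ∈ Finset.range (j + (ups a + 1) + 1), q ^ i * evenG q k i) := by
        rw [Finset.mul_sum]
        refine Finset.sum_congr rfl fun j _ => ?_
        rw [hC0 j]; ring
      rw [h5]
      linear_combination C 0 * x * qb_mul_sum_evenG hq k (ups a) m

theorem hat_Phi_eq (hq : ∀ n, 0 < n → q ^ n ≠ 1) {l : List Step} (hl : ¬ Low l) (m : ℕ) :
    hat q m (Phi q Anchorable (fun c => q ^ c) l) =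
      Psi q Anchorable (fun c => q ^ c) l 0 * normG q l.length m := by
  obtain ⟨x, hx⟩ := exists_hat_Phi_eq hq (nonNeg_of_not_low hl)
  have h0 := hx 0
  rw [normG_zero_right hq, mul_one] at h0
  have : hat q 0 (Phi q Anchorable (fun c => q ^ c) l) = Psi q Anchorable (fun c => q ^ c) l 0 := by
    simp [hat, Phi, frz]
  rw [hx, ← h0, this]

end Product

/-! ### Stacks of tiles and their transitions. -/

/-- `s'` is a possible stack at the abscissa `x + 1` after the stack `s` at the abscissa `x`. A stack
lists the abscissas of the first boxes of the tiles over a given abscissa, from bottom to top. -/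
def Trans (hf : ℕ → ℤ) (x : ℕ) (s s' : List ℕ) : Prop :=
  ∃ j e, j ≤ s.length ∧ s' = s.take j ++ List.replicate e (x + 1) ∧
    (∀ a ∈ s.drop j, hf a = hf x) ∧ (∀ a ∈ s.take j, hf a ≤ hf (x + 1)) ∧
    |(hf (x + 1) + 2 * s'.length) - (hf x + 2 * s.length)| = 1

/-- The number of tiles of the stack `s` that do not continue in `s'`. -/
def changed (s s' : List ℕ) : ℕ := ((Finset.range s.length).filter fun k => s'[k]? ≠ s[k]?).card

/-- The contribution of one step to the weight of a tiling. -/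
def cost (hf : ℕ → ℤ) (x : ℕ) (s s' : List ℕ) : ℕ :=
  if hf (x + 1) < hf x then s.length else changed s s'

open Classical in
/-- The possible stacks at the abscissa `x + 1` after the stack `s` at the abscissa `x`. -/
noncomputable def nexts (hf : ℕ → ℤ) (x : ℕ) (s : List ℕ) : Finset (List ℕ) :=
  ((Finset.range (s.length + 1) ×ˢ Finset.range (s.length + 2)).image fun p =>
    s.take p.1 ++ List.replicate p.2 (x + 1)).filter (Trans hf x s)

/-- The finite search range loses nothing: both paths move by one unit, so a column gains at most
one box and at most `s.length + 1` tiles open. -/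
theorem mem_nexts {hf : ℕ → ℤ} {x : ℕ} (hx : |hf (x + 1) - hf x| = 1) {s s' : List ℕ} :
    s' ∈ nexts hf x s ↔ Trans hf x s s' := by
  classical
  simp only [nexts, Finset.mem_filter, Finset.mem_image, and_iff_right_iff_imp]
  rintro ⟨j, e, hj, rfl, -, -, h⟩
  refine ⟨(j, e), ?_, rfl⟩
  simp only [Finset.mem_product, Finset.mem_range]
  refine ⟨by omega, ?_⟩
  simp only [List.length_append, List.length_take, List.length_replicate, min_eq_left hj] at h
  push_cast at h
  rw [abs_eq (by norm_num)] at h hx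
  omega

/-- The properties of the stacks that occur at the abscissa `x`. -/
def StackInv (hf : ℕ → ℤ) (x : ℕ) (s : List ℕ) : Prop :=
  (∀ a ∈ s, a ≤ x ∧ hf a ≤ hf x) ∧ s.Pairwise fun a b => hf a ≤ hf b

theorem StackInv.trans {hf : ℕ → ℤ} {x : ℕ} {s s' : List ℕ} (hs : StackInv hf x s)
    (h : Trans hf x s s') : StackInv hf (x + 1) s' := by
  obtain ⟨j, e, hj, rfl, -, h1, -⟩ := h
  refine ⟨fun a ha => ?_, ?_⟩
  · rcases List.mem_append.1 ha with ha | ha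
    · exact ⟨(hs.1 a (List.mem_of_mem_take ha)).1.trans (Nat.le_succ x), h1 a ha⟩
    · rw [List.eq_of_mem_replicate ha]; simp
  · refine List.pairwise_append.2 ⟨hs.2.sublist (List.take_sublist _ _), ?_, ?_⟩
    · exact List.pairwise_replicate.2 (Or.inr le_rfl)
    · intro a ha b hb
      rw [List.eq_of_mem_replicate hb]; exact h1 a ha

/-- Bases rise weakly up the stack, so the tiles that may close now form its top part `v`. -/
theorem StackInv.exists_append {hf : ℕ → ℤ} {x : ℕ} {s : List ℕ} (hs : StackInv hf x s) :
    ∃ u v, s = u ++ v ∧ (∀ a ∈ u, hf a < hf x) ∧ ∀ a ∈ v, hf a = hf x := by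
  obtain ⟨h1, h2⟩ := hs
  induction s with
  | nil => exact ⟨[], [], by simp⟩
  | cons a s ih =>
    rw [List.pairwise_cons] at h2
    rcases (h1 a (by simp)).2.lt_or_eq with h | h
    · obtain ⟨u, v, rfl, hu, hv⟩ := ih (fun b hb => h1 b (by simp [hb])) h2.2
      refine ⟨a :: u, v, rfl, ?_, hv⟩
      simpa [h] using hu
    · refine ⟨[], a :: s, rfl, by simp, ?_⟩
      intro b hb
      refine le_antisymm (h1 b hb).2 ?_
      rw [← h]
      rcases List.mem_cons.1 hb with rfl | hb
      · exact le_rfl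
      · exact h2.1 b hb

theorem take_append_replicate_inj {x : ℕ} {s : List ℕ} (hs : ∀ a ∈ s, a ≤ x) {j j' e e' : ℕ}
    (h : s.take j ++ List.replicate e (x + 1) = s.take j' ++ List.replicate e' (x + 1)) :
    e = e' := by
  have h0 : ∀ j, (s.take j).count (x + 1) = 0 := fun j => List.count_eq_zero.2 fun hm => by
    have := hs _ (List.mem_of_mem_take hm); omega
  have := congrArg (List.count (x + 1)) h
  simpa [h0] using this

theorem length_le_of_forall_drop {α : Type*} {p : α → Prop} {u v : List α} {j : ℕ}
    (hu : ∀ a ∈ u, ¬ p a) (h : ∀ a ∈ (u ++ v).drop j, p a) : u.length ≤ j := by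
  by_contra hlt
  refine hu (u[j]'(by omega)) (by simp) (h _ ?_)
  rw [List.drop_append_of_le_length (by omega)]
  refine List.mem_append_left _ ?_
  have : u.drop j = u[j]'(by omega) :: u.drop (j + 1) := List.drop_eq_getElem_cons _
  simp only [this, List.mem_cons_self]

section Sums

variable {M : Type*} [AddCommMonoid M]

/-- The tiles of `v` would be undercut and must close; those of `u` cannot close. The step of the
upper path decides between two numbers of new tiles. -/
theorem sum_nexts_down {hf : ℕ → ℤ} {x : ℕ} (hx : hf (x + 1) = hf x - 1) {u v : List ℕ}
    (hu : ∀ a ∈ u, hf a < hf x) (hv : ∀ a ∈ v, hf a = hf x) (G : List ℕ → M) :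
    ∑ s' ∈ nexts hf x (u ++ v), G s' = G (u ++ List.replicate v.length (x + 1)) +
      G (u ++ List.replicate (v.length + 1) (x + 1)) := by
  classical
  have h1 : nexts hf x (u ++ v) = {u ++ List.replicate v.length (x + 1),
      u ++ List.replicate (v.length + 1) (x + 1)} := by
    ext s'
    rw [mem_nexts (by rw [hx]; simp), Finset.mem_insert, Finset.mem_singleton]
    constructor
    · rintro ⟨j, e, hj, rfl, h2, h3, h4⟩
      have hj1 : u.length ≤ j :=
        length_le_of_forall_drop (fun a ha => (hu a ha).ne) h2
      have hj2 : j ≤ u.length := by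
        by_contra hlt
        simp only [List.length_append] at hj
        have hm : v[0]'(by omega) ∈ (u ++ v).take j := by
          rw [List.take_append]
          refine List.mem_append_right _ ?_
          have h5 : 0 < (v.take (j - u.length)).length := by simp; omega
          have h6 : (v.take (j - u.length))[0] = v[0]'(by omega) := by simp
          rw [← h6]; exact List.getElem_mem h5
        have := h3 _ hm
        have := hv (v[0]'(by omega)) (by simp)
        omega
      obtain rfl : j = u.length := by omega
      simp only [List.take_left, List.length_append, List.length_replicate] at h4 ⊢
      push_cast at h4
      rw [hx, abs_eq (by norm_num)] at h4
      have : e = v.length ∨ e = v.length + 1 := by omega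
      rcases this with rfl | rfl <;> simp
    · have h5 : ∀ a ∈ u, hf a ≤ hf (x + 1) := fun a ha => by have := hu a ha; omega
      rintro (rfl | rfl)
      · exact ⟨u.length, v.length, by simp, by simp, by simpa using hv, by simpa using h5, by
          rw [hx, abs_eq (by norm_num)]; right; simp⟩
      · exact ⟨u.length, v.length + 1, by simp, by simp, by simpa using hv, by simpa using h5, by
          rw [hx, abs_eq (by norm_num)]; left; simp; ring⟩
  rw [h1, Finset.sum_pair]
  intro h
  have := congrArg List.length h
  simp at this

theorem sum_nexts_up {hf : ℕ → ℤ} {x : ℕ} (hx : hf (x + 1) = hf x + 1) {u v : List ℕ}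
    (hs : StackInv hf x (u ++ v))
    (hu : ∀ a ∈ u, hf a < hf x) (hv : ∀ a ∈ v, hf a = hf x) (G : List ℕ → M) :
    ∑ s' ∈ nexts hf x (u ++ v), G s' = ∑ e ∈ Finset.range (v.length + 1),
      (G (u ++ v.take (v.length - e) ++ List.replicate e (x + 1)) +
        if e = 0 then 0 else G (u ++ v.take (v.length - e) ++ List.replicate (e - 1) (x + 1))) := by
  classical
  set f1 : ℕ → List ℕ := fun e => u ++ v.take (v.length - e) ++ List.replicate e (x + 1) with hf1
  -- Here `e` counts the opened tiles, one fewer than the closed ones; the statement counts closed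
  -- tiles, hence its zero term at e = 0.
  set f2 : ℕ → List ℕ := fun e =>
    u ++ v.take (v.length - (e + 1)) ++ List.replicate e (x + 1) with hf2
  have hle : ∀ a ∈ u ++ v, a ≤ x := fun a ha => (hs.1 a ha).1
  have ht : ∀ e, (u ++ v).take (u.length + e) = u ++ v.take e := fun e => by
    simp [List.take_append]
  have h1 : nexts hf x (u ++ v) = (Finset.range (v.length + 1)).image f1 ∪
      (Finset.range v.length).image f2 := by
    ext s'
    rw [mem_nexts (by rw [hx]; simp), Finset.mem_union, Finset.mem_image, Finset.mem_image]
    constructor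
    · rintro ⟨j, e, hj, rfl, h2, h3, h4⟩
      have hj1 : u.length ≤ j :=
        length_le_of_forall_drop (fun a ha => (hu a ha).ne) h2
      obtain ⟨i, rfl⟩ := Nat.exists_eq_add_of_le hj1
      rw [ht] at h4 ⊢
      simp only [List.length_append, List.length_take, List.length_replicate] at h4 hj
      rw [hx, abs_eq (by norm_num), min_eq_left (by omega)] at h4
      push_cast at h4
      have h6 : i + e = v.length ∨ i + e + 1 = v.length := by omega
      rcases h6 with h6 | h6
      · left
        refine ⟨e, by simp; omega, ?_⟩
        simp only [hf1]
        congr 3; omega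
      · right
        refine ⟨e, by simp; omega, ?_⟩
        simp only [hf2]
        congr 3; omega
    · have h7 : ∀ a ∈ u ++ v, hf a ≤ hf (x + 1) := fun a ha => by have := (hs.1 a ha).2; omega
      rintro (⟨e, he, rfl⟩ | ⟨e, he, rfl⟩)
      · rw [Finset.mem_range] at he
        refine ⟨u.length + (v.length - e), e, by simp, by rw [ht], ?_, ?_, ?_⟩
        · intro a ha
          refine hv a ?_
          rw [List.drop_append] at ha
          simp only [List.mem_append] at ha
          rcases ha with ha | ha
          · rw [List.drop_of_length_le (by omega)] at ha; simp at ha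
          · exact List.mem_of_mem_drop ha
        · intro a ha; exact h7 a (List.mem_of_mem_take ha)
        · simp only [hf1, List.length_append, List.length_take, List.length_replicate]
          rw [hx, abs_eq (by norm_num), min_eq_left (by omega)]
          left; push_cast [show e ≤ v.length by omega]; ring
      · rw [Finset.mem_range] at he
        refine ⟨u.length + (v.length - (e + 1)), e, by simp, by rw [ht], ?_, ?_, ?_⟩
        · intro a ha
          refine hv a ?_
          rw [List.drop_append] at ha
          simp only [List.mem_append] at ha
          rcases ha with ha | ha
          · rw [List.drop_of_length_le (by omega)] at ha; simp at ha
          · exact List.mem_of_mem_drop ha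
        · intro a ha; exact h7 a (List.mem_of_mem_take ha)
        · simp only [hf2, List.length_append, List.length_take, List.length_replicate]
          rw [hx, abs_eq (by norm_num), min_eq_left (by omega)]
          right; push_cast [show e + 1 ≤ v.length by omega]; ring
  have hinj : ∀ i i' e e', u ++ v.take i ++ List.replicate e (x + 1) =
      u ++ v.take i' ++ List.replicate e' (x + 1) → e = e' := by
    intro i i' e e' h
    rw [← ht, ← ht] at h
    exact take_append_replicate_inj hle h
  have hd : Disjoint ((Finset.range (v.length + 1)).image f1) ((Finset.range v.length).image f2) := by
    rw [Finset.disjoint_left]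
    intro w hw hw'
    obtain ⟨e, he, rfl⟩ := Finset.mem_image.1 hw
    obtain ⟨e', he', h⟩ := Finset.mem_image.1 hw'
    have := congrArg List.length h
    simp only [hf1, hf2, List.length_append, List.length_take, List.length_replicate] at this
    simp at he he'
    omega
  rw [h1, Finset.sum_union hd, Finset.sum_image fun e _ e' _ h => hinj _ _ _ _ h,
    Finset.sum_image fun e _ e' _ h => hinj _ _ _ _ h, Finset.sum_add_distrib]
  congr 1
  rw [Finset.sum_range_succ' _ v.length]
  simp

end Sums

/-- A replaced entry is detected even where the level stays occupied, since new entries are `x + 1`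
and old ones at most `x`. -/
theorem changed_take {x : ℕ} {u v : List ℕ} (hle : ∀ a ∈ u ++ v, a ≤ x) (e e' : ℕ)
    (he : e ≤ v.length) :
    changed (u ++ v) (u ++ v.take (v.length - e) ++ List.replicate e' (x + 1)) = e := by
  have h : (Finset.range (u ++ v).length).filter (fun k =>
      (u ++ v.take (v.length - e) ++ List.replicate e' (x + 1))[k]? ≠ (u ++ v)[k]?) =
      Finset.Ico (u.length + v.length - e) (u.length + v.length) := by
    ext k
    simp only [Finset.mem_filter, Finset.mem_range, Finset.mem_Ico, List.length_append]
    have ht : u ++ v.take (v.length - e) = (u ++ v).take (u.length + v.length - e) := by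
      rw [Nat.add_sub_assoc he]
      simp [List.take_append]
    rw [ht]
    constructor
    · rintro ⟨h1, h2⟩
      refine ⟨?_, h1⟩
      by_contra hlt
      apply h2
      rw [List.getElem?_append_left (by simp; omega), List.getElem?_take_of_lt (by omega)]
    · rintro ⟨h1, h2⟩
      refine ⟨h2, fun h3 => ?_⟩
      rw [List.getElem?_append_right (by simp; omega), List.getElem?_replicate] at h3
      have h4 : k < (u ++ v).length := by simpa using h2
      rw [List.getElem?_eq_getElem h4] at h3
      split_ifs at h3
      have := hle _ (List.getElem_mem h4)
      simp only [Option.some.injEq] at h3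
      omega
  rw [changed, h, Nat.card_Ico]
  omega

/-! ### Separation of frozen and live tiles. -/

section Runs

variable {K : Type*} [Field K] (q : K) (ball : Prop) (hf : ℕ → ℤ)

/-- The weighted number of continuations of the stack `s` at the abscissa `x` by `n` steps. -/
noncomputable def W1 (F : List ℕ → K) : ℕ → ℕ → List ℕ → K
  | 0, _, s => F s
  | n + 1, x, s => ∑ s' ∈ nexts hf x s, q ^ cost hf x s s' * W1 F n (x + 1) s'

/-- All tiles of `w` may extend to the end of the path `l`, which starts at height `h`. -/
def Frozen (l : List Step) (h : ℤ) (w : List ℕ) : Prop :=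
  ∀ a ∈ w, ball ∧ (∀ i ≤ l.length, hf a ≤ h + height l i) ∧
    Odd (h + height l l.length - hf a) ∧ Even (w.count a)

/-- The weight that a tile collects along `l` if it extends to the end. -/
def frozenCost (l : List Step) (h : ℤ) (a : ℕ) : ℕ :=
  l.count Step.D + ((h + height l l.length - hf a + 1) / 2).toNat

/-- Suitability of a path for anchored tiles of positive height difference. -/
def Okay (l : List Step) : Prop := ball ∧ Anchorable l

open Classical in
/-- The weight of `c` open tiles whose base is at the final height. -/
noncomputable def finW (c : ℕ) : K := if c = 0 ∨ ball then q ^ c else 0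

/-- The weighted number of completions of the stack `w` of tiles that do not extend to the end. -/
noncomputable def live (l : List Step) (h : ℤ) (w : List ℕ) : K :=
  Wt q (Okay ball) (finW q ball) l (w.countP fun a => hf a = h)
    (w.length - w.countP fun a => hf a = h) fun i => w.countP fun a => hf a = h - 1 - i

open Classical in
/-- The sum over the number `k` of tiles of the stack `s` that extend to the end. -/
noncomputable def frozenSum (l : List Step) (h : ℤ) (s : List ℕ) : K :=
  ∑ k ∈ Finset.range (s.length + 1), if Frozen ball hf l h (s.take k) then
    q ^ ((s.take k).map (frozenCost hf l h)).sum * live q ball hf l h (s.drop k) else 0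

theorem sum_range_even {M : Type*} [AddCommMonoid M] (f : ℕ → M) (e : ℕ) :
    ∑ a ∈ Finset.range (e + 1), (if Even a then f a else 0) =
      ∑ p ∈ Finset.range (e / 2 + 1), f (2 * p) := by
  induction e with
  | zero => simp
  | succ e ih =>
    rw [Finset.sum_range_succ, ih]
    split_ifs with h
    · obtain ⟨r, hr⟩ := h
      have h1 : (e + 1) / 2 = e / 2 + 1 := by omega
      have h2 : e + 1 = 2 * (e / 2 + 1) := by omega
      rw [h1, Finset.sum_range_succ _ (e / 2 + 1), ← h2]
    · rw [Nat.not_even_iff_odd] at h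
      obtain ⟨r, hr⟩ := h
      have h1 : (e + 1) / 2 = e / 2 := by omega
      rw [h1, add_zero]

theorem height_length_eq (l : List Step) :
    height l l.length = l.length - 2 * (l.count Step.D : ℤ) := by
  induction l with
  | nil => simp [height]
  | cons s l ih =>
    rw [List.length_cons, height_cons_succ, ih]
    cases s <;> simp [Step.rise] <;> ring

/-- The start `y` is new, so the parity condition splits into one for `u` and one for `p`. -/
theorem frozen_append_replicate {l : List Step} {h : ℤ} {u : List ℕ} {y : ℕ}
    (hu : ∀ a ∈ u, a < y) (hy : hf y = h) (p : ℕ) :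
    Frozen ball hf l h (u ++ List.replicate p y) ↔
      Frozen ball hf l h u ∧ (p = 0 ∨ Okay ball l) ∧ Even p := by
  have hyu : y ∉ u := fun hm => lt_irrefl _ (hu y hm)
  have h1 : ∀ a ∈ u, (u ++ List.replicate p y).count a = u.count a := by
    intro a ha
    rw [List.count_append, List.count_replicate, if_neg (by simpa using (hu a ha).ne')]
    rfl
  have h2 : (u ++ List.replicate p y).count y = p := by
    simp [List.count_eq_zero.2 hyu]
  have h3 : Okay ball l ↔ ball ∧ (∀ i ≤ l.length, hf y ≤ h + height l i) ∧
      Odd (h + height l l.length - hf y) := by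
    rw [Okay, Anchorable, Low, hy, height_length_eq]
    refine and_congr_right fun _ => and_congr ?_ ?_
    · push Not
      refine forall₂_congr fun i _ => ?_
      omega
    -- The length of a path and its final height have the same parity.
    · rw [← Int.odd_coe_nat, Int.odd_iff, Int.odd_iff]
      omega
  rw [h3]
  constructor
  · intro H
    refine ⟨fun a ha => ?_, ?_⟩
    · have := H a (List.mem_append_left _ ha)
      rwa [h1 a ha] at this
    · rcases Nat.eq_zero_or_pos p with rfl | hp
      · simp
      · have := H y (List.mem_append_right _ (List.mem_replicate.2 ⟨hp.ne', rfl⟩))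
        rw [h2] at this
        exact ⟨Or.inr ⟨this.1, this.2.1, this.2.2.1⟩, this.2.2.2⟩
  · rintro ⟨H1, H2, H3⟩ a ha
    rcases List.mem_append.1 ha with ha | ha
    · rw [h1 a ha]; exact H1 a ha
    · obtain ⟨h0, rfl⟩ := List.mem_replicate.1 ha
      rw [h2]
      obtain ⟨h4, h5, h6⟩ := H2.resolve_left h0
      exact ⟨h4, h5, h6, H3⟩

-- Frozen tiles lie below live ones. If the cut falls inside `u`, the new tiles rest on live ones
-- and are live themselves. Otherwise an even number 2p of new tiles is frozen, which is the sum in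
-- `frz`.
open Classical in
theorem frozenSum_append_replicate {l : List Step} {h : ℤ} {u : List ℕ} {y : ℕ}
    (hu : ∀ a ∈ u, a < y) (hy : hf y = h) (e : ℕ) :
    frozenSum q ball hf l h (u ++ List.replicate e y) =
      ∑ k ∈ Finset.range (u.length + 1), if Frozen ball hf l h (u.take k) then
        q ^ ((u.take k).map (frozenCost hf l h)).sum * frz q (Okay ball) l (u.length - k)
          (fun d => Wt q (Okay ball) (finW q ball) l
            (d + (u.drop k).countP fun a => hf a = h)
            (u.length - k - (u.drop k).countP fun a => hf a = h)
            fun i => (u.drop k).countP fun a => hf a = h - 1 - i) e else 0 := by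
  have hlive : ∀ w d, live q ball hf l h (w ++ List.replicate d y) =
      Wt q (Okay ball) (finW q ball) l (d + w.countP fun a => hf a = h)
        (w.length - w.countP fun a => hf a = h) fun i => w.countP fun a => hf a = h - 1 - i := by
    intro w d
    rw [live]
    have h1 : (w ++ List.replicate d y).countP (fun a => decide (hf a = h)) =
        d + w.countP fun a => decide (hf a = h) := by
      rw [List.countP_append, List.countP_replicate]; simp [hy, add_comm]
    congr 1
    · rw [h1]; simp; omega
    · funext i
      rw [List.countP_append, List.countP_replicate, if_neg, add_zero]
      simp only [hy, decide_eq_true_eq]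
      omega
  rw [frozenSum, List.length_append, List.length_replicate, add_assoc, Finset.sum_range_add,
    Finset.sum_range_succ _ u.length]
  congr 1
  · refine Finset.sum_congr rfl fun k hk => ?_
    rw [Finset.mem_range] at hk
    rw [List.take_append_of_le_length hk.le, List.drop_append_of_le_length hk.le, hlive,
      frz_of_not q (by omega), List.length_drop]
  · have h2 : ∀ a, (u ++ List.replicate e y).take (u.length + a) =
        u ++ List.replicate (min a e) y := by
      intro a
      simp [List.take_append, List.take_of_length_le]
    have h3 : ∀ a, (u ++ List.replicate e y).drop (u.length + a) =
        [] ++ List.replicate (e - a) y := by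
      intro a
      simp [List.drop_append, List.drop_of_length_le]
    simp only [h2, h3, hlive, frozen_append_replicate ball hf hu hy, List.take_length,
      List.drop_length, Nat.sub_self]
    have h4 : ∀ a ∈ Finset.range (e + 1),
        (if Frozen ball hf l h u ∧ (min a e = 0 ∨ Okay ball l) ∧ Even (min a e) then
          q ^ ((u ++ List.replicate (min a e) y).map (frozenCost hf l h)).sum *
            Wt q (Okay ball) (finW q ball) l (e - a + ([] : List ℕ).countP fun a => hf a = h)
            (([] : List ℕ).length - ([] : List ℕ).countP fun a => hf a = h)
            (fun i => ([] : List ℕ).countP fun a => hf a = h - 1 - i) else 0) =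
        if Even a then (if Frozen ball hf l h u ∧ (a = 0 ∨ Okay ball l) then
          q ^ ((u ++ List.replicate a y).map (frozenCost hf l h)).sum *
            Wt q (Okay ball) (finW q ball) l (e - a) 0 (fun _ => 0) else 0) else 0 := by
      intro a ha
      rw [Finset.mem_range] at ha
      rw [min_eq_left (by omega)]
      by_cases hE : Even a
      · simp [hE]
      · simp [hE]
    rw [Finset.sum_congr rfl h4, sum_range_even, frz]
    by_cases hF : Frozen ball hf l h u
    · simp only [hF, true_and, if_true, Finset.mul_sum]
      refine Finset.sum_congr rfl fun p _ => ?_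
      have h5 : (2 * p = 0 ∨ Okay ball l) ↔ (p = 0 ∨ Okay ball l) := by simp
      simp only [h5]
      split_ifs with hp
      · simp only [List.countP_nil, add_zero, Nat.sub_zero, List.map_append, List.sum_append,
          List.map_replicate, List.sum_replicate, smul_eq_mul]
        -- With d down steps the final height is length - 2d, so each tile costs d + (length - 2d +
        -- 1) / 2 = (length + 1) / 2.
        have h6 : 2 * p * frozenCost hf l h y = p * (l.length + 1) := by
          rcases hp with rfl | hp
          · simp
          · rw [mul_comm 2, mul_assoc]
            congr 1
            obtain ⟨r, hr⟩ := hp.2.2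
            rw [frozenCost, hy, height_length_eq, hr]
            have h8 := height_length_eq l
            have h7 : 0 ≤ height l l.length := by
              by_contra hlt
              exact hp.2.1 ⟨l.length, le_rfl, by omega⟩
            push_cast
            omega
        rw [h6, pow_add]; ring
      · simp
    · simp [hF]

/-- The tiles of the stack `s` may end at the end of the path. -/
def FinalOK (h : ℤ) (s : List ℕ) : Prop :=
  ∀ a ∈ s, ball ∧ (hf a = h ∨ (Odd (h - hf a) ∧ Even (s.count a)))

open Classical in
/-- The weight of a final stack. -/
noncomputable def finalW (h : ℤ) (s : List ℕ) : K :=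
  if FinalOK ball hf h s then
    q ^ (s.map fun a => if hf a = h then 1 else ((h - hf a + 1) / 2).toNat).sum else 0

theorem countP_eq_zero_of_ne {u : List ℕ} {h : ℤ} (hu : ∀ a ∈ u, hf a ≠ h) :
    (u.countP fun a => decide (hf a = h)) = 0 := by
  rw [List.countP_eq_zero]
  intro a ha
  simpa using hu a ha

theorem countP_eq_length_of_eq {u : List ℕ} {h : ℤ} (hu : ∀ a ∈ u, hf a = h) :
    (u.countP fun a => decide (hf a = h)) = u.length := by
  rw [List.countP_eq_length]
  intro a ha
  simpa using hu a ha

/-- Only the cut between `u` and `v` counts. A lower one leaves a live tile whose base is not at the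
final height; a higher one freezes a tile of height difference 0, which is not odd. -/
theorem frozenSum_nil {h : ℤ} {u v : List ℕ} (hu : ∀ a ∈ u, hf a < h) (hv : ∀ a ∈ v, hf a = h) :
    frozenSum q ball hf [] h (u ++ v) = finalW q ball hf h (u ++ v) := by
  classical
  have hh : height [] 0 = 0 := height_zero _
  rw [frozenSum, Finset.sum_eq_single u.length]
  · have h1 : Frozen ball hf [] h u ∧ (v.length = 0 ∨ ball) ↔
        FinalOK ball hf h (u ++ v) := by
      have hc : ∀ a ∈ u, (u ++ v).count a = u.count a := by
        intro a ha
        rw [List.count_append, List.count_eq_zero.2 (fun hm => ?_ : a ∉ v), add_zero]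
        have := hu a ha
        have := hv a hm
        omega
      constructor
      · rintro ⟨H1, H2⟩ a ha
        rcases List.mem_append.1 ha with ha | ha
        · have := H1 a ha
          rw [hc a ha]
          simp only [List.length_nil, hh, add_zero] at this
          exact ⟨this.1, Or.inr ⟨this.2.2.1, this.2.2.2⟩⟩
        · refine ⟨H2.resolve_left ?_, Or.inl (hv a ha)⟩
          have := List.length_pos_of_mem ha
          omega
      · intro H
        refine ⟨fun a ha => ?_, ?_⟩
        · obtain ⟨H1, H2⟩ := H a (List.mem_append_left _ ha)
          have h3 := hu a ha
          rcases H2 with H2 | H2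
          · omega
          · rw [hc a ha] at H2
            refine ⟨H1, fun i hi => ?_, by simpa [hh] using H2.1, H2.2⟩
            simp only [List.length_nil, Nat.le_zero] at hi
            subst hi
            rw [hh]; omega
        · cases v with
          | nil => simp
          | cons a v => exact Or.inr (H a (by simp)).1
    simp only [List.take_left, List.drop_left, live, Wt, finalW]
    rw [countP_eq_length_of_eq hf hv, Nat.sub_self, if_pos rfl, finW, ← h1]
    by_cases h2 : Frozen ball hf [] h u
    · by_cases h3 : v.length = 0 ∨ ball
      · simp only [h2, h3, and_self, if_true, List.map_append, List.sum_append]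
        rw [pow_add]
        congr 2
        · congr 1
          refine List.map_congr_left fun a ha => ?_
          rw [if_neg (hu a ha).ne]
          simp [frozenCost, hh]
        · have : v.map (fun a => if hf a = h then 1 else ((h - hf a + 1) / 2).toNat) =
              v.map fun _ => 1 := List.map_congr_left fun a ha => by rw [if_pos (hv a ha)]
          rw [this]; simp
      · rw [if_pos h2, if_neg h3, if_neg (fun h => h3 h.2), mul_zero]
    · rw [if_neg h2, if_neg (fun h => h2 h.1)]
  · intro k hk hne
    rw [Finset.mem_range, List.length_append] at hk
    rcases lt_or_gt_of_ne hne with h1 | h1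
    · have h2 : live q ball hf [] h ((u ++ v).drop k) = 0 := by
        simp only [live, Wt]
        rw [if_neg]
        rw [List.drop_append_of_le_length h1.le, List.countP_append, countP_eq_length_of_eq hf hv,
          countP_eq_zero_of_ne hf (fun a ha => (hu a (List.mem_of_mem_drop ha)).ne)]
        simp; omega
      rw [h2]; simp
    · rw [if_neg]
      intro hF
      have hm : v[0]'(by omega) ∈ (u ++ v).take k := by
        rw [List.take_append]
        refine List.mem_append_right _ ?_
        have h5 : 0 < (v.take (k - u.length)).length := by simp; omega
        have h6 : (v.take (k - u.length))[0] = v[0]'(by omega) := by simp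
        rw [← h6]; exact List.getElem_mem h5
      have := (hF _ hm).2.2.1
      rw [List.length_nil, hh, hv _ (by simp)] at this
      simp at this
  · intro hk
    exact absurd (Finset.mem_range.2 (by simp)) hk

theorem frozen_cons {st : Step} {l : List Step} {h : ℤ} {w : List ℕ} (hw : ∀ a ∈ w, hf a ≤ h) :
    Frozen ball hf (st :: l) h w ↔ Frozen ball hf l (h + st.rise) w := by
  refine forall₂_congr fun a ha => and_congr_right fun _ => and_congr ?_ ?_
  · constructor
    · intro H i hi
      have := H (i + 1) (by simpa using hi)
      rw [height_cons_succ] at this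
      omega
    · intro H i hi
      cases i with
      | zero => rw [height_zero]; have := hw a ha; omega
      | succ i =>
        have := H i (by simpa using hi)
        rw [height_cons_succ]
        omega
  · rw [List.length_cons, height_cons_succ, add_assoc]

/-- A frozen tile of `v` would be undercut, so cuts beyond `u` vanish. The others match term by
term: each frozen tile has already paid for this down step in `frozenCost`, each live one pays in
`Wt`. -/
theorem frozenSum_down {l : List Step} {x : ℕ} {u v : List ℕ} (hx : hf (x + 1) = hf x - 1)
    (hle : ∀ a ∈ u ++ v, a ≤ x)
    (hu : ∀ a ∈ u, hf a < hf x) (hv : ∀ a ∈ v, hf a = hf x) :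
    frozenSum q ball hf (Step.D :: l) (hf x) (u ++ v) =
      ∑ s' ∈ nexts hf x (u ++ v), q ^ cost hf x (u ++ v) s' *
        frozenSum q ball hf l (hf (x + 1)) s' := by
  classical
  have hu' : ∀ a ∈ u, a < x + 1 := fun a ha => Nat.lt_succ_of_le (hle a (List.mem_append_left _ ha))
  have hc : ∀ s', cost hf x (u ++ v) s' = (u ++ v).length := fun s' => if_pos (by omega)
  rw [sum_nexts_down hx hu hv, hc, hc, ← mul_add,
    frozenSum_append_replicate q ball hf hu' rfl, frozenSum_append_replicate q ball hf hu' rfl,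
    ← Finset.sum_add_distrib, Finset.mul_sum, frozenSum, List.length_append,
    Nat.add_right_comm, Finset.sum_range_add]
  have h0 : ∑ k ∈ Finset.range v.length,
      (if Frozen ball hf (Step.D :: l) (hf x) ((u ++ v).take (u.length + 1 + k)) then
        q ^ (((u ++ v).take (u.length + 1 + k)).map (frozenCost hf (Step.D :: l) (hf x))).sum *
          live q ball hf (Step.D :: l) (hf x) ((u ++ v).drop (u.length + 1 + k)) else 0) = 0 := by
    refine Finset.sum_eq_zero fun k hk => if_neg fun hF => ?_
    rw [Finset.mem_range] at hk
    have hm : v[0]'(by omega) ∈ (u ++ v).take (u.length + 1 + k) := by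
      rw [List.take_append]
      refine List.mem_append_right _ ?_
      have h5 : 0 < (v.take (u.length + 1 + k - u.length)).length := by simp; omega
      have h6 : (v.take (u.length + 1 + k - u.length))[0] = v[0]'(by omega) := by simp
      rw [← h6]; exact List.getElem_mem h5
    have := (hF _ hm).2.1 1 (by simp)
    rw [height_cons_succ, height_zero, hv _ (by simp)] at this
    simp [Step.rise] at this
  rw [h0, add_zero]
  refine Finset.sum_congr rfl fun k hk => ?_
  rw [Finset.mem_range] at hk
  have hk' : k ≤ u.length := by omega
  have hw : ∀ a ∈ u.take k, hf a ≤ hf x := fun a ha => (hu a (List.mem_of_mem_take ha)).le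
  have hx' : hf x + Step.D.rise = hf (x + 1) := by rw [hx]; rfl
  rw [List.take_append_of_le_length hk', List.drop_append_of_le_length hk']
  simp only [frozen_cons ball hf hw, hx']
  split_ifs with hF
  · have h1 : (u.take k).map (frozenCost hf (Step.D :: l) (hf x)) =
        (u.take k).map fun a => 1 + frozenCost hf l (hf (x + 1)) a := by
      refine List.map_congr_left fun a _ => ?_
      rw [frozenCost, frozenCost, List.length_cons, height_cons_succ, ← add_assoc, hx']
      simp; ring
    have h2 : ((u.take k).map fun a => 1 + frozenCost hf l (hf (x + 1)) a).sum =
        k + ((u.take k).map (frozenCost hf l (hf (x + 1)))).sum := by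
      rw [List.sum_map_add]
      simp [hk']
    have h3 : ((u.drop k ++ v).countP fun a => decide (hf a = hf x)) = v.length := by
      rw [List.countP_append, countP_eq_length_of_eq hf hv,
        countP_eq_zero_of_ne hf (fun a ha => (hu a (List.mem_of_mem_drop ha)).ne), zero_add]
    have h4 : ∀ i : ℕ, ((u.drop k ++ v).countP fun a => decide (hf a = hf x - 1 - i)) =
        (u.drop k).countP fun a => decide (hf a = hf x - 1 - i) := by
      intro i
      rw [List.countP_append, countP_eq_zero_of_ne hf (u := v) (fun a ha => ?_), add_zero]
      have := hv a ha
      omega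
    have h5 : (u.drop k ++ v).length - v.length = u.length - k := by simp
    rw [h1, h2, live, h3, h5]
    simp only [h4]
    simp only [Wt]
    have h6 : (fun i : ℕ => (u.drop k).countP fun a => decide (hf a = hf x - 1 - ((i + 1 : ℕ) : ℤ))) =
        fun i : ℕ => (u.drop k).countP fun a => decide (hf a = hf (x + 1) - 1 - i) := by
      funext i
      have : hf x - 1 - ((i + 1 : ℕ) : ℤ) = hf (x + 1) - 1 - i := by rw [hx]; push_cast; ring
      rw [this]
    have h7 : hf x - 1 - ((0 : ℕ) : ℤ) = hf (x + 1) := by rw [hx]; simp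
    simp only [h6, h7]
    have h8 : (u ++ v).length = k + (v.length + (u.length - k)) := by simp; omega
    rw [List.length_append] at h8
    rw [h8, pow_add, pow_add]
    ring
  · simp

/-- The sums over the number `e` of closed tiles and the number `k` of frozen ones are interchanged;
`B k` is the resulting summand of `Wt`. A frozen tile pays nothing at an up step. -/
theorem frozenSum_up {l : List Step} {x : ℕ} {u v : List ℕ} (hx : hf (x + 1) = hf x + 1)
    (hs : StackInv hf x (u ++ v))
    (hu : ∀ a ∈ u, hf a < hf x) (hv : ∀ a ∈ v, hf a = hf x) :
    frozenSum q ball hf (Step.U :: l) (hf x) (u ++ v) =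
      ∑ s' ∈ nexts hf x (u ++ v), q ^ cost hf x (u ++ v) s' *
        frozenSum q ball hf l (hf (x + 1)) s' := by
  classical
  have hle : ∀ a ∈ u ++ v, a ≤ x := fun a ha => (hs.1 a ha).1
  have hcost : ∀ e ≤ v.length, ∀ e', cost hf x (u ++ v)
      (u ++ v.take (v.length - e) ++ List.replicate e' (x + 1)) = e := by
    intro e he e'
    rw [cost, if_neg (by omega), changed_take hle e e' he]
  have hx' : hf x + Step.U.rise = hf (x + 1) := by rw [hx]; rfl
  set c := v.length with hc
  set s := u ++ v with hsdef
  have htk : ∀ e ≤ c, u ++ v.take (c - e) = s.take (s.length - e) := by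
    intro e he
    rw [hsdef, List.length_append, Nat.add_sub_assoc he]
    simp [List.take_append]
  -- the contribution of `e` closed tiles and `k` frozen tiles
  set B : ℕ → ℕ → ℕ → K := fun k i d =>
    frz q (Okay ball) l (s.length - k - ((s.drop k).countP fun a => hf a = hf x) + i)
      (fun d => Wt q (Okay ball) (finW q ball) l d
        (s.length - k - ((s.drop k).countP fun a => hf a = hf x) + i)
        (push i fun i => (s.drop k).countP fun a => hf a = hf x - 1 - i)) d with hB
  have hcount : ∀ k ≤ s.length, ((s.drop k).countP fun a => decide (hf a = hf x)) =
      min c (s.length - k) := by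
    intro k hk
    rw [hsdef] at hk ⊢
    rw [List.length_append] at hk ⊢
    rcases le_total k u.length with h | h
    · rw [List.drop_append_of_le_length h, List.countP_append, countP_eq_length_of_eq hf hv,
        countP_eq_zero_of_ne hf (fun a ha => (hu a (List.mem_of_mem_drop ha)).ne)]
      omega
    · rw [List.drop_append, List.drop_of_length_le h, List.nil_append,
        countP_eq_length_of_eq hf (fun a ha => hv a (List.mem_of_mem_drop ha)), List.length_drop]
      omega
  have hA : ∀ e ≤ c, ∀ d, frozenSum q ball hf l (hf (x + 1))
      (s.take (s.length - e) ++ List.replicate d (x + 1)) =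
      ∑ k ∈ Finset.range (s.length - e + 1), if Frozen ball hf l (hf (x + 1)) (s.take k) then
        q ^ ((s.take k).map (frozenCost hf l (hf (x + 1)))).sum *
          B k (min c (s.length - k) - e) d else 0 := by
    intro e he d
    have hec : e ≤ s.length := by rw [hsdef, List.length_append]; omega
    have hu' : ∀ a ∈ s.take (s.length - e), a < x + 1 :=
      fun a ha => Nat.lt_succ_of_le (hle a (List.mem_of_mem_take ha))
    rw [frozenSum_append_replicate q ball hf hu' rfl, List.length_take, min_eq_left (by omega)]
    refine Finset.sum_congr rfl fun k hk => ?_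
    rw [Finset.mem_range] at hk
    rw [List.take_take, min_eq_left (by omega)]
    split_ifs with hF
    · congr 1
      have h1 : (s.take (s.length - e)).drop k = (s.drop k).take (s.length - e - k) := by
        rw [List.drop_take]
      have hsub : ∀ a ∈ (s.take (s.length - e)).drop k, hf a ≤ hf x := fun a ha =>
        (hs.1 a (List.mem_of_mem_take (List.mem_of_mem_drop ha))).2
      have h2 : (((s.take (s.length - e)).drop k).countP fun a => decide (hf a = hf (x + 1))) = 0 :=
        countP_eq_zero_of_ne hf fun a ha => by have := hsub a ha; omega
      have h3 : s.drop k = (s.take (s.length - e)).drop k ++ s.drop (s.length - e) := by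
        conv_lhs => rw [← List.take_append_drop (s.length - e) s]
        rw [List.drop_append_of_le_length (by simp; omega)]
      have h4 : ∀ a ∈ s.drop (s.length - e), hf a = hf x := by
        intro a ha
        rw [hsdef, List.length_append, Nat.add_sub_assoc he, List.drop_append,
          List.drop_of_length_le (by omega), List.nil_append] at ha
        exact hv a (List.mem_of_mem_drop ha)
      have h5 : (((s.take (s.length - e)).drop k).countP fun a => decide (hf a = hf x)) =
          min c (s.length - k) - e := by
        have := hcount k (by omega)
        rw [h3, List.countP_append, countP_eq_length_of_eq hf h4, List.length_drop] at this
        omega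
      have h6 : ∀ i : ℕ, ((s.drop k).countP fun a => decide (hf a = hf x - 1 - i)) =
          ((s.take (s.length - e)).drop k).countP fun a => decide (hf a = hf x - 1 - i) := by
        intro i
        rw [h3, List.countP_append, countP_eq_zero_of_ne hf (u := s.drop (s.length - e))
          (fun a ha => ?_), add_zero]
        have := h4 a ha
        omega
      have h7 : s.length - k - min c (s.length - k) + (min c (s.length - k) - e) =
          s.length - e - k := by omega
      simp only [hB, hcount k (by omega : k ≤ s.length), h7, h2]
      simp only [add_zero, Nat.sub_zero]
      congr 1
      funext d
      congr 1
      funext i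
      cases i with
      | zero =>
        rw [push, ← h5]
        congr 2
        funext a
        have : hf (x + 1) - 1 - ((0 : ℕ) : ℤ) = hf x := by rw [hx]; simp
        rw [this]
      | succ i =>
        rw [push, h6]
        congr 2
        funext a
        have : hf (x + 1) - 1 - ((i + 1 : ℕ) : ℤ) = hf x - 1 - i := by rw [hx]; push_cast; ring
        rw [this]
    · rfl
  have hR : ∀ e ∈ Finset.range (c + 1),
      (q ^ cost hf x s (u ++ v.take (c - e) ++ List.replicate e (x + 1)) *
        frozenSum q ball hf l (hf (x + 1)) (u ++ v.take (c - e) ++ List.replicate e (x + 1)) +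
      if e = 0 then 0 else
        q ^ cost hf x s (u ++ v.take (c - e) ++ List.replicate (e - 1) (x + 1)) *
        frozenSum q ball hf l (hf (x + 1)) (u ++ v.take (c - e) ++ List.replicate (e - 1) (x + 1))) =
      ∑ k ∈ Finset.range (s.length - e + 1), if Frozen ball hf l (hf (x + 1)) (s.take k) then
        q ^ ((s.take k).map (frozenCost hf l (hf (x + 1)))).sum *
          (q ^ e * (B k (min c (s.length - k) - e) e +
            if e = 0 then 0 else B k (min c (s.length - k) - e) (e - 1))) else 0 := by
    intro e he
    have he' : e ≤ c := by rw [Finset.mem_range] at he; omega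
    rw [hcost e he', hcost e he', htk e he', hA e he', hA e he']
    rw [Finset.mul_sum, Finset.mul_sum]
    by_cases h0 : e = 0
    · simp only [h0, if_true, add_zero]
      refine Finset.sum_congr rfl fun k _ => ?_
      split_ifs <;> ring
    · simp only [h0, if_false]
      rw [← Finset.sum_add_distrib]
      refine Finset.sum_congr rfl fun k _ => ?_
      split_ifs <;> ring
  rw [sum_nexts_up hx hs hu hv, Finset.sum_congr rfl hR]
  -- Closed tiles are based at the present height and are not frozen: `e ≤ c` and `e + k ≤
  -- s.length`.
  rw [Finset.sum_comm' (t' := Finset.range (s.length + 1))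
    (s' := fun k => Finset.range (min c (s.length - k) + 1))]
  · rw [frozenSum]
    refine Finset.sum_congr rfl fun k hk => ?_
    rw [Finset.mem_range] at hk
    have hw : ∀ a ∈ s.take k, hf a ≤ hf x := fun a ha => (hs.1 a (List.mem_of_mem_take ha)).2
    simp only [frozen_cons ball hf hw, hx']
    split_ifs with hF
    · rw [← Finset.mul_sum]
      congr 1
      · congr 2
        refine List.map_congr_left fun a _ => ?_
        rw [frozenCost, frozenCost, List.length_cons, height_cons_succ, ← add_assoc, hx']
        simp
      · rw [live, hcount k (by omega)]
        simp only [Wt, upSum, hB, List.length_drop, hcount k (by omega : k ≤ s.length)]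
    · simp
  · intro e k
    simp only [Finset.mem_range]
    have : c ≤ s.length := by rw [hsdef, List.length_append]; omega
    omega

/-- Continuations are sorted by the number of tiles of `s` that reach the end with positive height
difference. -/
theorem W1_eq_frozenSum {l : List Step} {x : ℕ} {s : List ℕ}
    (hl : ∀ i ≤ l.length, hf (x + i) = hf x + height l i) (hs : StackInv hf x s) :
    W1 q hf (finalW q ball hf (hf (x + l.length))) l.length x s =
      frozenSum q ball hf l (hf x) s := by
  induction l generalizing x s with
  | nil =>
    obtain ⟨u, v, rfl, hu, hv⟩ := hs.exists_append
    rw [frozenSum_nil q ball hf hu hv]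
    rfl
  | cons st l ih =>
    have hx : hf (x + 1) = hf x + st.rise := by
      rw [hl 1 (by simp), height_cons_succ, height_zero, add_zero]
    have hl' : ∀ i ≤ l.length, hf (x + 1 + i) = hf (x + 1) + height l i := by
      intro i hi
      have := hl (i + 1) (by simpa using hi)
      rw [height_cons_succ] at this
      rw [add_assoc, add_comm 1 i, this, hx]; ring
    have hx1 : |hf (x + 1) - hf x| = 1 := by rw [hx]; cases st <;> simp [Step.rise]
    have h1 : W1 q hf (finalW q ball hf (hf (x + (st :: l).length))) (st :: l).length x s =
        ∑ s' ∈ nexts hf x s, q ^ cost hf x s s' * frozenSum q ball hf l (hf (x + 1)) s' := by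
      rw [List.length_cons, W1]
      refine Finset.sum_congr rfl fun s' hs' => ?_
      rw [← ih hl' (hs.trans ((mem_nexts hx1).1 hs')), add_assoc, add_comm 1]
    rw [h1]
    obtain ⟨u, v, rfl, hu, hv⟩ := hs.exists_append
    cases st with
    | D => rw [frozenSum_down q ball hf hx (fun a ha => (hs.1 a ha).1) hu hv]
    | U => rw [frozenSum_up q ball hf hx hs hu hv]

theorem W1_nil (l : List Step) :
    W1 q (height l) (finalW q ball (height l) (height l l.length)) l.length 0 [] =
      Wt q (Okay ball) (finW q ball) l 0 0 0 := by
  have h := W1_eq_frozenSum q ball (height l) (l := l) (x := 0) (s := [])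
    (fun i _ => by simp [height_zero]) ⟨by simp, by simp⟩
  rw [zero_add] at h
  rw [h, frozenSum]
  simp [Frozen, live]
  rfl

end Runs

/-! ### Levels above the lower path, and tiles as segments of levels. -/

theorem height_drop (l : List Step) (a i : ℕ) (ha : a ≤ l.length) :
    height (l.drop a) i = height l (a + i) - height l a := by
  have h := height_append_right (l.take a) (l.drop a) i
  rw [List.take_append_drop, List.length_take, min_eq_left ha] at h
  have h2 := height_append_left (l.take a) (l.drop a) a (by simp [ha])
  rw [List.take_append_drop] at h2
  rw [h, h2]; ring

theorem height_take (l : List Step) (n i : ℕ) (hi : i ≤ n) : height (l.take n) i = height l i := by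
  rw [height, height, List.take_take, min_eq_left hi]

theorem height_succ_abs (l : List Step) (i : ℕ) (hi : i < l.length) :
    |height l (i + 1) - height l i| = 1 := by
  have h := height_drop l i 1 hi.le
  rw [List.drop_eq_getElem_cons hi, height_cons_succ, height_zero] at h
  rw [← h]
  cases l[i] <;> simp [Step.rise]

theorem exists_path (g : ℕ → ℤ) (n : ℕ) (h0 : g 0 = 0) (h : ∀ i < n, |g (i + 1) - g i| = 1) :
    ∃ m : List Step, m.length = n ∧ ∀ i ≤ n, height m i = g i := by
  induction n with
  | zero => exact ⟨[], rfl, fun i hi => by rw [Nat.le_zero.1 hi, height_zero, h0]⟩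
  | succ n ih =>
    obtain ⟨m, hm, hm'⟩ := ih fun i hi => h i (by omega)
    obtain ⟨s, hs⟩ : ∃ s : Step, s.rise = g (n + 1) - g n := by
      have := h n (by omega)
      rw [abs_eq (by norm_num)] at this
      rcases this with h | h
      · exact ⟨Step.U, h.symm⟩
      · exact ⟨Step.D, h.symm⟩
    refine ⟨m ++ [s], by simp [hm], fun i hi => ?_⟩
    rcases Nat.lt_or_ge n i with h1 | h1
    · obtain rfl : i = n + 1 := by omega
      have := height_append_right m [s] 1
      rw [hm] at this
      rw [this, hm' n le_rfl, height_cons_succ, height_zero, hs]; ring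
    · rw [height_append_left _ _ _ (by omega), hm' i h1]

theorem eq_of_height_eq {m m' : List Step} (hm : m.length = m'.length)
    (h : ∀ i ≤ m.length, height m i = height m' i) : m = m' := by
  refine List.ext_getElem hm fun i h1 h2 => ?_
  have e1 := height_drop m i 1 h1.le
  have e2 := height_drop m' i 1 h2.le
  rw [List.drop_eq_getElem_cons h1, height_cons_succ, height_zero, h _ h1, h _ h1.le] at e1
  rw [List.drop_eq_getElem_cons h2, height_cons_succ, height_zero, ← e1] at e2
  revert e2
  cases m[i] <;> cases m'[i] <;> simp [Step.rise]

/-- The number of boxes of the region between `l` and `m` over the abscissa `x`. -/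
def depth (l m : List Step) (x : ℕ) : ℕ := ((height m x - height l x) / 2).toNat

theorem height_emod_two (l : List Step) (i : ℕ) (hi : i ≤ l.length) : height l i % 2 = i % 2 := by
  have := height_length_eq (l.take i)
  rw [List.length_take, min_eq_left hi, height_take _ _ _ le_rfl] at this
  omega

theorem height_eq_add_depth {l m : List Step} (h : IsAbove m l) {x : ℕ} (hx : x ≤ l.length) :
    height m x = height l x + 2 * depth l m x := by
  have h1 := height_emod_two l x hx
  have h2 := height_emod_two m x (h.1 ▸ hx)
  have h3 := h.2 x hx
  rw [depth]
  omega

/-- The box over the abscissa `x` at level `k` above the path `l`. -/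
def cell (l : List Step) (k x : ℕ) : Box := (x, height l x + 1 + 2 * k)

theorem cell_inj {l : List Step} {k k' x x' : ℕ} :
    cell l k x = cell l k' x' ↔ k = k' ∧ x = x' := by
  constructor
  · intro h
    obtain ⟨rfl, h2⟩ := Prod.mk.inj h
    exact ⟨by omega, rfl⟩
  · rintro ⟨rfl, rfl⟩; rfl

theorem mem_region {l m : List Step} {b : Box} : b ∈ region l m ↔ (1 ≤ b.1 ∧ b.1 ≤ l.length) ∧
    (height l b.1 < b.2 ∧ b.2 < height m b.1) ∧ Odd (b.2 - height l b.1) := by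
  obtain ⟨x, y⟩ := b
  simp only [region, Finset.mem_biUnion, Finset.mem_image, Finset.mem_filter, Finset.mem_Ioo,
    Finset.mem_Icc, Prod.mk.injEq]
  constructor
  · rintro ⟨x', hx, y', hy, rfl, rfl⟩; exact ⟨hx, hy⟩
  · rintro ⟨hx, hy⟩; exact ⟨x, hx, y, hy, rfl, rfl⟩

theorem exists_cell_of_mem_region {l m : List Step} {b : Box} (hb : b ∈ region l m) :
    ∃ k, b = cell l k b.1 := by
  obtain ⟨-, ⟨h1, -⟩, ⟨r, hr⟩⟩ := mem_region.1 hb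
  refine ⟨r.toNat, Prod.ext rfl ?_⟩
  simp only [cell]
  omega

theorem cell_mem_region {l m : List Step} (h : IsAbove m l) {k x : ℕ} :
    cell l k x ∈ region l m ↔ (1 ≤ x ∧ x ≤ l.length) ∧ k < depth l m x := by
  rw [mem_region]
  simp only [cell]
  refine and_congr_right fun hx => ?_
  rw [height_eq_add_depth h hx.2]
  constructor
  · rintro ⟨h1, -⟩; omega
  · intro h1
    exact ⟨by omega, k, by ring⟩

/-- The boxes at level `k` above the path `l` with abscissas from `a` to `b`. -/
def seg (l : List Step) (k a b : ℕ) : Finset Box := (Finset.Icc a b).image (cell l k)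

theorem cell_mem_seg {l : List Step} {k k' a b x : ℕ} :
    cell l k x ∈ seg l k' a b ↔ k = k' ∧ a ≤ x ∧ x ≤ b := by
  simp only [seg, Finset.mem_image, Finset.mem_Icc, cell_inj]
  constructor
  · rintro ⟨y, h, rfl, rfl⟩; exact ⟨rfl, h⟩
  · rintro ⟨rfl, h⟩; exact ⟨x, h, rfl, rfl⟩

theorem card_seg (l : List Step) (k a b : ℕ) : (seg l k a b).card = b + 1 - a := by
  rw [seg, Finset.card_image_of_injective _ fun x y h => (cell_inj.1 h).2, Nat.card_Icc]

/-- The path `l` stays above the height of its point of abscissa `a` as far as the abscissa `b`. -/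
def Base (l : List Step) (a b : ℕ) : Prop := ∀ y, a ≤ y → y ≤ b → height l a ≤ height l y

/-- A level runs parallel to `l`, so the ribbon must follow the piece of `l` from `a` to `b`. -/
theorem isBallotTile_seg_iff {l : List Step} {k a b n n' : ℕ} (hab : a ≤ b) (hb : b ≤ l.length)
    (h : Base l a b) :
    IsBallotTile (seg l k a b) n n' ↔ (n' : ℤ) = height l b - height l a ∧ b = a + (2 * n + n') := by
  constructor
  · rintro ⟨⟨x, y⟩, w, ⟨h1, h2, h3⟩, h4⟩
    have hmem : ∀ i ≤ w.length, (a ≤ x + i ∧ x + i ≤ b) ∧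
        y + height w i = height l (x + i) + 1 + 2 * k := by
      intro i hi
      have : (x + i, y + height w i) ∈ seg l k a b := by
        rw [h4]
        exact Finset.mem_image.2 ⟨i, Finset.mem_range.2 (by omega), rfl⟩
      obtain ⟨z, hz, hz'⟩ := Finset.mem_image.1 this
      obtain ⟨rfl, h6⟩ := Prod.mk.inj hz'
      exact ⟨Finset.mem_Icc.1 hz, h6.symm⟩
    have hmem' : ∀ z, a ≤ z → z ≤ b → x ≤ z ∧ z ≤ x + w.length := by
      intro z h5 h6
      have : cell l k z ∈ ribbon (x, y) w := by
        rw [← h4, cell_mem_seg]; exact ⟨rfl, h5, h6⟩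
      obtain ⟨i, hi, hi'⟩ := Finset.mem_image.1 this
      have h7 := (Prod.mk.inj hi').1
      rw [Finset.mem_range] at hi
      simp only at h7
      omega
    have h5 := hmem 0 (by omega)
    have h6 := hmem w.length le_rfl
    have h7 := hmem' a le_rfl hab
    have h8 := hmem' b hab le_rfl
    obtain rfl : x = a := by omega
    obtain rfl : b = x + w.length := by omega
    rw [height_zero] at h5
    simp only [add_zero] at h5
    exact ⟨by omega, by omega⟩
  · rintro ⟨h1, h2⟩
    have hw : ((l.drop a).take (b - a)).length = b - a := by simp; omega
    have hh : ∀ i ≤ b - a, height ((l.drop a).take (b - a)) i = height l (a + i) - height l a := by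
      intro i hi
      rw [height_take _ _ _ hi, height_drop _ _ _ (by omega)]
    refine ⟨cell l k a, (l.drop a).take (b - a), ⟨by omega, ?_, ?_⟩, ?_⟩
    · rw [hw, hh _ le_rfl, Nat.add_sub_cancel' hab, h1]
    · intro i hi
      rw [hw] at hi
      rw [hh i hi]
      have := h (a + i) (by omega) (by omega)
      omega
    · rw [seg, ribbon, hw]
      ext c
      simp only [Finset.mem_image, Finset.mem_Icc, Finset.mem_range]
      constructor
      · rintro ⟨z, hz, rfl⟩
        refine ⟨z - a, by omega, ?_⟩
        rw [hh _ (by omega), Nat.add_sub_cancel' hz.1]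
        simp only [cell, Prod.mk.injEq]
        exact ⟨by omega, by ring⟩
      · rintro ⟨i, hi, rfl⟩
        refine ⟨a + i, by omega, ?_⟩
        rw [hh _ (by omega)]
        simp only [cell, Prod.mk.injEq, true_and]
        ring

theorem exists_isBallotTile_seg {l : List Step} {k a b : ℕ} (hab : a ≤ b) (hb : b ≤ l.length)
    (h : Base l a b) : ∃ n n', IsBallotTile (seg l k a b) n n' := by
  have h1 := height_emod_two l a (by omega)
  have h2 := height_emod_two l b hb
  have h3 := h b hab le_rfl
  have h4 : height l b - height l a ≤ b - a := by
    have := height_length_eq ((l.drop a).take (b - a))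
    have hw : ((l.drop a).take (b - a)).length = b - a := by simp; omega
    rw [hw, height_take _ _ _ le_rfl, height_drop _ _ _ (by omega), Nat.add_sub_cancel' hab] at this
    omega
  refine ⟨((b - a : ℤ) - (height l b - height l a)).toNat / 2, (height l b - height l a).toNat, ?_⟩
  rw [isBallotTile_seg_iff hab hb h]
  omega

theorem isDyckTile_seg_iff {l : List Step} {k a b : ℕ} (hab : a ≤ b) (hb : b ≤ l.length)
    (h : Base l a b) : IsDyckTile (seg l k a b) ↔ height l b = height l a := by
  constructor
  · rintro ⟨n, hn⟩
    have := ((isBallotTile_seg_iff hab hb h).1 hn).1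
    push_cast at this
    omega
  · intro h1
    obtain ⟨n, n', hn⟩ := exists_isBallotTile_seg (k := k) hab hb h
    have := ((isBallotTile_seg_iff hab hb h).1 hn).1
    obtain rfl : n' = 0 := by omega
    exact ⟨n, hn⟩

/-- Cover-inclusive tilings by ballot tiles, the tiles of positive height difference being
anchored. -/
def IsTiling (l m : List Step) (T : Finset (Finset Box)) : Prop :=
  (∀ t ∈ T, ∃ n n', IsBallotTile t n n') ∧ Tiles T (region l m) ∧ CoverInclusive l T ∧
    ∀ t ∈ T, ∀ n n', IsBallotTile t n n' → 1 ≤ n' → ∃ b ∈ t, b.1 = l.length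

theorem IsTiling.subset {l m : List Step} {T : Finset (Finset Box)} (hT : IsTiling l m T)
    {t : Finset Box} (ht : t ∈ T) : t ⊆ region l m := by
  rw [← hT.2.1.2]
  exact Finset.subset_biUnion_of_mem id ht

/-- A tile that meets level 0 must sink entirely below `l`, so it lies in level 0; a tile that meets
level k + 1 sinks into a tile of level k. -/
theorem IsTiling.exists_level {l m : List Step} {T : Finset (Finset Box)} (hT : IsTiling l m T)
    {t : Finset Box} (ht : t ∈ T) {k x : ℕ} (hx : cell l k x ∈ t) : ∀ b ∈ t, b = cell l k b.1 := by
  induction k generalizing t x with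
  | zero =>
    rcases hT.2.2.1 t ht with h | ⟨t', ht', h⟩
    · intro b hb
      obtain ⟨k, hk⟩ := exists_cell_of_mem_region (hT.subset ht hb)
      have := h b hb
      rw [hk] at this
      simp only [cell] at this
      obtain rfl : k = 0 := by omega
      exact hk
    · have h1 := mem_region.1 (hT.subset ht' (h _ hx))
      simp only [cell] at h1
      have := h1.2.1.1
      omega
  | succ k ih =>
    rcases hT.2.2.1 t ht with h | ⟨t', ht', h⟩
    · have := h _ hx
      simp only [cell] at this
      push_cast at this
      omega
    · intro b hb
      have h1 : cell l k x ∈ t' := by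
        have := h _ hx
        convert this using 1
        simp only [cell, Prod.mk.injEq, true_and]
        push_cast; ring
      have h2 := ih ht' h1 _ (h b hb)
      have h3 := (Prod.mk.inj h2).2
      refine Prod.ext rfl ?_
      simp only [cell]
      simp only at h3
      push_cast
      omega

theorem IsTiling.exists_seg {l m : List Step} {T : Finset (Finset Box)} (hT : IsTiling l m T)
    {t : Finset Box} (ht : t ∈ T) : ∃ k a b, t = seg l k a b ∧ a ≤ b ∧ 1 ≤ a ∧ b ≤ l.length ∧
      Base l a b ∧ (height l b = height l a ∨ b = l.length) := by
  obtain ⟨n, n', hn⟩ := hT.1 t ht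
  obtain ⟨⟨x, y⟩, w, hw, rfl⟩ := id hn
  have hmem : ∀ i ≤ w.length, (x + i, y + height w i) ∈ ribbon (x, y) w := fun i hi =>
    Finset.mem_image.2 ⟨i, Finset.mem_range.2 (by omega), rfl⟩
  obtain ⟨k, hk⟩ := exists_cell_of_mem_region (hT.subset ht (hmem 0 (by omega)))
  have hlev := hT.exists_level ht (hk ▸ hmem 0 (by omega))
  have hcell : ∀ i ≤ w.length, (x + i, y + height w i) = cell l k (x + i) := fun i hi =>
    hlev _ (hmem i hi)
  have hseg : ribbon (x, y) w = seg l k x (x + w.length) := by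
    ext c
    constructor
    · intro hc
      rw [hlev c hc, cell_mem_seg]
      obtain ⟨i, hi, rfl⟩ := Finset.mem_image.1 hc
      rw [Finset.mem_range] at hi
      exact ⟨rfl, by simp, by simp; omega⟩
    · intro hc
      obtain ⟨z, hz, rfl⟩ := Finset.mem_image.1 hc
      rw [Finset.mem_Icc] at hz
      obtain ⟨i, rfl⟩ := Nat.exists_eq_add_of_le hz.1
      rw [← hcell i (by omega)]
      exact hmem i (by omega)
  have hbase : Base l x (x + w.length) := by
    intro z h1 h2
    obtain ⟨i, rfl⟩ := Nat.exists_eq_add_of_le h1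
    have e1 := (Prod.mk.inj (hcell i (by omega))).2
    have e2 := (Prod.mk.inj (hcell 0 (by omega))).2
    have e3 := hw.2.2 i (by omega)
    rw [height_zero] at e2
    simp only [add_zero] at e2
    omega
  have hr1 := (mem_region.1 (hT.subset ht (hmem 0 (by omega)))).1
  have hr2 := (mem_region.1 (hT.subset ht (hmem w.length le_rfl))).1
  simp only at hr1 hr2
  refine ⟨k, x, x + w.length, hseg, by omega, by omega, hr2.2, hbase, ?_⟩
  have h1 := hbase (x + w.length) (by omega) le_rfl
  rcases h1.eq_or_lt with h1 | h1
  · exact Or.inl h1.symm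
  · right
    rw [hseg] at hn
    have h2 := ((isBallotTile_seg_iff (by omega) hr2.2 hbase).1 hn).1
    obtain ⟨c, hc, hc'⟩ := hT.2.2.2 _ ht n n' (hseg ▸ hn) (by omega)
    rw [hseg] at hc
    obtain ⟨z, hz, rfl⟩ := Finset.mem_image.1 hc
    rw [Finset.mem_Icc] at hz
    simp only [cell] at hc'
    omega

/-! ### The bijection between tilings and sequences of stacks. -/

theorem Trans.exists_index {hf : ℕ → ℤ} {x : ℕ} {s s' : List ℕ} (h : Trans hf x s s') :
    ∃ j : ℕ, (∀ k < j, s'[k]? = s[k]?) ∧ (∀ k a : ℕ, j ≤ k → s'[k]? = some a → a = x + 1) ∧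
      (∀ k a : ℕ, j ≤ k → s[k]? = some a → hf a = hf x) ∧
      ∀ k a : ℕ, k < j → s[k]? = some a → hf a ≤ hf (x + 1) := by
  obtain ⟨j, e, hj, rfl, h1, h2, -⟩ := h
  refine ⟨j, fun k hk => ?_, fun k a hk ha => ?_, fun k a hk ha => ?_, fun k a hk ha => ?_⟩
  · rw [List.getElem?_append_left (by simp; omega), List.getElem?_take_of_lt hk]
  · rw [List.getElem?_append_right (by simp; omega), List.getElem?_replicate] at ha
    split_ifs at ha
    exact (Option.some.inj ha).symm
  · refine h1 a (List.mem_of_getElem? (i := k - j) ?_)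
    rw [List.getElem?_drop, Nat.add_sub_cancel' hk, ha]
  · refine h2 a (List.mem_of_getElem? (i := k) ?_)
    rw [List.getElem?_take_of_lt hk, ha]

/-- `σ` is the sequence of the stacks of a tiling above `l`. -/
def IsStack (l : List Step) (σ : ℕ → List ℕ) : Prop :=
  σ 0 = [] ∧ ∀ x < l.length, Trans (height l) x (σ x) (σ (x + 1))

namespace IsStack

variable {l : List Step} {σ : ℕ → List ℕ}

theorem bounds (hσ : IsStack l σ) {x k a : ℕ} (hx : x ≤ l.length) (h : (σ x)[k]? = some a) :
    1 ≤ a ∧ a ≤ x := by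
  induction x with
  | zero => rw [hσ.1] at h; simp at h
  | succ x ih =>
    obtain ⟨j, h1, h2, -, -⟩ := (hσ.2 x (by omega)).exists_index
    rcases Nat.lt_or_ge k j with hk | hk
    · have := ih (by omega) (h1 k hk ▸ h)
      omega
    · have := h2 k a hk h
      omega

theorem of_le (hσ : IsStack l σ) {x k a : ℕ} (hx : x ≤ l.length) (h : (σ x)[k]? = some a) {z : ℕ}
    (h1 : a ≤ z) (h2 : z ≤ x) : (σ z)[k]? = some a ∧ height l a ≤ height l z := by
  induction x with
  | zero => rw [hσ.1] at h; simp at h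
  | succ x ih =>
    obtain ⟨j, e1, e2, -, e4⟩ := (hσ.2 x (by omega)).exists_index
    rcases Nat.lt_or_ge k j with hk | hk
    · have h3 : (σ x)[k]? = some a := e1 k hk ▸ h
      rcases Nat.lt_or_ge x z with h4 | h4
      · obtain rfl : z = x + 1 := by omega
        exact ⟨h, e4 k a hk h3⟩
      · exact ih (by omega) h3 h4
    · have := e2 k a hk h
      obtain rfl : z = a := by omega
      obtain rfl : z = x + 1 := by omega
      exact ⟨h, le_rfl⟩

theorem height_eq (hσ : IsStack l σ) {x k a : ℕ} (hx : x < l.length) (h : (σ x)[k]? = some a)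
    (h' : (σ (x + 1))[k]? ≠ some a) : height l x = height l a := by
  obtain ⟨j, e1, -, e3, -⟩ := (hσ.2 x hx).exists_index
  rcases Nat.lt_or_ge k j with hk | hk
  · exact absurd (e1 k hk ▸ h) h'
  · exact (e3 k a hk h).symm

/-- When a tile survives a step, so does the one below it; hence the lower neighbour is the same all
along a tile. This is cover-inclusiveness. -/
theorem nested (hσ : IsStack l σ) {x k a : ℕ} (hx : x ≤ l.length) (h : (σ x)[k + 1]? = some a) :
    (σ x)[k]? = (σ a)[k]? := by
  induction x with
  | zero => rw [hσ.1] at h; simp at h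
  | succ x ih =>
    obtain ⟨j, e1, e2, -, -⟩ := (hσ.2 x (by omega)).exists_index
    rcases Nat.lt_or_ge (k + 1) j with hk | hk
    · rw [e1 k (by omega)]
      exact ih (by omega) (e1 _ hk ▸ h)
    · rw [← e2 _ a hk h]

end IsStack

/-- The tile at level `k` that starts over the abscissa `a`. -/
def stackTile (l : List Step) (σ : ℕ → List ℕ) (k a : ℕ) : Finset Box :=
  ((Finset.Icc 1 l.length).filter fun y => (σ y)[k]? = some a).image (cell l k)

/-- The tiling with given stacks. -/
def tilingOf (l : List Step) (σ : ℕ → List ℕ) : Finset (Finset Box) :=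
  (Finset.Icc 1 l.length).biUnion fun x =>
    (Finset.range (σ x).length).image fun k => stackTile l σ k ((σ x).getD k 0)

theorem mem_tilingOf {l : List Step} {σ : ℕ → List ℕ} {t : Finset Box} :
    t ∈ tilingOf l σ ↔ ∃ x k a, (1 ≤ x ∧ x ≤ l.length) ∧ (σ x)[k]? = some a ∧
      t = stackTile l σ k a := by
  simp only [tilingOf, Finset.mem_biUnion, Finset.mem_image, Finset.mem_range, Finset.mem_Icc]
  constructor
  · rintro ⟨x, hx, k, hk, rfl⟩
    refine ⟨x, k, _, hx, ?_, rfl⟩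
    rw [List.getElem?_eq_getElem hk, List.getD_eq_getElem _ _ hk]
  · rintro ⟨x, k, a, hx, h, rfl⟩
    obtain ⟨hk, h1⟩ := List.getElem?_eq_some_iff.1 h
    refine ⟨x, hx, k, hk, ?_⟩
    rw [List.getD_eq_getElem _ _ hk, h1]

theorem cell_mem_stackTile {l : List Step} {σ : ℕ → List ℕ} {k k' a x : ℕ} :
    cell l k x ∈ stackTile l σ k' a ↔ k = k' ∧ (1 ≤ x ∧ x ≤ l.length) ∧ (σ x)[k]? = some a := by
  simp only [stackTile, Finset.mem_image, Finset.mem_filter, Finset.mem_Icc, cell_inj]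
  constructor
  · rintro ⟨y, h, rfl, rfl⟩; exact ⟨rfl, h⟩
  · rintro ⟨rfl, h⟩; exact ⟨x, h, rfl, rfl⟩

namespace IsStack

variable {l : List Step} {σ : ℕ → List ℕ}

theorem stackTile_eq_seg (hσ : IsStack l σ) {x k a : ℕ} (hx : x ≤ l.length)
    (h : (σ x)[k]? = some a) :
    ∃ b, stackTile l σ k a = seg l k a b ∧ x ≤ b ∧ b ≤ l.length ∧ Base l a b ∧
      (∀ y, a ≤ y → y ≤ b → (σ y)[k]? = some a) ∧
      (b < l.length → (σ (b + 1))[k]? ≠ some a) := by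
  set S := (Finset.Icc 1 l.length).filter fun y => (σ y)[k]? = some a with hS
  have hax := hσ.bounds hx h
  have hxS : x ∈ S := by
    rw [hS, Finset.mem_filter, Finset.mem_Icc]; exact ⟨by omega, h⟩
  have hb := S.max'_mem ⟨x, hxS⟩
  set b := S.max' ⟨x, hxS⟩ with hbdef
  have hb2 := hb
  rw [hS, Finset.mem_filter, Finset.mem_Icc] at hb2
  have hmax : ∀ y ∈ S, y ≤ b := fun y hy => S.le_max' y hy
  refine ⟨b, ?_, hmax x hxS, hb2.1.2, fun y h1 h2 => (hσ.of_le hb2.1.2 hb2.2 h1 h2).2,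
    fun y h1 h2 => (hσ.of_le hb2.1.2 hb2.2 h1 h2).1, fun h1 h2 => ?_⟩
  · rw [stackTile, seg]
    congr 1
    ext y
    rw [Finset.mem_Icc]
    constructor
    · intro hy
      have hy2 := hy
      rw [Finset.mem_filter, Finset.mem_Icc] at hy2
      exact ⟨(hσ.bounds hy2.1.2 hy2.2).2, hmax y hy⟩
    · rintro ⟨h1, h2⟩
      rw [Finset.mem_filter, Finset.mem_Icc]
      exact ⟨by omega, (hσ.of_le hb2.1.2 hb2.2 h1 h2).1⟩
  · have : b + 1 ∈ S := by
      rw [hS, Finset.mem_filter, Finset.mem_Icc]; exact ⟨by omega, h2⟩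
    have := hmax _ this
    omega

theorem isTiling (hσ : IsStack l σ) {m : List Step} (hm : IsAbove m l)
    (hd : ∀ x ≤ l.length, depth l m x = (σ x).length) : IsTiling l m (tilingOf l σ) := by
  refine ⟨?_, ⟨?_, ?_⟩, ?_, ?_⟩
  · intro t ht
    obtain ⟨x, k, a, hx, h, rfl⟩ := mem_tilingOf.1 ht
    obtain ⟨b, hb, hxb, hbl, hbase, -, -⟩ := hσ.stackTile_eq_seg hx.2 h
    have := hσ.bounds hx.2 h
    rw [hb]
    exact exists_isBallotTile_seg (by omega) hbl hbase
  · intro t ht t' ht' hne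
    obtain ⟨x, k, a, hx, h, rfl⟩ := mem_tilingOf.1 ht
    obtain ⟨x', k', a', hx', h', rfl⟩ := mem_tilingOf.1 ht'
    rw [Finset.disjoint_left]
    intro c hc hc'
    obtain ⟨y, -, rfl⟩ := Finset.mem_image.1 hc
    rw [cell_mem_stackTile] at hc hc'
    obtain ⟨rfl, -, h1⟩ := hc'
    rw [hc.2.2] at h1
    exact hne (by rw [Option.some.inj h1])
  · ext c
    rw [Finset.mem_biUnion]
    constructor
    · rintro ⟨t, ht, hc⟩
      obtain ⟨x, k, a, hx, h, rfl⟩ := mem_tilingOf.1 ht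
      obtain ⟨y, -, rfl⟩ := Finset.mem_image.1 hc
      rw [id, cell_mem_stackTile] at hc
      rw [cell_mem_region hm, hd y hc.2.1.2]
      exact ⟨hc.2.1, (List.getElem?_eq_some_iff.1 hc.2.2).1⟩
    · intro hc
      obtain ⟨k, hk⟩ := exists_cell_of_mem_region hc
      obtain ⟨x, y⟩ := c
      simp only at hk
      rw [hk] at hc ⊢
      rw [cell_mem_region hm] at hc
      obtain ⟨hx, hk'⟩ := hc
      rw [hd x hx.2] at hk'
      have h1 := List.getElem?_eq_getElem hk'
      exact ⟨_, mem_tilingOf.2 ⟨x, k, _, hx, h1, rfl⟩, cell_mem_stackTile.2 ⟨rfl, hx, h1⟩⟩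
  · intro t ht
    obtain ⟨x, k, a, hx, h, rfl⟩ := mem_tilingOf.1 ht
    cases k with
    | zero =>
      left
      intro c hc
      obtain ⟨y, -, rfl⟩ := Finset.mem_image.1 hc
      simp only [cell]
      push_cast
      omega
    | succ k =>
      right
      have hax := hσ.bounds hx.2 h
      have ha := (hσ.of_le hx.2 h le_rfl hax.2).1
      have hk : k < (σ a).length := by
        have := (List.getElem?_eq_some_iff.1 ha).1
        omega
      have h1 := List.getElem?_eq_getElem hk
      -- The containing tile is the one found at level `k` where the upper tile starts.
      refine ⟨_, mem_tilingOf.2 ⟨a, k, _, ⟨hax.1, by omega⟩, h1, rfl⟩, ?_⟩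
      intro c hc
      obtain ⟨y, -, rfl⟩ := Finset.mem_image.1 hc
      rw [cell_mem_stackTile] at hc
      have h2 : ((cell l (k + 1) y).1, (cell l (k + 1) y).2 - 2) = cell l k y := by
        simp only [cell, Prod.mk.injEq, true_and]
        push_cast; ring
      rw [h2, cell_mem_stackTile]
      exact ⟨rfl, hc.2.1, by rw [hσ.nested hc.2.1.2 hc.2.2, h1]⟩
  · intro t ht n n' hn hn'
    obtain ⟨x, k, a, hx, h, rfl⟩ := mem_tilingOf.1 ht
    obtain ⟨b, hb, hxb, hbl, hbase, hy, hend⟩ := hσ.stackTile_eq_seg hx.2 h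
    have hax := hσ.bounds hx.2 h
    rw [hb] at hn ⊢
    have h1 := ((isBallotTile_seg_iff (by omega) hbl hbase).1 hn).1
    refine ⟨cell l k b, cell_mem_seg.2 ⟨rfl, by omega, le_rfl⟩, ?_⟩
    by_contra hne
    have hlt : b < l.length := lt_of_le_of_ne hbl hne
    have := hσ.height_eq hlt (hy b (by omega) le_rfl) (hend hlt)
    omega

end IsStack

/-- The abscissa of the first box of the tile that covers the box at level `k` over `x`. -/
noncomputable def start (l : List Step) (T : Finset (Finset Box)) (x k : ℕ) : ℕ :=
  sInf {a | ∃ t ∈ T, cell l k x ∈ t ∧ cell l k a ∈ t}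

/-- The stack of a tiling over the abscissa `x`. -/
noncomputable def stackOf (l m : List Step) (T : Finset (Finset Box)) (x : ℕ) : List ℕ :=
  (List.range (depth l m x)).map (start l T x)

theorem IsTiling.eq_of_mem {l m : List Step} {T : Finset (Finset Box)} (hT : IsTiling l m T)
    {t t' : Finset Box} (ht : t ∈ T) (ht' : t' ∈ T) {c : Box} (hc : c ∈ t) (hc' : c ∈ t') :
    t = t' := by
  by_contra hne
  exact Finset.disjoint_left.1 (hT.2.1.1 t ht t' ht' hne) hc hc'

theorem IsTiling.start_eq {l m : List Step} {T : Finset (Finset Box)} (hT : IsTiling l m T)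
    {k x a b : ℕ} (ht : seg l k a b ∈ T) (h1 : a ≤ x) (h2 : x ≤ b) : start l T x k = a := by
  have hx : cell l k x ∈ seg l k a b := cell_mem_seg.2 ⟨rfl, h1, h2⟩
  have : {a | ∃ t ∈ T, cell l k x ∈ t ∧ cell l k a ∈ t} = Set.Icc a b := by
    ext z
    constructor
    · rintro ⟨t, ht', hx', hz⟩
      rw [hT.eq_of_mem ht' ht hx' hx, cell_mem_seg] at hz
      exact hz.2
    · intro hz
      exact ⟨_, ht, hx, cell_mem_seg.2 ⟨rfl, hz⟩⟩
  rw [start, this, csInf_Icc (h1.trans h2)]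

theorem stackOf_getElem?_eq_some {l m : List Step} {T : Finset (Finset Box)} {x k a : ℕ} :
    (stackOf l m T x)[k]? = some a ↔ k < depth l m x ∧ start l T x k = a := by
  rw [stackOf, List.getElem?_map]
  by_cases hk : k < depth l m x
  · simp [hk]
  · simp [hk]

/-- Every box of the region lies in a tile. -/
theorem IsTiling.exists_mem {l m : List Step} {T : Finset (Finset Box)} (hT : IsTiling l m T)
    (hm : IsAbove m l) {k x : ℕ} (hx : 1 ≤ x ∧ x ≤ l.length) (hk : k < depth l m x) :
    ∃ a b, seg l k a b ∈ T ∧ a ≤ x ∧ x ≤ b ∧ 1 ≤ a ∧ b ≤ l.length ∧ Base l a b ∧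
      (height l b = height l a ∨ b = l.length) := by
  have h1 := (cell_mem_region hm).2 ⟨hx, hk⟩
  rw [← hT.2.1.2, Finset.mem_biUnion] at h1
  obtain ⟨t, ht, hc⟩ := h1
  obtain ⟨k', a, b, rfl, hab, ha, hb, hbase, hend⟩ := hT.exists_seg ht
  obtain ⟨rfl, h2⟩ := cell_mem_seg.1 hc
  exact ⟨a, b, ht, h2.1, h2.2, ha, hb, hbase, hend⟩

theorem IsTiling.depth_zero {l m : List Step} : depth l m 0 = 0 := by
  simp [depth, height_zero]

theorem IsTiling.isStack {l m : List Step} {T : Finset (Finset Box)} (hT : IsTiling l m T)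
    (hm : IsAbove m l) : IsStack l (stackOf l m T) := by
  classical
  refine ⟨by simp [stackOf, depth_zero], fun x hx => ?_⟩
  -- the levels at which a tile covers both abscissas
  set P : ℕ → Prop := fun k => ∃ t ∈ T, cell l k x ∈ t ∧ cell l k (x + 1) ∈ t with hP
  -- By cover-inclusiveness these levels form an initial segment, whose length is the `j` of
  -- `Trans`.
  have hdown : ∀ k, P (k + 1) → P k := by
    rintro k ⟨t, ht, h1, h2⟩
    rcases hT.2.2.1 t ht with h | ⟨t', ht', h⟩
    · have := h _ h1
      simp only [cell] at this
      push_cast at this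
      omega
    · have h3 : ∀ y, ((cell l (k + 1) y).1, (cell l (k + 1) y).2 - 2) = cell l k y := by
        intro y
        simp only [cell, Prod.mk.injEq, true_and]
        push_cast; ring
      exact ⟨t', ht', h3 x ▸ h _ h1, h3 (x + 1) ▸ h _ h2⟩
  have hdepth : ∀ k, P k → (1 ≤ x ∧ k < depth l m x) ∧ k < depth l m (x + 1) := by
    rintro k ⟨t, ht, h1, h2⟩
    have e1 := (cell_mem_region hm).1 (hT.subset ht h1)
    have e2 := (cell_mem_region hm).1 (hT.subset ht h2)
    exact ⟨⟨e1.1.1, e1.2⟩, e2.2⟩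
  have hex : ∃ j, ¬ P j := ⟨depth l m x, fun h => by have := (hdepth _ h).1.2; omega⟩
  set j := Nat.find hex with hj
  have hjP : ∀ k < j, P k := fun k hk => by
    have := Nat.find_min hex hk
    simpa using this
  have hjN : ∀ k, j ≤ k → ¬ P k := by
    intro k hk
    induction k, hk using Nat.le_induction with
    | base => exact Nat.find_spec hex
    | succ k hk ih => exact fun h => ih (hdown k h)
  have hjd : j ≤ depth l m x := by
    by_contra h
    have := (hdepth _ (hjP (depth l m x) (by omega))).1.2
    omega
  have hjd' : j ≤ depth l m (x + 1) := by
    by_contra h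
    have := (hdepth _ (hjP (depth l m (x + 1)) (by omega))).2
    omega
  have hstart : ∀ k < j, ∃ a b, seg l k a b ∈ T ∧ a ≤ x ∧ x + 1 ≤ b ∧ Base l a b := by
    intro k hk
    obtain ⟨t, ht, h1, h2⟩ := hjP k hk
    obtain ⟨k', a, b, rfl, hab, ha, hb, hbase, hend⟩ := hT.exists_seg ht
    rw [cell_mem_seg] at h1 h2
    obtain ⟨rfl, h3⟩ := h1
    exact ⟨a, b, ht, h3.1, h2.2.2, hbase⟩
  refine ⟨j, depth l m (x + 1) - j, by simpa [stackOf] using hjd, ?_, ?_, ?_, ?_⟩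
  · refine List.ext_getElem? fun k => ?_
    rcases Nat.lt_or_ge k j with hk | hk
    · rw [List.getElem?_append_left (by simp [stackOf]; omega), List.getElem?_take_of_lt hk]
      obtain ⟨a, b, ht, h1, h2, -⟩ := hstart k hk
      rw [stackOf_getElem?_eq_some.2 ⟨by omega, hT.start_eq ht (x := x + 1) (by omega) (by omega)⟩,
        stackOf_getElem?_eq_some.2 ⟨by omega, hT.start_eq ht (x := x) (by omega) (by omega)⟩]
    · rw [List.getElem?_append_right (by simp [stackOf]; omega), List.getElem?_replicate]
      have hlen : ((stackOf l m T x).take j).length = j := by simp [stackOf]; omega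
      rw [hlen]
      split_ifs with h1
      · obtain ⟨a, b, ht, h2, h3, ha, hb, -⟩ := hT.exists_mem hm (x := x + 1) ⟨by omega, hx⟩
          (show k < depth l m (x + 1) by omega)
        have h4 : a = x + 1 := by
          by_contra hne
          exact hjN k hk ⟨_, ht, cell_mem_seg.2 ⟨rfl, by omega, by omega⟩,
            cell_mem_seg.2 ⟨rfl, by omega, by omega⟩⟩
        rw [stackOf_getElem?_eq_some.2 ⟨by omega, hT.start_eq ht h2 h3⟩, h4]
      · rw [List.getElem?_eq_none]
        simp [stackOf]; omega
  · intro a ha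
    obtain ⟨i, hi⟩ := List.mem_iff_getElem?.1 ha
    rw [List.getElem?_drop, stackOf_getElem?_eq_some] at hi
    obtain ⟨h1, h2⟩ := hi
    have hx0 : 1 ≤ x := by
      by_contra h0
      obtain rfl : x = 0 := by omega
      rw [depth_zero] at h1; omega
    obtain ⟨a', b, ht, h3, h4, ha', hb, hbase, hend⟩ := hT.exists_mem hm ⟨hx0, hx.le⟩ h1
    rw [hT.start_eq ht h3 h4] at h2
    subst h2
    have h5 : b = x := by
      by_contra hne
      exact hjN (j + i) (by omega) ⟨_, ht, cell_mem_seg.2 ⟨rfl, by omega, by omega⟩,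
            cell_mem_seg.2 ⟨rfl, by omega, by omega⟩⟩
    subst h5
    rcases hend with h | h
    · exact h.symm
    · omega
  · intro a ha
    obtain ⟨i, hi⟩ := List.mem_iff_getElem?.1 ha
    have hij : i < j := by
      have := (List.getElem?_eq_some_iff.1 hi).1
      simp at this; omega
    rw [List.getElem?_take_of_lt hij, stackOf_getElem?_eq_some] at hi
    obtain ⟨a', b, ht, h1, h2, hbase⟩ := hstart i hij
    rw [hT.start_eq ht h1 (by omega)] at hi
    rw [← hi.2]
    exact hbase _ (by omega) (by omega)
  · have h1 := height_eq_add_depth hm hx.le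
    have h2 := height_eq_add_depth hm (x := x + 1) hx
    simp only [stackOf, List.length_map, List.length_range]
    rw [← h1, ← h2]
    exact height_succ_abs m x (by rw [hm.1]; exact hx)

theorem IsTiling.tilingOf_stackOf {l m : List Step} {T : Finset (Finset Box)}
    (hT : IsTiling l m T) (hm : IsAbove m l) : tilingOf l (stackOf l m T) = T := by
  have key : ∀ k a b, seg l k a b ∈ T → a ≤ b → stackTile l (stackOf l m T) k a = seg l k a b := by
    intro k a b ht hab
    ext c
    constructor
    · intro hc
      obtain ⟨y, -, rfl⟩ := Finset.mem_image.1 hc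
      rw [cell_mem_stackTile, stackOf_getElem?_eq_some] at hc
      obtain ⟨-, hy, h1, h2⟩ := hc
      obtain ⟨a', b', ht', h3, h4, -⟩ := hT.exists_mem hm hy h1
      rw [hT.start_eq ht' h3 h4] at h2
      subst h2
      rw [← hT.eq_of_mem ht' ht (cell_mem_seg.2 ⟨rfl, le_rfl, by omega⟩)
        (cell_mem_seg.2 ⟨rfl, le_rfl, hab⟩), cell_mem_seg]
      exact ⟨rfl, h3, h4⟩
    · intro hc
      obtain ⟨y, -, rfl⟩ := Finset.mem_image.1 hc
      have h1 := (cell_mem_region hm).1 (hT.subset ht hc)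
      rw [cell_mem_stackTile, stackOf_getElem?_eq_some]
      have h2 := cell_mem_seg.1 hc
      exact ⟨rfl, h1.1, h1.2, hT.start_eq ht h2.2.1 h2.2.2⟩
  ext t
  rw [mem_tilingOf]
  constructor
  · rintro ⟨x, k, a, hx, h, rfl⟩
    rw [stackOf_getElem?_eq_some] at h
    obtain ⟨a', b, ht, h3, h4, -⟩ := hT.exists_mem hm hx h.1
    rw [hT.start_eq ht h3 h4] at h
    rw [← h.2, key k a' b ht (by omega)]
    exact ht
  · intro ht
    obtain ⟨k, a, b, rfl, hab, ha, hb, -⟩ := hT.exists_seg ht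
    have h1 := (cell_mem_region hm).1 (hT.subset ht (cell_mem_seg.2 ⟨rfl, le_rfl, hab⟩))
    exact ⟨a, k, a, h1.1, stackOf_getElem?_eq_some.2 ⟨h1.2, hT.start_eq ht le_rfl hab⟩,
      (key k a b ht hab).symm⟩

theorem IsStack.stackOf_tilingOf {l m : List Step} {σ : ℕ → List ℕ} (hσ : IsStack l σ)
    (hm : IsAbove m l) (hd : ∀ x ≤ l.length, depth l m x = (σ x).length) {x : ℕ}
    (hx : x ≤ l.length) : stackOf l m (tilingOf l σ) x = σ x := by
  refine List.ext_getElem (by simp [stackOf, hd x hx]) fun k h1 h2 => ?_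
  have h3 := List.getElem?_eq_getElem h2
  have hx1 : 1 ≤ x := by
    have := hσ.bounds hx h3; omega
  obtain ⟨b, hb, hxb, -⟩ := hσ.stackTile_eq_seg hx h3
  have h4 : seg l k (σ x)[k] b ∈ tilingOf l σ := hb ▸ mem_tilingOf.2 ⟨x, k, _, ⟨hx1, hx⟩, h3, rfl⟩
  have h5 := (hσ.isTiling hm hd).start_eq h4 (hσ.bounds hx h3).2 hxb
  simpa [stackOf] using h5

/-! ### The weight of a tiling as a sum of local contributions. -/

/-- The weight of a tile of the final stack that starts over the abscissa `a`. -/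
def finalCost (hf : ℕ → ℤ) (h : ℤ) (a : ℕ) : ℕ :=
  if hf a = h then 1 else ((h - hf a + 1) / 2).toNat

theorem height_sub_eq (l : List Step) {a b : ℕ} (hab : a ≤ b) (hb : b ≤ l.length) :
    height l b - height l a = (b - a : ℤ) -
      2 * (∑ y ∈ Finset.Ico a b, if height l (y + 1) < height l y then 1 else 0 : ℕ) := by
  induction b, hab using Nat.le_induction with
  | base => simp
  | succ b hab ih =>
    have h1 := ih (by omega)
    have h2 := height_succ_abs l b hb
    rw [abs_eq (by norm_num)] at h2
    rw [Finset.sum_Ico_succ_top hab]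
    push_cast at h1 ⊢
    split_ifs with h3 <;> omega

/-- The contribution of the box at level `k` over the abscissa `x` to the weight of a tiling. -/
def boxCost (l : List Step) (σ : ℕ → List ℕ) (x k : ℕ) : ℕ :=
  if x = l.length then finalCost (height l) (height l l.length) ((σ x).getD k 0)
  else if height l (x + 1) < height l x then 1
  else if (σ (x + 1))[k]? ≠ (σ x)[k]? then 1 else 0

namespace IsStack

variable {l : List Step} {σ : ℕ → List ℕ}

/-- A tile of length (2n, n') lies over n down steps of `l`, each costing 1. Its last box adds 1 if
n' = 0, and otherwise the rest ⌊(n' + 1) / 2⌋, charged at the end of `l`. -/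
theorem tileArt_stackTile (hσ : IsStack l σ) {x k a b : ℕ} (hx : x ≤ l.length)
    (h : (σ x)[k]? = some a) (hb : stackTile l σ k a = seg l k a b) (hxb : x ≤ b)
    (hbl : b ≤ l.length) (hbase : Base l a b) (hy : ∀ y, a ≤ y → y ≤ b → (σ y)[k]? = some a)
    (hend : b < l.length → (σ (b + 1))[k]? ≠ some a) :
    tileArt (stackTile l σ k a) = ∑ y ∈ Finset.Icc a b, boxCost l σ y k := by
  have hax := hσ.bounds hx h
  have hab : a ≤ b := by omega
  have hIcc : Finset.Icc a b = Finset.Ico a (b + 1) := by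
    ext; simp
  rw [hIcc, Finset.sum_Ico_succ_top hab]
  have h1 : ∑ y ∈ Finset.Ico a b, boxCost l σ y k =
      ∑ y ∈ Finset.Ico a b, if height l (y + 1) < height l y then 1 else 0 := by
    refine Finset.sum_congr rfl fun y hy' => ?_
    rw [Finset.mem_Ico] at hy'
    rw [boxCost, if_neg (by omega), hy y (by omega) (by omega), hy (y + 1) (by omega) (by omega)]
    simp
  have h2 := height_sub_eq l hab hbl
  rw [h1, tileArt, hb, card_seg]
  simp only [isDyckTile_seg_iff hab hbl hbase]
  generalize (∑ y ∈ Finset.Ico a b, if height l (y + 1) < height l y then 1 else 0) = n at h2 ⊢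
  have h3 := hbase b hab le_rfl
  rcases Nat.lt_or_ge b l.length with h4 | h4
  · have h5 := hσ.height_eq h4 (hy b hab le_rfl) (hend h4)
    rw [if_pos h5, boxCost, if_neg h4.ne, hy b hab le_rfl, if_pos (hend h4)]
    simp only [ite_self]
    omega
  · obtain rfl : b = l.length := by omega
    have h6 : (σ l.length).getD k 0 = a := by
      rw [List.getD_eq_getElem?_getD, hy _ hab le_rfl]; rfl
    rw [boxCost, if_pos rfl, h6, finalCost]
    by_cases h7 : height l a = height l l.length
    · rw [if_pos h7.symm, if_pos h7]; omega
    · rw [if_neg (fun h => h7 h.symm), if_neg h7]; omega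

/-- The box costs are summed once by tiles and once by columns. -/
theorem art_tilingOf (hσ : IsStack l σ) :
    art (tilingOf l σ) =
      ∑ x ∈ Finset.range l.length, cost (height l) x (σ x) (σ (x + 1)) +
        ((σ l.length).map (finalCost (height l) (height l l.length))).sum := by
  classical
  set P : Finset (Σ _ : ℕ, ℕ) := (Finset.Icc 1 l.length).sigma fun x => Finset.range (σ x).length
    with hP
  set f : (Σ _ : ℕ, ℕ) → Finset Box := fun p => stackTile l σ p.2 ((σ p.1).getD p.2 0) with hf
  have hmem : ∀ p ∈ P, (1 ≤ p.1 ∧ p.1 ≤ l.length) ∧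
      (σ p.1)[p.2]? = some ((σ p.1).getD p.2 0) := by
    intro p hp
    rw [hP, Finset.mem_sigma, Finset.mem_Icc, Finset.mem_range] at hp
    rw [List.getElem?_eq_getElem hp.2, List.getD_eq_getElem _ _ hp.2]
    exact ⟨hp.1, rfl⟩
  have hmaps : ∀ p ∈ P, f p ∈ tilingOf l σ := fun p hp =>
    mem_tilingOf.2 ⟨p.1, p.2, _, (hmem p hp).1, (hmem p hp).2, rfl⟩
  have h1 : art (tilingOf l σ) = ∑ p ∈ P, boxCost l σ p.1 p.2 := by
    rw [art, ← Finset.sum_fiberwise_of_maps_to hmaps]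
    refine Finset.sum_congr rfl fun t ht => ?_
    obtain ⟨x, k, a, hx, h, rfl⟩ := mem_tilingOf.1 ht
    obtain ⟨b, hb, hxb, hbl, hbase, hy, hend⟩ := hσ.stackTile_eq_seg hx.2 h
    have hax := hσ.bounds hx.2 h
    rw [hσ.tileArt_stackTile hx.2 h hb hxb hbl hbase hy hend]
    have h2 : P.filter (fun p => f p = stackTile l σ k a) =
        (Finset.Icc a b).image fun y => (⟨y, k⟩ : Σ _ : ℕ, ℕ) := by
      ext ⟨y, k'⟩
      simp only [Finset.mem_filter, Finset.mem_image, Finset.mem_Icc, Sigma.mk.injEq, heq_eq_eq]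
      constructor
      · rintro ⟨hp, hfp⟩
        have h3 : cell l k' y ∈ f ⟨y, k'⟩ :=
          cell_mem_stackTile.2 ⟨rfl, (hmem _ hp).1, (hmem _ hp).2⟩
        rw [hfp, hb, cell_mem_seg] at h3
        exact ⟨y, h3.2, rfl, h3.1.symm⟩
      · rintro ⟨y, hy', rfl, rfl⟩
        have h3 := hy y hy'.1 hy'.2
        have h4 := List.getElem?_eq_some_iff.1 h3
        refine ⟨?_, ?_⟩
        · rw [hP, Finset.mem_sigma, Finset.mem_Icc, Finset.mem_range]
          exact ⟨⟨hax.1.trans hy'.1, hy'.2.trans hbl⟩, h4.1⟩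
        · simp only [hf]
          rw [List.getD_eq_getElem _ _ h4.1, h4.2]
    rw [h2, Finset.sum_image]
    intro y _ y' _ h
    simpa using h
  rw [h1, hP, Finset.sum_sigma]
  set F : ℕ → ℕ := fun x => ∑ k ∈ Finset.range (σ x).length, boxCost l σ x k with hF
  have h2 : ∑ x ∈ Finset.Icc 1 l.length, F x = ∑ x ∈ Finset.range (l.length + 1), F x := by
    refine Finset.sum_subset (fun x hx => ?_) fun x hx hx' => ?_
    · rw [Finset.mem_Icc] at hx
      rw [Finset.mem_range]; omega
    · rw [Finset.mem_Icc] at hx'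
      rw [Finset.mem_range] at hx
      obtain rfl : x = 0 := by omega
      simp [hF, hσ.1]
  rw [h2, Finset.sum_range_succ]
  congr 1
  · refine Finset.sum_congr rfl fun x hx => ?_
    rw [Finset.mem_range] at hx
    simp only [hF, cost, boxCost, if_neg hx.ne]
    split_ifs with h3
    · simp
    · rw [changed, Finset.card_filter]
  · simp only [hF, boxCost, if_true]
    rw [Finset.sum_range, ← List.sum_ofFn]
    congr 1
    refine List.ext_getElem (by simp) fun i h3 h4 => ?_
    simp only [List.length_ofFn] at h3
    simp

end IsStack

/-! ### Summation over sequences of stacks. -/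

/-- The stacks over the abscissas `x + 1, …, x + n`. -/
def toRun (σ : ℕ → List ℕ) : ℕ → ℕ → List (List ℕ)
  | _, 0 => []
  | x, n + 1 => σ (x + 1) :: toRun σ (x + 1) n

theorem toRun_congr {σ τ : ℕ → List ℕ} {x n : ℕ} :
    toRun σ x n = toRun τ x n ↔ ∀ i < n, σ (x + 1 + i) = τ (x + 1 + i) := by
  induction n generalizing x with
  | zero => simp [toRun]
  | succ n ih =>
    rw [toRun, toRun, List.cons.injEq, ih]
    constructor
    · rintro ⟨h1, h2⟩ i hi
      cases i with
      | zero => exact h1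
      | succ i =>
        have := h2 i (by omega)
        rwa [add_right_comm, add_assoc] at this
    · intro h
      refine ⟨h 0 (by omega), fun i hi => ?_⟩
      have := h (i + 1) (by omega)
      rwa [add_right_comm, add_assoc]

open Classical in
/-- The sequences of `n` stacks after the stack `s` over the abscissa `x`. -/
noncomputable def runs (hf : ℕ → ℤ) : ℕ → ℕ → List ℕ → Finset (List (List ℕ))
  | 0, _, _ => {[]}
  | n + 1, x, s => (nexts hf x s).biUnion fun s' => (runs hf n (x + 1) s').image (s' :: ·)

/-- The weight collected along a sequence of stacks. -/
def runCost (hf : ℕ → ℤ) : ℕ → List ℕ → List (List ℕ) → ℕ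
  | _, _, [] => 0
  | x, s, s' :: r => cost hf x s s' + runCost hf (x + 1) s' r

/-- The last stack. -/
def lastStack : List ℕ → List (List ℕ) → List ℕ
  | s, [] => s
  | _, s' :: r => lastStack s' r

theorem mem_runs {hf : ℕ → ℤ} {n x : ℕ} (hx : ∀ i < n, |hf (x + i + 1) - hf (x + i)| = 1)
    {s : List ℕ} {r : List (List ℕ)} : r ∈ runs hf n x s ↔
      ∃ σ : ℕ → List ℕ, σ x = s ∧ r = toRun σ x n ∧
        ∀ i < n, Trans hf (x + i) (σ (x + i)) (σ (x + i + 1)) := by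
  classical
  induction n generalizing x s r with
  | zero =>
    simp only [runs, Finset.mem_singleton, toRun]
    constructor
    · rintro rfl; exact ⟨fun _ => s, rfl, rfl, by simp⟩
    · rintro ⟨σ, -, rfl, -⟩; rfl
  | succ n ih =>
    have hx' : ∀ i < n, |hf (x + 1 + i + 1) - hf (x + 1 + i)| = 1 := by
      intro i hi
      have := hx (i + 1) (by omega)
      rwa [← add_assoc, add_right_comm x i 1] at this
    simp only [runs, Finset.mem_biUnion, Finset.mem_image, mem_nexts (hx 0 (by omega)), ih hx']
    constructor
    · rintro ⟨s', hs', r', ⟨σ, rfl, rfl, hσ⟩, rfl⟩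
      refine ⟨Function.update σ x s, by simp, ?_, ?_⟩
      · rw [toRun, Function.update_of_ne (by omega)]
        congr 1
        rw [toRun_congr]
        intro i _
        rw [Function.update_of_ne (by omega)]
      · intro i hi
        cases i with
        | zero =>
          rw [add_zero, Function.update_self, Function.update_of_ne (by omega)]
          exact hs'
        | succ i =>
          rw [Function.update_of_ne (by omega), Function.update_of_ne (by omega)]
          have := hσ i (by omega)
          rwa [add_right_comm x 1 i] at this
    · rintro ⟨σ, rfl, rfl, hσ⟩
      refine ⟨σ (x + 1), hσ 0 (by omega), _, ⟨σ, rfl, rfl, fun i hi => ?_⟩, rfl⟩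
      have := hσ (i + 1) (by omega)
      rwa [← add_assoc, add_right_comm x i 1] at this

theorem runCost_toRun (hf : ℕ → ℤ) (σ : ℕ → List ℕ) (x n : ℕ) :
    runCost hf x (σ x) (toRun σ x n) =
      ∑ i ∈ Finset.range n, cost hf (x + i) (σ (x + i)) (σ (x + i + 1)) := by
  induction n generalizing x with
  | zero => simp [toRun, runCost]
  | succ n ih =>
    rw [toRun, runCost, ih, Finset.sum_range_succ', add_comm]
    congr 1
    refine Finset.sum_congr rfl fun i _ => ?_
    rw [← add_assoc, add_right_comm x i 1]

theorem lastStack_toRun (σ : ℕ → List ℕ) (x n : ℕ) :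
    lastStack (σ x) (toRun σ x n) = σ (x + n) := by
  induction n generalizing x with
  | zero => rfl
  | succ n ih => rw [toRun, lastStack, ih, add_assoc, add_comm 1]

theorem sum_runs {K : Type*} [Field K] (q : K) (hf : ℕ → ℤ) (F : List ℕ → K) (n x : ℕ)
    (s : List ℕ) :
    ∑ r ∈ runs hf n x s, q ^ runCost hf x s r * F (lastStack s r) = W1 q hf F n x s := by
  classical
  induction n generalizing x s with
  | zero => simp [runs, runCost, lastStack, W1]
  | succ n ih =>
    rw [runs, Finset.sum_biUnion, W1]
    · refine Finset.sum_congr rfl fun s' _ => ?_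
      rw [Finset.sum_image (fun r _ r' _ h => (List.cons.inj h).2), ← ih, Finset.mul_sum]
      refine Finset.sum_congr rfl fun r _ => ?_
      rw [runCost, lastStack, pow_add, mul_assoc]
    · intro s1 _ s2 _ hne
      rw [Function.onFun, Finset.disjoint_left]
      intro r h1 h2
      obtain ⟨r1, -, rfl⟩ := Finset.mem_image.1 h1
      obtain ⟨r2, -, h3⟩ := Finset.mem_image.1 h2
      exact hne (List.cons.inj h3).1.symm

theorem stackOf_length (l m : List Step) (T : Finset (Finset Box)) (x : ℕ) :
    (stackOf l m T x).length = depth l m x := by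
  simp [stackOf]

/-- A sequence of stacks determines both members of a pair (upper path, tiling), so summing over all
upper paths becomes summing over all runs. -/
theorem sum_tilings {K : Type*} [Field K] (q : K) (ball : Prop) (l : List Step)
    (S : Finset (Σ _ : List Step, Finset (Finset Box)))
    (hS : ∀ p, p ∈ S ↔ IsAbove p.1 l ∧ IsTiling l p.1 p.2 ∧
      FinalOK ball (height l) (height l l.length) (stackOf l p.1 p.2 l.length)) :
    ∑ p ∈ S, q ^ art p.2 = Wt q (Okay ball) (finW q ball) l 0 0 0 := by
  classical
  rw [← W1_nil, ← sum_runs]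
  have hstep : ∀ i < l.length, |height l (0 + i + 1) - height l (0 + i)| = 1 := fun i hi => by
    rw [zero_add]; exact height_succ_abs l i hi
  have hrun : ∀ {σ : ℕ → List ℕ}, IsStack l σ →
      toRun σ 0 l.length ∈ runs (height l) l.length 0 [] := fun {σ} hσ =>
    (mem_runs hstep).2 ⟨σ, hσ.1, rfl, fun i hi => by rw [zero_add]; exact hσ.2 i hi⟩
  have hval : ∀ {σ : ℕ → List ℕ}, IsStack l σ →
      runCost (height l) 0 [] (toRun σ 0 l.length) +
        ((lastStack [] (toRun σ 0 l.length)).map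
          (finalCost (height l) (height l l.length))).sum = art (tilingOf l σ) := by
    intro σ hσ
    rw [← hσ.1, runCost_toRun, lastStack_toRun, hσ.art_tilingOf]
    simp only [zero_add]
  have hlast : ∀ {σ : ℕ → List ℕ}, IsStack l σ →
      lastStack [] (toRun σ 0 l.length) = σ l.length := by
    intro σ hσ
    rw [← hσ.1, lastStack_toRun, zero_add]
  set R := (runs (height l) l.length 0 []).filter fun r =>
    FinalOK ball (height l) (height l l.length) (lastStack [] r) with hR
  have h1 : ∑ r ∈ runs (height l) l.length 0 [], q ^ runCost (height l) 0 [] r *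
      finalW q ball (height l) (height l l.length) (lastStack [] r) =
      ∑ r ∈ R, q ^ (runCost (height l) 0 [] r + ((lastStack [] r).map
        (finalCost (height l) (height l l.length))).sum) := by
    rw [hR, Finset.sum_filter]
    refine Finset.sum_congr rfl fun r _ => ?_
    rw [finalW]
    split_ifs with h
    · rw [pow_add]; rfl
    · simp
  rw [h1]
  refine Finset.sum_bij (fun p _ => toRun (stackOf l p.1 p.2) 0 l.length) ?_ ?_ ?_ ?_
  · intro p hp
    obtain ⟨hm, hT, hF⟩ := (hS p).1 hp
    have hσ := hT.isStack hm
    rw [hR, Finset.mem_filter, hlast hσ]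
    exact ⟨hrun hσ, hF⟩
  · rintro ⟨m, T⟩ hp ⟨m', T'⟩ hp' h
    obtain ⟨hm, hT, -⟩ := (hS _).1 hp
    obtain ⟨hm', hT', -⟩ := (hS _).1 hp'
    simp only at hm hT hm' hT' h
    rw [toRun_congr] at h
    have h2 : ∀ x ≤ l.length, stackOf l m T x = stackOf l m' T' x := by
      intro x hx
      cases x with
      | zero => rw [(hT.isStack hm).1, (hT'.isStack hm').1]
      | succ x =>
        have := h x (by omega)
        rwa [zero_add, add_comm 1] at this
    have h3 : m = m' := by
      refine eq_of_height_eq (by rw [hm.1, hm'.1]) fun i hi => ?_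
      rw [hm.1] at hi
      rw [height_eq_add_depth hm hi, height_eq_add_depth hm' hi, ← stackOf_length l m T,
        ← stackOf_length l m' T', h2 i hi]
    subst h3
    have h4 : T = T' := by
      rw [← hT.tilingOf_stackOf hm, ← hT'.tilingOf_stackOf hm]
      ext t
      simp only [mem_tilingOf]
      have h5 : ∀ k a, stackTile l (stackOf l m T) k a = stackTile l (stackOf l m T') k a := by
        intro k a
        rw [stackTile, stackTile]
        congr 1
        refine Finset.filter_congr fun y hy => ?_
        rw [h2 y (Finset.mem_Icc.1 hy).2]
      refine exists_congr fun x => exists_congr fun k => exists_congr fun a =>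
        and_congr_right fun hx => ?_
      rw [h2 x hx.2, h5]
    rw [h4]
  · intro r hr
    rw [hR, Finset.mem_filter, mem_runs hstep] at hr
    obtain ⟨⟨σ, h0, rfl, h2⟩, hF⟩ := hr
    have hσ : IsStack l σ := ⟨h0, fun x hx => by have := h2 x hx; rwa [zero_add] at this⟩
    -- Each box of a column raises the upper path by 2; the last clause of `Trans` makes the result
    -- a path.
    obtain ⟨m, hm, hm'⟩ := exists_path (fun x => height l x + 2 * (σ x).length) l.length
      (by simp [height_zero, h0]) fun i hi => by
        obtain ⟨j, e, -, -, -, -, h3⟩ := hσ.2 i hi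
        exact h3
    have hma : IsAbove m l := ⟨hm, fun i hi => by rw [hm' i hi]; omega⟩
    have hd : ∀ x ≤ l.length, depth l m x = (σ x).length := by
      intro x hx
      have := height_eq_add_depth hma hx
      rw [hm' x hx] at this
      omega
    have hst : ∀ x ≤ l.length, stackOf l m (tilingOf l σ) x = σ x := fun x hx =>
      hσ.stackOf_tilingOf hma hd hx
    refine ⟨⟨m, tilingOf l σ⟩, (hS _).2 ⟨hma, hσ.isTiling hma hd, ?_⟩, ?_⟩
    · rw [hst _ le_rfl, ← hlast hσ]
      exact hF
    · rw [toRun_congr]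
      intro i hi
      exact hst _ (by omega)
  · intro p hp
    obtain ⟨hm, hT, -⟩ := (hS p).1 hp
    rw [hval (hT.isStack hm), hT.tilingOf_stackOf hm]

/-! ### The two kinds of tilings through their final stacks. -/

theorem count_eq_card_filter (w : List ℕ) (a : ℕ) :
    w.count a = ((Finset.range w.length).filter fun k => w[k]? = some a).card := by
  induction w using List.reverseRecOn with
  | nil => simp
  | append_singleton w b ih =>
    rw [List.count_append, ih, List.length_append, List.length_singleton, Finset.range_add_one,
      Finset.filter_insert]
    have h1 : (Finset.range w.length).filter (fun k => (w ++ [b])[k]? = some a) =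
        (Finset.range w.length).filter fun k => w[k]? = some a := by
      refine Finset.filter_congr fun k hk => ?_
      rw [Finset.mem_range] at hk
      rw [List.getElem?_append_left hk]
    rw [h1, List.getElem?_concat_length]
    by_cases hb : b = a
    · rw [if_pos (by rw [hb]), Finset.card_insert_of_notMem (by simp)]
      simp [hb]
    · rw [if_neg (by simpa using hb)]
      simp [hb]

section Membership

variable {l m : List Step} {T : Finset (Finset Box)}

theorem IsTiling.anchored (hT : IsTiling l m T) {t : Finset Box} (ht : t ∈ T) {n n' : ℕ}
    (hn : IsBallotTile t n n') (hn' : 1 ≤ n') :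
    ∃ k a, t = seg l k a l.length ∧ 1 ≤ a ∧ Base l a l.length ∧
      (n' : ℤ) = height l l.length - height l a ∧ l.length = a + (2 * n + n') := by
  obtain ⟨k, a, b, rfl, hab, ha, hb, hbase, hend⟩ := hT.exists_seg ht
  obtain ⟨h1, h2⟩ := (isBallotTile_seg_iff hab hb hbase).1 hn
  have h3 : b = l.length := by
    rcases hend with h | h
    · omega
    · exact h
  subst h3
  exact ⟨k, a, rfl, ha, hbase, h1, h2⟩

theorem IsTiling.seg_mem_iff (hT : IsTiling l m T) (hm : IsAbove m l) {k a : ℕ}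
    (ha : 1 ≤ a) (hal : a ≤ l.length) :
    seg l k a l.length ∈ T ↔ (stackOf l m T l.length)[k]? = some a := by
  rw [stackOf_getElem?_eq_some]
  constructor
  · intro h
    have h1 := (cell_mem_region hm).1 (hT.subset h (cell_mem_seg.2 ⟨rfl, hal, le_rfl⟩))
    exact ⟨h1.2, hT.start_eq h hal le_rfl⟩
  · rintro ⟨h1, h2⟩
    obtain ⟨a', b, ht, h3, h4, -, h5, -⟩ := hT.exists_mem hm (x := l.length)
      ⟨by omega, le_rfl⟩ h1
    rw [hT.start_eq ht h3 h4] at h2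
    obtain rfl : b = l.length := by omega
    rwa [h2] at ht

-- An anchored tile of length (2n, n') starts at N - (2n + n'). So all tiles of this length have the
-- same start `a`, one for each entry `a` of the final stack.
open Classical in
theorem IsTiling.card_filter (hT : IsTiling l m T) (hm : IsAbove m l) {a n n' : ℕ} (ha : 1 ≤ a)
    (hbase : Base l a l.length) (h1 : (n' : ℤ) = height l l.length - height l a)
    (h2 : l.length = a + (2 * n + n')) (hn' : 1 ≤ n') :
    (T.filter fun t => IsBallotTile t n n').card = (stackOf l m T l.length).count a := by
  have hal : a ≤ l.length := by omega
  rw [count_eq_card_filter]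
  symm
  refine Finset.card_bij (fun k _ => seg l k a l.length) ?_ ?_ ?_
  · intro k hk
    rw [Finset.mem_filter] at hk ⊢
    exact ⟨(hT.seg_mem_iff hm ha hal).2 hk.2, (isBallotTile_seg_iff hal le_rfl hbase).2 ⟨h1, h2⟩⟩
  · intro k _ k' _ h
    have : cell l k a ∈ seg l k' a l.length := h ▸ cell_mem_seg.2 ⟨rfl, le_rfl, hal⟩
    exact (cell_mem_seg.1 this).1
  · intro t ht
    rw [Finset.mem_filter] at ht
    obtain ⟨k, a', rfl, h3, -, h4, h5⟩ := hT.anchored ht.1 ht.2 hn'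
    obtain rfl : a' = a := by omega
    have h6 := (hT.seg_mem_iff hm ha hal).1 ht.1
    refine ⟨k, ?_, rfl⟩
    rw [Finset.mem_filter, Finset.mem_range]
    exact ⟨(List.getElem?_eq_some_iff.1 h6).1, h6⟩

/-- The parity conditions by lengths (2n, n') turn into conditions by starting points, through
`IsTiling.card_filter`. -/
theorem mem_ballotTilings (hm : IsAbove m l) : T ∈ ballotTilings l m ↔ IsTiling l m T ∧
    FinalOK True (height l) (height l l.length) (stackOf l m T l.length) := by
  classical
  rw [ballotTilings, Finset.mem_filter]
  have hT' : (∀ t ∈ T, ∃ n n', IsBallotTile t n n') ∧ Tiles T (region l m) ∧ CoverInclusive l T →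
      (∀ t ∈ T, ∀ n n', IsBallotTile t n n' → 1 ≤ n' → ∃ b ∈ t, b.1 = l.length) →
      IsTiling l m T := fun h1 h2 => ⟨h1.1, h1.2.1, h1.2.2, h2⟩
  constructor
  · rintro ⟨-, h1, h2, h3, h4⟩
    have hT := hT' h1 h2
    refine ⟨hT, fun a ha => ⟨trivial, ?_⟩⟩
    obtain ⟨k, hk⟩ := List.mem_iff_getElem?.1 ha
    have hσ := hT.isStack hm
    have hb := hσ.bounds le_rfl hk
    have hbase : Base l a l.length := fun y h5 h6 => (hσ.of_le le_rfl hk h5 h6).2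
    obtain ⟨n, n', hn⟩ := exists_isBallotTile_seg (k := k) hb.2 le_rfl hbase
    obtain ⟨e1, e2⟩ := (isBallotTile_seg_iff hb.2 le_rfl hbase).1 hn
    rcases Nat.eq_zero_or_pos n' with h0 | h0
    · left; subst h0; push_cast at e1; omega
    · right
      have hc := hT.card_filter hm hb.1 hbase e1 e2 h0
      have hodd : Odd n' := by
        rw [← Nat.not_even_iff_odd]
        intro he
        have := h4 n n' he h0
        rw [hc] at this
        exact List.count_eq_zero.1 this ha
      rw [← e1, ← hc]
      refine ⟨by exact_mod_cast hodd, ?_⟩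
      convert h3 n n' hodd
  · rintro ⟨hT, hF⟩
    have hF' : ∀ t ∈ T, ∀ n n', IsBallotTile t n n' → 1 ≤ n' → Odd n' ∧
        Even (T.filter fun t => IsBallotTile t n n').card := by
      intro t ht n n' hn hn'
      obtain ⟨k, a, rfl, ha, hbase, e1, e2⟩ := hT.anchored ht hn hn'
      have h6 := (hT.seg_mem_iff hm ha (by omega)).1 ht
      rcases (hF a (List.mem_of_getElem? h6)).2 with h | h
      · omega
      · rw [hT.card_filter hm ha hbase e1 e2 hn']
        rw [← e1] at h
        exact ⟨by exact_mod_cast h.1, h.2⟩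
    refine ⟨?_, ⟨hT.1, hT.2.1, hT.2.2.1⟩, hT.2.2.2, ?_, ?_⟩
    · rw [Finset.mem_powerset]
      intro t ht
      exact Finset.mem_powerset.2 (hT.subset ht)
    · intro n n' hodd
      rcases Finset.eq_empty_or_nonempty (T.filter fun t => IsBallotTile t n n') with h | ⟨t, ht⟩
      · simp [h]
      · rw [Finset.mem_filter] at ht
        exact (hF' t ht.1 n n' ht.2 hodd.pos).2
    · intro n n' heven hpos
      rw [Finset.card_eq_zero, Finset.filter_eq_empty_iff]
      intro t ht hn
      exact Nat.not_even_iff_odd.2 (hF' t ht n n' hn hpos).1 heven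

theorem IsBallotTile.exists_ends {t : Finset Box} {n n' : ℕ} (h : IsBallotTile t n n') :
    ∃ (x : ℕ) (y : ℤ), (x, y) ∈ t ∧ (x + (2 * n + n'), y + n') ∈ t ∧
      ∀ c ∈ t, x ≤ c.1 ∧ c.1 ≤ x + (2 * n + n') ∧ (c.1 = x → c.2 = y) ∧
        (c.1 = x + (2 * n + n') → c.2 = y + n') := by
  obtain ⟨⟨x, y⟩, w, ⟨h1, h2, h3⟩, rfl⟩ := h
  refine ⟨x, y, ?_, ?_, ?_⟩
  · exact Finset.mem_image.2 ⟨0, by simp, by simp [height_zero]⟩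
  · refine Finset.mem_image.2 ⟨w.length, by simp, ?_⟩
    change (x + w.length, y + height w w.length) = _
    rw [h2, h1]
  · intro c hc
    obtain ⟨i, hi, rfl⟩ := Finset.mem_image.1 hc
    rw [Finset.mem_range] at hi
    refine ⟨by simp, by simp only; omega, fun h => ?_, fun h => ?_⟩
    · obtain rfl : i = 0 := by simpa using h
      simp [height_zero]
    · obtain rfl : i = w.length := by simp only at h; omega
      simp only [h2]

theorem IsBallotTile.unique {t : Finset Box} {n n' k k' : ℕ} (h : IsBallotTile t n n')
    (h' : IsBallotTile t k k') : n' = k' := by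
  obtain ⟨x, y, h1, h2, h3⟩ := h.exists_ends
  obtain ⟨x', y', h1', h2', h3'⟩ := h'.exists_ends
  have e1 := h3 _ h1'
  have e2 := h3' _ h1
  have e3 := h3 _ h2'
  have e4 := h3' _ h2
  simp only at e1 e2 e3 e4
  have e5 : y = y' := e2.2.2.1 (by omega)
  have e6 : y + n' = y' + k' := e4.2.2.2 (by omega)
  omega

/-- `FinalOK False` empties the last column: the paths have the same end point, and no anchor box
remains for a tile of positive height difference. -/
theorem mem_dyckTilings (hm : IsAbove m l) :
    height m l.length = height l l.length ∧ T ∈ dyckTilings l m ↔ IsTiling l m T ∧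
    FinalOK False (height l) (height l l.length) (stackOf l m T l.length) := by
  classical
  have hF : FinalOK False (height l) (height l l.length) (stackOf l m T l.length) ↔
      depth l m l.length = 0 := by
    rw [← stackOf_length l m T, List.length_eq_zero_iff]
    constructor
    · intro h
      exact List.eq_nil_iff_forall_not_mem.2 fun a ha => (h a ha).1
    · intro h a ha
      rw [h] at ha; simp at ha
  have hd := height_eq_add_depth hm (x := l.length) le_rfl
  rw [hF, dyckTilings, Finset.mem_filter]
  constructor
  · rintro ⟨h0, -, h1, h2, h3⟩
    refine ⟨⟨fun t ht => ?_, h2, h3, fun t ht n n' hn hn' => ?_⟩, by omega⟩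
    · obtain ⟨n, hn⟩ := h1 t ht
      exact ⟨n, 0, hn⟩
    · obtain ⟨k, hk⟩ := h1 t ht
      have := hn.unique hk
      omega
  · rintro ⟨hT, h0⟩
    refine ⟨by omega, ?_, fun t ht => ?_, hT.2.1, hT.2.2.1⟩
    · rw [Finset.mem_powerset]
      intro t ht
      exact Finset.mem_powerset.2 (hT.subset ht)
    · obtain ⟨n, n', hn⟩ := hT.1 t ht
      rcases Nat.eq_zero_or_pos n' with h | h
      · subst h; exact ⟨n, hn⟩
      · obtain ⟨b, hb, hb'⟩ := hT.2.2.2 t ht n n' hn h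
        have := (mem_region.1 (hT.subset ht hb)).2.1
        rw [hb', hd, h0] at this
        omega

theorem mem_paths {n : ℕ} : m ∈ paths n ↔ m.length = n := by
  simp only [paths, Finset.mem_image, Finset.mem_univ, true_and]
  constructor
  · rintro ⟨f, rfl⟩; simp
  · rintro rfl; exact ⟨fun i => m[i], List.ofFn_getElem⟩

end Membership

/-! ### The generating functions as transfer weights. -/

section Evaluation

variable {K : Type*} [Field K] (φ : ℤ[X] →+* K)

theorem map_ballotGF (l : List Step) :
    φ (ballotGF l) = Psi (φ X) Anchorable (fun c => φ X ^ c) l 0 := by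
  classical
  have h := sum_tilings (φ X) True l
    (((paths l.length).filter fun m => IsAbove m l).sigma fun m => ballotTilings l m) ?_
  · have e1 : Okay True = Anchorable := by
      funext l; simp [Okay]
    have e2 : finW (φ X) True = fun c => φ X ^ c := by
      funext c; simp [finW]
    rw [e1, e2, Finset.sum_sigma] at h
    rw [Psi, ← h, ballotGF, map_sum]
    refine Finset.sum_congr (by congr) fun m _ => ?_
    rw [map_sum]
    simp only [map_pow]
  · rintro ⟨m, T⟩
    rw [Finset.mem_sigma, Finset.mem_filter, mem_paths]
    constructor
    · rintro ⟨⟨-, hm⟩, hT⟩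
      exact ⟨hm, (mem_ballotTilings hm).1 hT⟩
    · rintro ⟨hm, hT⟩
      exact ⟨⟨hm.1, hm⟩, (mem_ballotTilings hm).2 hT⟩

theorem map_dyckGF (l : List Step) :
    φ (dyckGF l) = Psi (φ X) (fun _ => False) (fun c => if c = 0 then 1 else 0) l 0 := by
  classical
  have h := sum_tilings (φ X) False l
    (((paths l.length).filter fun m => IsAbove m l ∧
      height m l.length = height l l.length).sigma fun m => dyckTilings l m) ?_
  · have e1 : Okay False = fun _ => False := by
      funext l; simp [Okay]
    have e2 : finW (φ X) False = fun c => if c = 0 then 1 else 0 := by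
      funext c
      by_cases hc : c = 0
      · simp [finW, hc]
      · simp [finW, hc]
    rw [e1, e2, Finset.sum_sigma] at h
    rw [Psi, ← h, dyckGF, map_sum]
    refine Finset.sum_congr (by congr) fun m _ => ?_
    rw [map_sum]
    simp only [map_pow]
  · rintro ⟨m, T⟩
    rw [Finset.mem_sigma, Finset.mem_filter, mem_paths]
    constructor
    · rintro ⟨⟨-, hm, h0⟩, hT⟩
      exact ⟨hm, (mem_dyckTilings hm).1 ⟨h0, hT⟩⟩
    · rintro ⟨hm, hT⟩
      obtain ⟨h0, hT⟩ := (mem_dyckTilings hm).2 hT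
      exact ⟨⟨hm.1, hm, h0⟩, hT⟩

variable (q : K) (ok : List Step → Prop) (fin : ℕ → K)

theorem Phi_apply_zero (l : List Step) : Phi q ok fin l 0 = Psi q ok fin l 0 := by
  simp [Phi, frz]

/-- With an empty stack nothing can close at an up step, hence nothing opens. -/
theorem Psi_replicate_append (p : ℕ) (l : List Step) :
    Psi q ok fin (List.replicate p Step.U ++ l) 0 = Psi q ok fin l 0 := by
  induction p with
  | zero => rfl
  | succ p ih =>
    rw [← ih, List.replicate_succ, List.cons_append, Psi, Wt, upSum]
    simp only [zero_add, Finset.sum_range_one, pow_zero, one_mul, if_true, add_zero, Nat.sub_zero,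
      push_zero]
    exact Phi_apply_zero q ok fin _

theorem not_low_replicate (M : ℕ) : ¬ Low (List.replicate M Step.U) := by
  induction M with
  | zero => exact NonNeg.nil.not_low
  | succ M ih => exact (NonNeg.up (nonNeg_of_not_low ih)).not_low

end Evaluation

/-! ### The two sides of the minimum point. -/

theorem height_succ (l : List Step) {i : ℕ} (hi : i < l.length) :
    height l (i + 1) = height l i + (l[i]).rise := by
  have h := height_drop l i 1 hi.le
  rw [List.drop_eq_getElem_cons hi, height_cons_succ, height_zero] at h
  omega

/-- The run of down steps that begins or continues at `x` ends in a valley. -/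
theorem exists_valley (l : List Step) (x : ℕ) (hx : l[x]? = some Step.D) :
    ∃ j, x < j ∧ IsValley l j ∧ height l j < height l x := by
  obtain ⟨hlt, hD⟩ := List.getElem?_eq_some_iff.1 hx
  induction hn : l.length - x generalizing x with
  | zero => omega
  | succ n ih =>
    have h1 := height_succ l hlt
    rw [hD] at h1
    simp only [Step.rise] at h1
    by_cases hD' : l[x + 1]? = some Step.D
    · obtain ⟨hlt', h2⟩ := List.getElem?_eq_some_iff.1 hD'
      obtain ⟨j, h3, h4, h5⟩ := ih (x + 1) hD' hlt' h2 (by omega)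
      exact ⟨j, by omega, h4, by omega⟩
    · refine ⟨x + 1, by omega, ⟨by omega, by simpa using hx, ?_⟩, by omega⟩
      rcases Nat.lt_or_ge (x + 1) l.length with h2 | h2
      · left
        rw [List.getElem?_eq_getElem h2] at hD' ⊢
        cases h3 : l[x + 1] with
        | U => rfl
        | D => exact absurd (by rw [h3]) hD'
      · right; omega

/-- Every descent ends in a valley, and up steps only gain height. The start at a down step `p` is
needed because the initial run of up steps may lie below every valley. -/
theorem IsMinimumPoint.height_le {l : List Step} {k p : ℕ} (h : IsMinimumPoint l k)
    (hp : l[p]? = some Step.D) {x : ℕ} (hpx : p ≤ x) (hx : x ≤ l.length) :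
    height l k ≤ height l x ∧ (x < k → height l k < height l x) := by
  induction x, hpx using Nat.le_induction with
  | base =>
    obtain ⟨j, -, hj, hlt⟩ := exists_valley l p hp
    rcases h.2 j hj with h1 | h1 <;> omega
  | succ x hpx ih =>
    by_cases hD : l[x + 1]? = some Step.D
    · obtain ⟨j, -, hj, hlt⟩ := exists_valley l (x + 1) hD
      rcases h.2 j hj with h1 | h1 <;> omega
    · have h1 := height_succ l hx
      cases h2 : l[x] with
      | U =>
        rw [h2] at h1
        simp only [Step.rise] at h1
        have := (ih (by omega)).1
        omega
      | D =>
        have hv : IsValley l (x + 1) := by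
          refine ⟨by omega, by simp [h2, List.getElem?_eq_getElem hx], ?_⟩
          rcases Nat.lt_or_ge (x + 1) l.length with h3 | h3
          · left
            rw [List.getElem?_eq_getElem h3] at hD ⊢
            cases h4 : l[x + 1] with
            | U => rfl
            | D => exact absurd (by rw [h4]) hD
          · right; omega
        rcases h.2 _ hv with h4 | h4 <;> omega

theorem exists_replicate_append (l : List Step) :
    ∃ p u, l = List.replicate p Step.U ++ u ∧ (u = [] ∨ u[0]? = some Step.D) := by
  induction l with
  | nil => exact ⟨0, [], rfl, Or.inl rfl⟩
  | cons s l ih =>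
    cases s with
    | D => exact ⟨0, _, rfl, Or.inr rfl⟩
    | U =>
      obtain ⟨p, u, h, hu⟩ := ih
      exact ⟨p + 1, u, by rw [h]; rfl, hu⟩

/-- "Leftmost" makes the end point of `u` a strict minimum; "lowest" keeps `l₂` above its start. -/
theorem IsMinimumPoint.decompose {l₁ l₂ : List Step} (h : IsMinimumPoint (l₁ ++ l₂) l₁.length) :
    (∃ p u, l₁ = List.replicate p Step.U ++ u ∧ Desc u) ∧ ¬ Low l₂ := by
  obtain ⟨p, u, rfl, hu⟩ := exists_replicate_append l₁
  have hu' : u[0]? = some Step.D := by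
    refine hu.resolve_left fun h0 => ?_
    subst h0
    have h1 := h.1.2.1
    have h2 := h.1.1
    simp only [List.append_nil, List.length_replicate] at h1 h2
    rw [List.getElem?_append_left (by simp; omega), List.getElem?_replicate, if_pos (by omega)] at h1
    simp at h1
  have hu0 : 0 < u.length := (List.getElem?_eq_some_iff.1 hu').1
  have hp : (List.replicate p Step.U ++ u ++ l₂)[p]? = some Step.D := by
    rw [List.append_assoc, List.getElem?_append_right (by simp), List.length_replicate,
      Nat.sub_self, List.getElem?_append_left hu0, hu']
  have key := fun {x} => h.height_le hp (x := x)
  have hh : ∀ i ≤ u.length, height (List.replicate p Step.U ++ u ++ l₂) (p + i) =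
      height (List.replicate p Step.U) p + height u i := by
    intro i hi
    have := height_append_right (List.replicate p Step.U) (u ++ l₂) i
    rw [List.length_replicate, height_append_left _ _ _ hi] at this
    rw [List.append_assoc, this]
  have hlen : (List.replicate p Step.U ++ u).length = p + u.length := by simp
  rw [hlen] at key
  refine ⟨⟨p, u, rfl, desc_of_forall_lt fun i hi => ?_⟩, ?_⟩
  · have := (key (x := p + i) (by omega) (by simp; omega)).2 (by omega)
    rw [hh _ le_rfl, hh _ hi.le] at this
    omega
  · rintro ⟨i, hi, hlt⟩
    have h1 := (key (x := p + u.length + i) (by omega) (by simp; omega)).1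
    have h2 := height_append_right (List.replicate p Step.U ++ u) l₂ i
    rw [hlen] at h2
    rw [height_append_left _ _ _ hlen.ge, h2] at h1
    omega

/-- All three factors are read off from the transform at m = 0, where it is evaluation at the empty
stack. -/
theorem map_ballotGF_append {K : Type*} [Field K] (φ : ℤ[X] →+* K)
    (hq : ∀ n, 0 < n → φ X ^ n ≠ 1) (l₁ l₂ : List Step)
    (h : IsMinimumPoint (l₁ ++ l₂) l₁.length) :
    φ (ballotGF (l₁ ++ l₂)) = φ (dyckGF l₁) *
      φ (ballotGFDU (l₂.count Step.U + l₂.count Step.D) (l₁.count Step.D)) * φ (ballotGF l₂) := by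
  obtain ⟨⟨p, u, rfl, hu⟩, hl⟩ := h.decompose
  obtain ⟨C, hC⟩ := hat_Phi_desc hq hu
  have hlen : l₂.count Step.U + l₂.count Step.D = l₂.length := by
    clear h hl
    induction l₂ with
    | nil => rfl
    | cons s l ih => cases s <;> simp <;> omega
  have hcount : (List.replicate p Step.U ++ u).count Step.D = u.count Step.D := by
    simp [List.count_replicate]
  have e1 := hC Anchorable (fun c => φ X ^ c) (fun _ h => h.1) l₂ 0
  -- With nothing after `u` and an empty last column prescribed, the transform on the right is 1, so
  -- `C 0` is the Dyck generating function.
  have e2 := hC (fun _ => False) (fun c => if c = 0 then 1 else 0) (fun _ h => h.elim) [] 0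
  -- The path D^(N₁) U^(M₂+N₂) produces the same factor `normG` as `l₂`, with coefficient 1 by `e5`.
  have e3 := hat_Phi_replicate (φ X) (ok := Anchorable) (fun c => φ X ^ c) (fun _ h => h.1)
    (u.count Step.D) (List.replicate l₂.length Step.U) 0
  have e4 : Phi (φ X) (fun _ => False) (fun c => if c = 0 then 1 else 0) [] =
      fun c => if c = 0 then 1 else 0 := by
    rw [Phi_of_not _ _ id]
    funext c
    simp [Psi, Wt]
  have e5 : Psi (φ X) Anchorable (fun c => φ X ^ c) (List.replicate l₂.length Step.U) 0 = 1 := by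
    rw [← List.append_nil (List.replicate _ _), Psi_replicate_append]
    simp [Psi, Wt]
  rw [hat_Phi_eq hq hl] at e1
  rw [e4, hat_single] at e2
  rw [hat_Phi_eq hq (not_low_replicate _), e5, List.length_replicate] at e3
  simp only [hat, Phi_apply_zero, zero_add, List.append_nil, mul_one, one_mul] at e1 e2 e3
  rw [ballotGFDU, map_ballotGF, map_ballotGF, map_ballotGF, map_dyckGF, hlen, hcount,
    List.append_assoc, Psi_replicate_append, Psi_replicate_append, e1, e2, e3]
  ring

end BallotTiling

theorem mainTheorem7 (l₁ l₂ : List BallotTiling.Step)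
    (h : BallotTiling.IsMinimumPoint (l₁ ++ l₂) l₁.length) :
    BallotTiling.ballotGF (l₁ ++ l₂) =
      BallotTiling.dyckGF l₁ *
        BallotTiling.ballotGFDU
          (l₂.count BallotTiling.Step.U + l₂.count BallotTiling.Step.D)
          (l₁.count BallotTiling.Step.D) *
        BallotTiling.ballotGF l₂ := by
  -- The argument divides by 1 - q^n, which is nonzero in the fraction field since X^n has positive
  -- degree.
  apply IsFractionRing.injective ℤ[X] (FractionRing ℤ[X])
  rw [map_mul, map_mul]
  refine BallotTiling.map_ballotGF_append (algebraMap ℤ[X] (FractionRing ℤ[X])) ?_ l₁ l₂ h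
  intro n hn h1
  rw [← map_pow, ← map_one (algebraMap ℤ[X] (FractionRing ℤ[X]))] at h1
  have h2 := congrArg natDegree (IsFractionRing.injective ℤ[X] (FractionRing ℤ[X]) h1)
  simp at h2
  omega
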